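/- Let $\Sigma=\{0,1\}$. An NPTM is a nondeterministic Turing machine all of whose computations on an input $x$ halt within polynomially (in $|x|$) many steps; its nondeterministic choices are binary guesses, and a computation path is named by its sequence of guesses. $\mathrm{acc}_M(x)$ is the set of accepting paths of $M$ on $x$. For a polynomial $p$, $M$ is $p$-balanced if for every input $x$ the set of its computation paths is precisely $\Sigma^{p(|x|)}$. $\mathrm{FP_t}$ is the class of total polynomial-time computable functions. Write $a\prec_{\rm lex}b$ if $b$ is the lexicographical successor of $a$. A total function $f:\Sigma^*\to\mathbb N$ belongs to $\mathrm{CLU\#P}$ if there are a polynomial $p$, a $p$-balanced NPTM $M$, functions $b,\top\in\mathrm{FP_t}$ and a 3-argument polynomial-time computable predicate $\prec$ such that for every $x\in\Sigma^*$ there is a bijection $h_x$ from $\Sigma^{p(|x|)}$ onto itself with: (i) $|b(x)|=|\top(x)|=p(|x|)$; (ii) $h_x(b(x))=0^{p(|x|)}$ and $h_x(\top(x))=1^{p(|x|)}$; (iii) for all $y,z\in\Sigma^{p(|x|)}$: $\prec(x,y,z)\iff h_x(y)\prec_{\rm lex}h_x(z)$; (iv) if $f(x)\neq 0$, then there are $\ell,u\in\Sigma^{p(|x|)}$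 with $\mathrm{acc}_M(x)=\{w\in\Sigma^{p(|x|)} : h_x(\ell)\le_{\rm lex}h_x(w)\le_{\rm lex}h_x(u)\}$; (v) $f(x)=|\mathrm{acc}_M(x)|$. $\mathrm{UP}$ is the class of languages $L=\{x:\mathrm{acc}_M(x)\ne\emptyset\}$ for NPTMs $M$ that have at most one accepting path on every input, and $\mathrm{coUP}=\{L:\Sigma^*\setminus L\in\mathrm{UP}\}$. $\mathrm{UPSV_t}$ is the class of total functions $f:\Sigma^*\to\Sigma^*$ for which there is an NPTM that on every input $x$ has exactly one accepting path, with output $f(x)$ on that path. A function $g:\Sigma^*\to\mathbb N$ is regarded as belonging to $\mathrm{FP_t}$ or $\mathrm{UPSV_t}$ if the function that maps $x$ to the binary representation of $g(x)$ does. Theorem. The following statements are equivalent: 1. $\mathrm{UP}=\mathrm{coUP}$. 2. $\mathrm{CLU\#P}$ is closed under increment: if $f\in\mathrm{CLU\#P}$, then $f+1\in\mathrm{CLU\#P}$. 3. $\mathrm{CLU\#P}$ is closed under addition of natural-number-valued $\mathrm{FP_t}$ functions: if $f\in\mathrm{CLU\#P}$ and $g:\Sigma^*\to\mathbb N$ is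 in $\mathrm{FP_t}$, then $f+g\in\mathrm{CLU\#P}$. 4. $\mathrm{CLU\#P}$ is closed under addition of natural-number-valued $\mathrm{UPSV_t}$ functions: if $f\in\mathrm{CLU\#P}$ and $g:\Sigma^*\to\mathbb N$ is in $\mathrm{UPSV_t}$, then $f+g\in\mathrm{CLU\#P}$. 5. $\mathrm{CLU\#P}$ is closed under addition: if $f,g\in\mathrm{CLU\#P}$, then $f+g\in\mathrm{CLU\#P}$. -/

import Mathlib

namespace ClusterComputing

open Turing

/-- Strings over the alphabet `{0, 1}`; `false` is the bit `0` and `true` is the bit `1`. -/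
abbrev Str : Type := List Bool

/-- The set of all strings of length `n`. -/
def strs (n : ℕ) : Set Str := {w | w.length = n}

/-- The strict length-lexicographical order on strings, with `0 < 1`. -/
def LexLt (a b : Str) : Prop := List.Shortlex (· < ·) a b

/-- The non-strict length-lexicographical order on strings. -/
def LexLe (a b : Str) : Prop := a = b ∨ LexLt a b

/-- `b` is the lexicographical successor of `a`. -/
def LexSucc (a b : Str) : Prop := LexLt a b ∧ ∀ c, ¬ (LexLt a c ∧ LexLt c b)

/-- A natural-number-valued function on the natural numbers that is given by a polynomial. -/
def IsPoly (p : ℕ → ℕ) : Prop :=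
  ∃ P : Polynomial ℝ, ∀ n : ℕ, (p n : ℝ) = P.eval (n : ℝ)

/-! ### Deterministic polynomial time -/

/-- Total polynomial-time computable functions from strings to strings. -/
def FPt : Set (Str → Str) :=
  {f | Nonempty (TM2ComputableInPolyTime (id : Str → List Bool) (id : Str → List Bool) f)}

/-- A triple of strings is written on the input tape as `x # y # z`;
`none` is the separator symbol `#`. -/
def encodeTriple (a : Str × Str × Str) : List (Option Bool) :=
  a.1.map some ++ none :: (a.2.1.map some ++ none :: a.2.2.map some)

/-- Three-argument polynomial-time computable predicates on strings. -/
def PolyTimePred₃ (r : Str → Str → Str → Bool) : Prop :=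
  Nonempty (TM2ComputableInPolyTime encodeTriple Computability.encodeBool
    (fun a : Str × Str × Str => r a.1 a.2.1 a.2.2))

/-! ### Nondeterministic machines -/

/-- A nondeterministic Turing machine with binary input and output alphabets: a finite
multi-stack Turing machine some of whose labels are marked as guessing. At a guessing label
the machine guesses a bit and executes the statement `tm.m l` if the bit is `0` and
the statement `alt l` if the bit is `1`; at every other label it executes `tm.m l` without
guessing. A halted computation accepts iff `accept` holds of the final internal state. -/
structure NTM extends TM2ComputableAux Bool Bool where
  /-- the labels at which the machine makes a binary guess -/
  guessing : tm.Λ → Bool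
  /-- the statement executed at a guessing label if the guessed bit is `1` -/
  alt : tm.Λ → tm.Stmt
  /-- the accepting internal states -/
  accept : tm.σ → Bool

namespace NTM

/-- The initial configuration on input `x`. -/
def init (M : NTM) (x : Str) : M.tm.Cfg := initList M.tm (x.map M.inputAlphabet.symm)

/-- `M.Run n w c c'`: the machine can pass from configuration `c` to configuration `c'` in
exactly `n` steps, and the sequence of bits guessed during these steps is `w`. -/
inductive Run (M : NTM) : ℕ → Str → M.tm.Cfg → M.tm.Cfg → Prop
  | refl (c : M.tm.Cfg) : Run M 0 [] c c
  | det {n : ℕ} {w : Str} {c' : M.tm.Cfg} (l : M.tm.Λ) (v : M.tm.σ)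
      (S : (k : M.tm.K) → List (M.tm.Γ k)) (hl : M.guessing l = false)
      (h : Run M n w (TM2.stepAux (M.tm.m l) v S) c') :
      Run M (n + 1) w (TM2.Cfg.mk (some l) v S) c'
  | guess {n : ℕ} {w : Str} {c' : M.tm.Cfg} (l : M.tm.Λ) (v : M.tm.σ)
      (S : (k : M.tm.K) → List (M.tm.Γ k)) (b : Bool) (hl : M.guessing l = true)
      (h : Run M n w (TM2.stepAux (if b then M.alt l else M.tm.m l) v S) c') :
      Run M (n + 1) (b :: w) (TM2.Cfg.mk (some l) v S) c'

/-- `M.HaltsWith x w c`: on input `x` and nondeterministic guesses `w` (exactly these, all of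
them used), `M` halts in the configuration `c`. -/
def HaltsWith (M : NTM) (x w : Str) (c : M.tm.Cfg) : Prop :=
  (∃ n, M.Run n w (M.init x) c) ∧ c.l = none

/-- The computation paths of `M` on input `x`, each named by its nondeterministic guesses. -/
def paths (M : NTM) (x : Str) : Set Str := {w | ∃ c, M.HaltsWith x w c}

/-- The accepting paths of `M` on input `x`. -/
def acc (M : NTM) (x : Str) : Set Str := {w | ∃ c, M.HaltsWith x w c ∧ M.accept c.var = true}

/-- `M.Outputs x w s`: on input `x` the path `w` is accepting, and `s` is on the output tape
when it halts. -/
def Outputs (M : NTM) (x w s : Str) : Prop :=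
  ∃ c, M.HaltsWith x w c ∧ M.accept c.var = true ∧ (c.stk M.tm.k₁).map M.outputAlphabet = s

/-- `M` is polynomial-time bounded: no computation on an input `x`, whatever is guessed, takes
more than polynomially (in the length of `x`) many steps. -/
def IsPolyTime (M : NTM) : Prop :=
  ∃ t : Polynomial ℕ, ∀ (x : Str) (n : ℕ) (w : Str) (c : M.tm.Cfg),
    M.Run n w (M.init x) c → n ≤ t.eval x.length

/-- `M` is `p`-balanced: on every input `x` the guesses along the computation paths are
precisely the strings of length `p |x|`. -/
def IsBalanced (M : NTM) (p : ℕ → ℕ) : Prop := ∀ x : Str, M.paths x = strs (p x.length)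

end NTM

/-! ### The complexity classes -/

/-- Unambiguous polynomial time. -/
def UP : Set (Set Str) :=
  {L | ∃ M : NTM, M.IsPolyTime ∧ (∀ x, (M.acc x).Subsingleton) ∧
    ∀ x, x ∈ L ↔ (M.acc x).Nonempty}

/-- The complements of the languages in `UP`. -/
def coUP : Set (Set Str) := {L | Lᶜ ∈ UP}

/-- Partial functions computed by unambiguous polynomial-time machines; the value `none` means
that the function is undefined. -/
def UPSVp : Set (Str → Option Str) :=
  {f | ∃ M : NTM, M.IsPolyTime ∧ ∀ x, (M.acc x).Subsingleton ∧
    (∀ w ∈ M.acc x, ∃ s, M.Outputs x w s ∧ f x = some s) ∧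
    (M.acc x = ∅ → f x = none)}

/-- Total functions computed by unambiguous polynomial-time machines. -/
def UPSVt : Set (Str → Str) := {f | (fun x => some (f x)) ∈ UPSVp}

/-- A natural-number-valued function is regarded as a string-valued one by writing its values
in binary. -/
def natValued (g : Str → ℕ) : Str → Str := fun x => Computability.encodeNat (g x)

/-- The class `CLU#P`. -/
def CLUSharpP : Set (Str → ℕ) :=
  {f | ∃ p : ℕ → ℕ, IsPoly p ∧
    ∃ M : NTM, M.IsPolyTime ∧ M.IsBalanced p ∧
    ∃ bot ∈ FPt, ∃ top ∈ FPt,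
    ∃ prec : Str → Str → Str → Bool, PolyTimePred₃ prec ∧
    ∀ x : Str, ∃ h : Str → Str, Set.BijOn h (strs (p x.length)) (strs (p x.length)) ∧
      ((bot x).length = p x.length ∧ (top x).length = p x.length) ∧
      (h (bot x) = List.replicate (p x.length) false ∧
        h (top x) = List.replicate (p x.length) true) ∧
      (∀ y ∈ strs (p x.length), ∀ z ∈ strs (p x.length),
        prec x y z = true ↔ LexSucc (h y) (h z)) ∧
      (f x ≠ 0 → ∃ l ∈ strs (p x.length), ∃ u ∈ strs (p x.length),
        M.acc x = {w | w ∈ strs (p x.length) ∧ LexLe (h l) (h w) ∧ LexLe (h w) (h u)}) ∧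
      f x = (M.acc x).ncard}

end ClusterComputing

/-! For a fixed input, a value of a function in CLU#P is the length of an interval in a linear order
on the strings of one length. Of this order only the least element, the greatest element and the
successor relation are required to be computable in polynomial time; ranks and comparisons need not
be. The argument therefore works locally: that a string is the last element of the interval is
certified by exhibiting it together with its neighbour. `mem_cluSharpP_iff` brings the class into
this form, with a polynomial-time set of accepted strings in place of the machine and a ranking in
place of the bijection.

Statements 5, 4, 3, 2 imply each other in this order because of inclusions: a UPSV_t function with
natural values is in CLU#P (`upsvt_mem_cluSharpP`), FP_t is contained in UPSV_t
(`fpt_subset_upsvt`), and the constant 1 is in FP_t.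

From 2 to 1 (`up_eq_coUP_of_increment`): for L in UP the characteristic function is in CLU#P, since
a unique witness is an interval of length one. After the increment the cluster has one element
outside L and two elements in L. It has one element exactly if some string is both its first and its
last element, and such a string, listed with its two neighbours, is a unique certificate. So the
complement of L is in UP.

From 1 to 5: the support of f in CLU#P is in UP (`support_mem_up`), so by hypothesis its complement
is too. Hence every input has exactly one certificate that either names the last element of the
cluster and its cyclic successor, or proves that the cluster is empty. With the certificate at hand
the order can be rotated so that the cluster becomes a final segment (`exists_certForm_final`). Two
functions are added by laying two orders end to end, the second one reversed, so that a final
segment meets an initial one (`add_mem_of_final`). Orders that depend on a unique certificate are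
admissible, because the certificate can be made a prefix of the string, with a harmless order and no
accepted strings behind every wrong prefix (`CertForm.mem`).

The rest is a calculus for machines. Program fragments acting on registers are combined by
flowcharts, and they can call or simulate machines. This makes polynomial time closed under
composition, pairing, case distinction and length-bounded recursion, and it translates between
nondeterministic machines and polynomial-time predicates of an input and a certificate
(`exists_pt_outputs`, `exists_ntm`). -/

namespace ClusterComputing

open Turing

set_option linter.unusedSectionVars false

section

/-! ### Runs with guesses -/

section Runs

variable {K : Type} [DecidableEq K] {Γ : K → Type} {Λ σ : Type}

/-- Runs of a nondeterministic multi-stack machine with guessing labels: `NRun g m a n w c c'` says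
that `c'` is reached from `c` in exactly `n` steps with the guesses `w`. -/
inductive NRun (g : Λ → Bool) (m a : Λ → TM2.Stmt Γ Λ σ) :
    ℕ → Str → TM2.Cfg Γ Λ σ → TM2.Cfg Γ Λ σ → Prop
  | refl (c : TM2.Cfg Γ Λ σ) : NRun g m a 0 [] c c
  | det {n : ℕ} {w : Str} {c' : TM2.Cfg Γ Λ σ} (l : Λ) (v : σ) (S : ∀ k, List (Γ k))
      (hl : g l = false) (h : NRun g m a n w (TM2.stepAux (m l) v S) c') :
      NRun g m a (n + 1) w ⟨some l, v, S⟩ c'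
  | guess {n : ℕ} {w : Str} {c' : TM2.Cfg Γ Λ σ} (l : Λ) (v : σ) (S : ∀ k, List (Γ k)) (b : Bool)
      (hl : g l = true) (h : NRun g m a n w (TM2.stepAux (if b then a l else m l) v S) c') :
      NRun g m a (n + 1) (b :: w) ⟨some l, v, S⟩ c'

variable {g : Λ → Bool} {m a : Λ → TM2.Stmt Γ Λ σ}

theorem NRun.trans {n n' : ℕ} {w w' : Str} {c c' c'' : TM2.Cfg Γ Λ σ} (h : NRun g m a n w c c')
    (h' : NRun g m a n' w' c' c'') : NRun g m a (n + n') (w ++ w') c c'' := by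
  induction h with
  | refl c => simpa using h'
  | det l v S hl h ih => rw [Nat.add_right_comm]; exact .det l v S hl (ih h')
  | guess l v S b hl h ih => rw [Nat.add_right_comm]; exact .guess l v S b hl (ih h')

theorem NRun.trans' {n n' N : ℕ} {w w' W : Str} {c c' c'' : TM2.Cfg Γ Λ σ}
    (h : NRun g m a n w c c') (h' : NRun g m a n' w' c' c'') (hN : N = n + n')
    (hW : W = w ++ w') : NRun g m a N W c c'' := by
  subst hN hW; exact h.trans h'

/-- A run that is compatible with a halting run is an initial part of it. -/
theorem NRun.prefix_of_halt {n N : ℕ} {w W : Str} {c c₁ c₂ : TM2.Cfg Γ Λ σ}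
    (h : NRun g m a n w c c₁) (H : NRun g m a N W c c₂) (h2 : c₂.l = none)
    (hw : w <+: W ∨ W <+: w) :
    ∃ k W', N = n + k ∧ W = w ++ W' ∧ NRun g m a k W' c₁ c₂ := by
  induction h generalizing N W with
  | refl c => exact ⟨N, W, by simp, by simp, H⟩
  | det l v S hl h ih =>
    cases H with
    | refl => simp at h2
    | det _ _ _ _ H =>
      obtain ⟨k, W', rfl, rfl, r⟩ := ih H hw
      exact ⟨k, W', by omega, rfl, r⟩
    | guess _ _ _ _ hl' => simp [hl] at hl'
  | guess l v S b hl h ih =>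
    cases H with
    | refl => simp at h2
    | det _ _ _ hl' H => simp [hl] at hl'
    | guess _ _ _ b' _ H =>
      simp only [List.cons_prefix_cons] at hw
      obtain rfl : b = b' := by rcases hw with hw | hw <;> simp [hw.1]
      obtain ⟨k, W', rfl, rfl, r⟩ := ih H (by simpa using hw)
      exact ⟨k, W', by omega, rfl, r⟩

theorem NRun.eq_of_halted {n : ℕ} {w : Str} {c c' : TM2.Cfg Γ Λ σ} (h : NRun g m a n w c c')
    (hc : c.l = none) : n = 0 ∧ w = [] ∧ c = c' := by
  cases h <;> simp_all

/-- Once the guesses are fixed a machine is deterministic. In particular no name of a path is a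
proper prefix of the name of another one. -/
theorem NRun.eq_of_halt {n N : ℕ} {w W : Str} {c c₁ c₂ : TM2.Cfg Γ Λ σ}
    (h : NRun g m a n w c c₁) (H : NRun g m a N W c c₂) (h1 : c₁.l = none) (h2 : c₂.l = none)
    (hw : w <+: W ∨ W <+: w) : n = N ∧ w = W ∧ c₁ = c₂ := by
  obtain ⟨k, W', rfl, rfl, r⟩ := h.prefix_of_halt H h2 hw
  obtain ⟨rfl, rfl, rfl⟩ := r.eq_of_halted h1
  simp

/-- With the guesses `w` at hand, a run of any length exists unless the machine halts or
runs out of guesses. -/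
theorem NRun.exists_run (g : Λ → Bool) (m a : Λ → TM2.Stmt Γ Λ σ) (N : ℕ) (w : Str)
    (c : TM2.Cfg Γ Λ σ) :
    ∃ n w₁ w₂ c', w = w₁ ++ w₂ ∧ NRun g m a n w₁ c c' ∧ n ≤ N ∧
      (n = N ∨ c'.l = none ∨ ∃ l, c'.l = some l ∧ g l = true ∧ w₂ = []) := by
  induction N generalizing w c with
  | zero => exact ⟨0, [], w, c, rfl, .refl c, le_rfl, .inl rfl⟩
  | succ N ih =>
    obtain ⟨_ | l, v, S⟩ := c
    · exact ⟨0, [], w, _, rfl, .refl _, by simp, .inr (.inl rfl)⟩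
    · cases hl : g l
      · obtain ⟨n, w₁, w₂, c', rfl, r, hn, h⟩ := ih w (TM2.stepAux (m l) v S)
        exact ⟨n + 1, w₁, w₂, c', rfl, .det l v S hl r, by omega, by
          rcases h with h | h | h <;> simp_all⟩
      · cases w with
        | nil => exact ⟨0, [], [], _, rfl, .refl _, by simp, .inr (.inr ⟨l, rfl, hl, rfl⟩)⟩
        | cons b w =>
          obtain ⟨n, w₁, w₂, c', rfl, r, hn, h⟩ :=
            ih w (TM2.stepAux (if b then a l else m l) v S)
          exact ⟨n + 1, b :: w₁, w₂, c', rfl, .guess l v S b hl r, by omega, by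
            rcases h with h | h | h <;> simp_all⟩

/-- The number of push instructions in a statement. -/
def pushes : TM2.Stmt Γ Λ σ → ℕ
  | .push _ _ q => pushes q + 1
  | .peek _ _ q => pushes q
  | .pop _ _ q => pushes q
  | .load _ q => pushes q
  | .branch _ q q' => pushes q + pushes q'
  | .goto _ => 0
  | .halt => 0

theorem length_stepAux_le (q : TM2.Stmt Γ Λ σ) (v : σ) (S : ∀ k, List (Γ k)) (k : K) :
    ((TM2.stepAux q v S).stk k).length ≤ (S k).length + pushes q := by
  induction q generalizing v S with
  | push k' f q ih =>
    refine (ih _ _).trans ?_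
    by_cases h : k = k'
    · subst h; simp [pushes]; omega
    · simp [pushes, h]
      try omega
  | peek k' f q ih => exact ih _ _
  | pop k' f q ih =>
    refine (ih _ _).trans ?_
    by_cases h : k = k'
    · subst h; simp [pushes]
    · simp [pushes, h]
  | load f q ih => exact ih _ _
  | branch f q q' ih ih' =>
    simp only [TM2.stepAux, pushes]
    cases f v
    · exact (ih' _ _).trans (by omega)
    · exact (ih _ _).trans (by omega)
  | goto f => simp [TM2.stepAux]
  | halt => simp [TM2.stepAux]

/-- A step executes a single statement and so pushes at most as often as this statement contains
push instructions; the sum over all labels is a bound independent of the label. Time bounds turn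
into length bounds in this way. -/
theorem NRun.length_stk_le [Fintype Λ] {n : ℕ} {w : Str} {c c' : TM2.Cfg Γ Λ σ}
    (h : NRun g m a n w c c') (k : K) :
    (c'.stk k).length ≤ (c.stk k).length + n * ∑ l, (pushes (m l) + pushes (a l)) := by
  have key : ∀ l, pushes (m l) + pushes (a l) ≤ ∑ l, (pushes (m l) + pushes (a l)) :=
    fun l => Finset.single_le_sum (f := fun l => pushes (m l) + pushes (a l))
      (fun _ _ => Nat.zero_le _) (Finset.mem_univ l)
  induction h with
  | refl c => simp
  | det l v S hl h ih =>
    have h1 := length_stepAux_le (m l) v S k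
    have h2 := key l
    rw [Nat.succ_mul]
    simp only at ih ⊢
    omega
  | guess l v S b hl h ih =>
    have h1 := length_stepAux_le (if b then a l else m l) v S k
    have h2 := key l
    have h3 : pushes (if b then a l else m l) ≤ pushes (m l) + pushes (a l) := by
      cases b <;> simp
    rw [Nat.succ_mul]
    simp only at ih ⊢
    omega

theorem NRun.length_guesses_le {n : ℕ} {w : Str} {c c' : TM2.Cfg Γ Λ σ}
    (h : NRun g m a n w c c') : w.length ≤ n := by
  induction h with
  | refl => simp
  | det _ _ _ _ _ ih => omega
  | guess _ _ _ _ _ _ ih => simpa using ih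

/-- `TM2ComputableInPolyTime` speaks of iterating `TM2.step` in `Option`. The value `none` is
absorbing, so an iteration that ends in a configuration is a genuine run. -/
theorem NRun.of_iterate_step (hg : ∀ l, g l = false) {n : ℕ} {c c' : TM2.Cfg Γ Λ σ}
    (h : ((flip bind (TM2.step m))^[n]) (some c) = some c') : NRun g m a n [] c c' := by
  induction n generalizing c with
  | zero => cases h; exact .refl _
  | succ n ih =>
    obtain ⟨_ | l, v, S⟩ := c
    · exfalso
      rw [Function.iterate_succ_apply] at h
      have : ∀ n, ((flip bind (TM2.step m))^[n]) (none : Option (TM2.Cfg Γ Λ σ)) = none := by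
        intro n
        induction n with
        | zero => rfl
        | succ n ih => rw [Function.iterate_succ_apply]; exact ih
      have h2 : flip bind (TM2.step m) (some (⟨none, v, S⟩ : TM2.Cfg Γ Λ σ)) = none := rfl
      rw [h2, this] at h
      cases h
    · exact .det l v S (hg l) (ih h)

theorem NRun.iterate_step {n : ℕ} {c c' : TM2.Cfg Γ Λ σ} {w : Str}
    (h : NRun g m a n w c c') (hw : w = []) :
    ((flip bind (TM2.step m))^[n]) (some c) = some c' := by
  induction h with
  | refl => rfl
  | det l v S hl h ih => exact ih hw
  | guess => cases hw

end Runs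

/-- The rules are the same; `NRun` takes the program unbundled, so that it also applies to
fragments, which are not machines. -/
theorem NTM.run_iff_nrun {M : NTM} {n : ℕ} {w : Str} {c c' : M.tm.Cfg} :
    M.Run n w c c' ↔ NRun (K := M.tm.K) M.guessing M.tm.m M.alt n w c c' := by
  constructor
  · intro h
    induction h with
    | refl => exact .refl _
    | det l v S hl h ih => exact .det l v S hl ih
    | guess l v S b hl h ih => exact .guess l v S b hl ih
  · intro h
    induction h with
    | refl => exact .refl _
    | det l v S hl h ih => exact .det l v S hl ih
    | guess l v S b hl h ih => exact .guess l v S b hl ih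

/-! ### Embedding one program into another -/

section Translation

variable {K K' : Type} [DecidableEq K] [DecidableEq K'] {Γ : K → Type} {Γ' : K' → Type}
  {Λ Λ' σ σ' : Type}

/-- Data for the translation of statements of one machine to statements of another one. -/
structure Tr (Γ : K → Type) (Γ' : K' → Type) (Λ Λ' σ σ' : Type) where
  e : K → K'
  φ : ∀ k, Γ k → Γ' (e k)
  ψ : ∀ k, Γ' (e k) → Γ k
  lab : Λ → Λ'
  get : σ' → σ
  upd : σ' → σ → σ'

/-- Translation of a statement; `halt` becomes `ex`. -/
def Tr.stmt (E : Tr Γ Γ' Λ Λ' σ σ') (ex : TM2.Stmt Γ' Λ' σ') : TM2.Stmt Γ Λ σ → TM2.Stmt Γ' Λ' σ'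
  | .push k f q => .push (E.e k) (fun s => E.φ k (f (E.get s))) (E.stmt ex q)
  | .peek k f q =>
    .peek (E.e k) (fun s o => E.upd s (f (E.get s) (o.map (E.ψ k)))) (E.stmt ex q)
  | .pop k f q => .pop (E.e k) (fun s o => E.upd s (f (E.get s) (o.map (E.ψ k)))) (E.stmt ex q)
  | .load f q => .load (fun s => E.upd s (f (E.get s))) (E.stmt ex q)
  | .branch f q q' => .branch (fun s => f (E.get s)) (E.stmt ex q) (E.stmt ex q')
  | .goto f => .goto (fun s => E.lab (f (E.get s)))
  | .halt => ex

/-- The states and stores of the first machine are represented by `emb` and `mrg`. -/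
structure Tr.Sound (E : Tr Γ Γ' Λ Λ' σ σ') (emb : σ → σ')
    (mrg : (∀ k, List (Γ k)) → ∀ k, List (Γ' k)) : Prop where
  ψ_φ : ∀ k x, E.ψ k (E.φ k x) = x
  get_emb : ∀ v, E.get (emb v) = v
  upd_emb : ∀ v v', E.upd (emb v) v' = emb v'
  mrg_e : ∀ T k, mrg T (E.e k) = (T k).map (E.φ k)
  mrg_ne : ∀ T k l k', k' ≠ E.e k → mrg (Function.update T k l) k' = mrg T k'

/-- The configuration of the second machine that represents a configuration of the first one;
after halting, `ex` is executed. -/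
def Tr.cfg (E : Tr Γ Γ' Λ Λ' σ σ') (ex : TM2.Stmt Γ' Λ' σ') (emb : σ → σ')
    (mrg : (∀ k, List (Γ k)) → ∀ k, List (Γ' k)) (c : TM2.Cfg Γ Λ σ) : TM2.Cfg Γ' Λ' σ' :=
  match c.l with
  | some l => ⟨some (E.lab l), emb c.var, mrg c.stk⟩
  | none => TM2.stepAux ex (emb c.var) (mrg c.stk)

variable {E : Tr Γ Γ' Λ Λ' σ σ'} {ex : TM2.Stmt Γ' Λ' σ'} {emb : σ → σ'}
  {mrg : (∀ k, List (Γ k)) → ∀ k, List (Γ' k)}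

theorem Tr.Sound.mrg_update (hE : E.Sound emb mrg) (T : ∀ k, List (Γ k)) (k : K)
    (l : List (Γ k)) : mrg (Function.update T k l) =
      Function.update (mrg T) (E.e k) (l.map (E.φ k)) := by
  funext k'
  by_cases h : k' = E.e k
  · subst h; rw [hE.mrg_e]; simp
  · rw [hE.mrg_ne _ _ _ _ h, Function.update_of_ne h]

theorem Tr.Sound.stepAux_stmt (hE : E.Sound emb mrg) (ex : TM2.Stmt Γ' Λ' σ')
    (q : TM2.Stmt Γ Λ σ) (v : σ) (T : ∀ k, List (Γ k)) :
    TM2.stepAux (E.stmt ex q) (emb v) (mrg T) = E.cfg ex emb mrg (TM2.stepAux q v T) := by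
  have hψ : ∀ k (o : Option (Γ k)), (o.map (E.φ k)).map (E.ψ k) = o := by
    intro k o; cases o <;> simp [hE.ψ_φ]
  induction q generalizing v T with
  | push k f q ih =>
    simp only [Tr.stmt, TM2.stepAux, hE.get_emb, ← ih, hE.mrg_update, hE.mrg_e, List.map_cons]
  | peek k f q ih =>
    simp only [Tr.stmt, TM2.stepAux, hE.get_emb, ← ih, hE.mrg_e, hE.upd_emb, List.head?_map, hψ]
  | pop k f q ih =>
    simp only [Tr.stmt, TM2.stepAux, hE.get_emb, ← ih, hE.mrg_update, hE.mrg_e, hE.upd_emb,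
      List.head?_map, hψ, List.map_tail]
  | load f q ih => simp only [Tr.stmt, TM2.stepAux, hE.get_emb, ← ih, hE.upd_emb]
  | branch f q q' ih ih' =>
    simp only [Tr.stmt, TM2.stepAux, hE.get_emb]
    cases f v <;> simp [ih, ih']
  | goto f => simp only [Tr.stmt, TM2.stepAux, hE.get_emb, Tr.cfg]
  | halt => simp only [Tr.stmt, TM2.stepAux, Tr.cfg]

/-- Steps correspond one to one. Since `halt` is replaced by `ex` inside the statements, the last
step of the embedded program already executes `ex`, and no step is added. -/
theorem NRun.translate {g : Λ → Bool} {m a : Λ → TM2.Stmt Γ Λ σ} {g' : Λ' → Bool}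
    {m' a' : Λ' → TM2.Stmt Γ' Λ' σ'} (hE : E.Sound emb mrg) (hg : ∀ l, g' (E.lab l) = g l)
    (hm : ∀ l, m' (E.lab l) = E.stmt ex (m l)) (ha : ∀ l, a' (E.lab l) = E.stmt ex (a l))
    {n : ℕ} {w : Str} {c c' : TM2.Cfg Γ Λ σ} (h : NRun g m a n w c c') :
    NRun g' m' a' n w (E.cfg ex emb mrg c) (E.cfg ex emb mrg c') := by
  induction h with
  | refl c => exact .refl _
  | det l v S hl h ih =>
    refine .det _ _ _ ((hg l).trans hl) ?_
    rw [hm, hE.stepAux_stmt]; exact ih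
  | guess l v S b hl h ih =>
    refine .guess _ _ _ b ((hg l).trans hl) ?_
    rw [hm, ha, ← apply_ite (E.stmt ex), hE.stepAux_stmt]; exact ih

end Translation

end

/-! ### Program fragments and flowcharts -/

section

/-- A program fragment that works on registers, indexed by `ι` and holding lists over `A`, and on
stacks of its own, which are empty before and after its execution. -/
structure Frag (A ι : Type) where
  H : Type
  [decH : DecidableEq H]
  [finH : Fintype H]
  Γ : H → Type
  Λ : Type
  [finΛ : Fintype Λ]
  σ : Type
  [finσ : Fintype σ]
  guessing : Λ → Bool
  m : Λ → TM2.Stmt (Sum.elim (fun _ : ι => A) Γ) Λ σ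
  alt : Λ → TM2.Stmt (Sum.elim (fun _ : ι => A) Γ) Λ σ
  main : Λ
  s0 : σ

namespace Frag

attribute [instance] Frag.decH Frag.finH Frag.finΛ Frag.finσ

variable {A ι : Type} [DecidableEq ι]

/-- The contents of all stacks when the registers contain `S` and the other stacks are empty. -/
def store (F : Frag A ι) (S : ι → List A) :
    ∀ k : ι ⊕ F.H, List (Sum.elim (fun _ : ι => A) F.Γ k)
  | .inl i => S i
  | .inr _ => []

/-- `F.Exec S w S' n`: with the guesses `w`, the fragment `F` transforms the registers `S` into
`S'` in exactly `n` steps. -/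
def Exec (F : Frag A ι) (S : ι → List A) (w : Str) (S' : ι → List A) (n : ℕ) : Prop :=
  NRun F.guessing F.m F.alt n w ⟨some F.main, F.s0, F.store S⟩ ⟨none, F.s0, F.store S'⟩

theorem store_update (F : Frag A ι) (S : ι → List A) (i : ι) (l : List A) :
    F.store (Function.update S i l) = Function.update (F.store S) (.inl i) l := by
  funext k
  rcases k with j | h
  · by_cases hj : j = i
    · subst hj
      exact (Function.update_self _ _ _).trans (Function.update_self (Sum.inl j) l (F.store S)).symm
    · have h := Function.update_of_ne (a := (Sum.inl j : ι ⊕ F.H)) (a' := Sum.inl i)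
        (by simpa using hj) l (F.store S)
      exact (Function.update_of_ne hj l S).trans h.symm
  · exact (Function.update_of_ne (a := (Sum.inr h : ι ⊕ F.H)) (a' := Sum.inl i) (by simp) l (F.store S)).symm

section Graph

variable [Fintype A] {V : Type} [Fintype V] [DecidableEq V] (F : V → Frag A ι)
  (reg : V → Option ι) (nx : V → Option A → Option V) (v₀ : V)

/-- The translation of the statements of the fragment at node `v` in a flowchart. -/
def nodeTr (v : V) : Tr (Sum.elim (fun _ : ι => A) (F v).Γ)
    (Sum.elim (fun _ : ι => A) (fun h : Σ v, (F v).H => (F h.1).Γ h.2))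
    (F v).Λ (Σ v, (F v).Λ) (F v).σ ((∀ v, (F v).σ) × Option A) where
  e := Sum.map id fun h => ⟨v, h⟩
  φ k := match k with
    | .inl _ => id
    | .inr _ => id
  ψ k := match k with
    | .inl _ => id
    | .inr _ => id
  lab l := ⟨v, l⟩
  get s := s.1 v
  upd s a := (Function.update s.1 v a, s.2)

/-- The jump to the next node of a flowchart. -/
def jump (v : V) : TM2.Stmt
    (Sum.elim (fun _ : ι => A) (fun h : Σ v, (F v).H => (F h.1).Γ h.2))
    (Σ v, (F v).Λ) ((∀ v, (F v).σ) × Option A) :=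
  .branch (fun s => (nx v s.2).isNone) (.load (fun s => (s.1, none)) .halt)
    (.goto fun s => match nx v s.2 with
      | some v' => ⟨v', (F v').main⟩
      | none => ⟨v₀, (F v₀).main⟩)

/-- What a flowchart does after the execution of the fragment at a node. -/
def exit (v : V) : TM2.Stmt
    (Sum.elim (fun _ : ι => A) (fun h : Σ v, (F v).H => (F h.1).Γ h.2))
    (Σ v, (F v).Λ) ((∀ v, (F v).σ) × Option A) :=
  match reg v with
  | some i => .pop (.inl i) (fun s o => (s.1, o)) (jump F nx v₀ v)
  | none => .load (fun s => (s.1, none)) (jump F nx v₀ v)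

/-- The flowchart with a fragment `F v` at each node `v`: after its execution, the register `reg v`
is popped (if there is one), and `nx v` determines the next node (if there is one). -/
def graph : Frag A ι where
  H := Σ v, (F v).H
  Γ h := (F h.1).Γ h.2
  Λ := Σ v, (F v).Λ
  σ := (∀ v, (F v).σ) × Option A
  guessing l := (F l.1).guessing l.2
  m l := (nodeTr F l.1).stmt (exit F reg nx v₀ l.1) ((F l.1).m l.2)
  alt l := (nodeTr F l.1).stmt (exit F reg nx v₀ l.1) ((F l.1).alt l.2)
  main := ⟨v₀, (F v₀).main⟩
  s0 := (fun v => (F v).s0, none)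

/-- The stacks of a flowchart when those of the node `v` are given and the others are empty. -/
def nodeMrg (v : V) (T : ∀ k : ι ⊕ (F v).H, List (Sum.elim (fun _ : ι => A) (F v).Γ k)) :
    ∀ k : ι ⊕ (Σ v, (F v).H),
      List (Sum.elim (fun _ : ι => A) (fun h : Σ v, (F v).H => (F h.1).Γ h.2) k)
  | .inl i => T (.inl i)
  | .inr ⟨u, h⟩ => if e : v = u then
      (e ▸ fun h' : (F v).H => (T (.inr h') : List ((F v).Γ h')) :
        ∀ h' : (F u).H, List ((F u).Γ h')) h else []

theorem nodeMrg_self (v : V)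
    (T : ∀ k : ι ⊕ (F v).H, List (Sum.elim (fun _ : ι => A) (F v).Γ k)) (h : (F v).H) :
    nodeMrg F v T (.inr ⟨v, h⟩) = T (.inr h) := dif_pos rfl

theorem nodeMrg_ne {v u : V} (huv : v ≠ u)
    (T : ∀ k : ι ⊕ (F v).H, List (Sum.elim (fun _ : ι => A) (F v).Γ k)) (h : (F u).H) :
    nodeMrg F v T (.inr ⟨u, h⟩) = [] := dif_neg huv

/-- While node `v` is at work, all other nodes rest in their initial states with empty private
stacks. As `Exec` makes a fragment restore its own initial state and stacks, a node can be entered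
any number of times. -/
theorem nodeTr_sound (v : V) (o : Option A) :
    (nodeTr F v).Sound (fun s => (Function.update (fun v => (F v).s0) v s, o)) (nodeMrg F v) where
  ψ_φ k x := by rcases k with i | h <;> rfl
  get_emb s := by simp [nodeTr]
  upd_emb s s' := by simp [nodeTr]
  mrg_e T k := by
    rcases k with i | h
    · exact (List.map_id (T (.inl i))).symm
    · exact (nodeMrg_self F v T h).trans (List.map_id (T (.inr h))).symm
  mrg_ne T k l k' hk := by
    rcases k' with i' | ⟨u, h'⟩
    · refine Function.update_of_ne ?_ _ _
      rintro rfl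
      exact hk rfl
    · by_cases hu : v = u
      · subst hu
        rw [nodeMrg_self, nodeMrg_self, Function.update_of_ne]
        rintro rfl
        exact hk rfl
      · rw [nodeMrg_ne F hu, nodeMrg_ne F hu]

theorem nodeMrg_store (v : V) (S : ι → List A) :
    nodeMrg F v ((F v).store S) = (graph F reg nx v₀).store S := by
  funext k
  rcases k with i | ⟨u, h⟩
  · rfl
  · by_cases hu : v = u
    · subst hu; exact nodeMrg_self _ _ _ _
    · exact nodeMrg_ne _ hu _ _

/-- Runs of a flowchart from node `v`. -/
inductive GRun : V → (ι → List A) → Str → (ι → List A) → ℕ → Prop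
  | halt {v S w S₁ n} (h : (F v).Exec S w S₁ n) (hr : reg v = none) (hn : nx v none = none) :
      GRun v S w S₁ n
  | halt_pop {v S w S₁ n i} (h : (F v).Exec S w S₁ n) (hr : reg v = some i)
      (hn : nx v (S₁ i).head? = none) : GRun v S w (Function.update S₁ i (S₁ i).tail) n
  | next {v S w S₁ n v' w' S' n'} (h : (F v).Exec S w S₁ n) (hr : reg v = none)
      (hn : nx v none = some v') (h' : GRun v' S₁ w' S' n') : GRun v S (w ++ w') S' (n + n')
  | next_pop {v S w S₁ n i v' w' S' n'} (h : (F v).Exec S w S₁ n) (hr : reg v = some i)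
      (hn : nx v (S₁ i).head? = some v')
      (h' : GRun v' (Function.update S₁ i (S₁ i).tail) w' S' n') : GRun v S (w ++ w') S' (n + n')

variable {F reg nx v₀}

theorem exec_node {v : V} {S S' : ι → List A} {w : Str} {n : ℕ} (h : (F v).Exec S w S' n)
    (o : Option A) {c : TM2.Cfg (Sum.elim (fun _ : ι => A) (graph F reg nx v₀).Γ)
      (graph F reg nx v₀).Λ (graph F reg nx v₀).σ}
    (hc : TM2.stepAux (exit F reg nx v₀ v) (fun v => (F v).s0, o)
      ((graph F reg nx v₀).store S') = c) :
    NRun (graph F reg nx v₀).guessing (graph F reg nx v₀).m (graph F reg nx v₀).alt n w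
      ⟨some ⟨v, (F v).main⟩, (fun v => (F v).s0, o), (graph F reg nx v₀).store S⟩
      c := by
  subst hc
  have := NRun.translate (g := (F v).guessing) (m := (F v).m) (a := (F v).alt) (g' := (graph F reg nx v₀).guessing) (m' := (graph F reg nx v₀).m)
    (a' := (graph F reg nx v₀).alt) (ex := exit F reg nx v₀ v) (nodeTr_sound F v o)
    (fun _ => rfl) (fun _ => rfl) (fun _ => rfl) h
  simp only [Tr.cfg, nodeMrg_store F reg nx v₀, Function.update_eq_self] at this
  exact this

theorem stepAux_exit_none {v : V} (h : reg v = none) (hn : nx v none = none)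
    (s : ∀ v, (F v).σ) (o : Option A)
    (T : ∀ k, List (Sum.elim (fun _ : ι => A) (fun h : Σ v, (F v).H => (F h.1).Γ h.2) k)) :
    TM2.stepAux (exit F reg nx v₀ v) (s, o) T = ⟨none, (s, none), T⟩ := by
  simp [exit, jump, h, hn]

theorem stepAux_exit_none' {v v' : V} (h : reg v = none) (hn : nx v none = some v')
    (s : ∀ v, (F v).σ) (o : Option A)
    (T : ∀ k, List (Sum.elim (fun _ : ι => A) (fun h : Σ v, (F v).H => (F h.1).Γ h.2) k)) :
    TM2.stepAux (exit F reg nx v₀ v) (s, o) T = ⟨some ⟨v', (F v').main⟩, (s, none), T⟩ := by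
  simp [exit, jump, h, hn]

theorem stepAux_exit_some {v : V} {i : ι} (h : reg v = some i) (s : ∀ v, (F v).σ) (o : Option A)
    (T : ∀ k, List (Sum.elim (fun _ : ι => A) (fun h : Σ v, (F v).H => (F h.1).Γ h.2) k))
    (hn : nx v (List.head? (α := A) (T (.inl i))) = none) :
    TM2.stepAux (exit F reg nx v₀ v) (s, o) T =
      ⟨none, (s, none), Function.update T (.inl i) (T (.inl i)).tail⟩ := by
  simp only [exit, jump, h, TM2.stepAux]
  simp [hn]

theorem stepAux_exit_some' {v v' : V} {i : ι} (h : reg v = some i) (s : ∀ v, (F v).σ)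
    (o : Option A)
    (T : ∀ k, List (Sum.elim (fun _ : ι => A) (fun h : Σ v, (F v).H => (F h.1).Γ h.2) k))
    (hn : nx v (List.head? (α := A) (T (.inl i))) = some v') :
    TM2.stepAux (exit F reg nx v₀ v) (s, o) T =
      ⟨some ⟨v', (F v').main⟩, (s, List.head? (α := A) (T (.inl i))),
        Function.update T (.inl i) (T (.inl i)).tail⟩ := by
  simp only [exit, jump, h, TM2.stepAux]
  simp [hn]

/-- The symbol popped last is still in the state when the next node is entered, so the induction
runs over an arbitrary `o`. It is erased on halting, as `Exec` demands. -/
theorem GRun.exec_aux {v : V} {S S' : ι → List A} {w : Str} {n : ℕ}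
    (h : GRun F reg nx v S w S' n) (o : Option A) :
    NRun (graph F reg nx v₀).guessing (graph F reg nx v₀).m (graph F reg nx v₀).alt n w
      ⟨some ⟨v, (F v).main⟩, (fun v => (F v).s0, o), (graph F reg nx v₀).store S⟩
      ⟨none, (graph F reg nx v₀).s0, (graph F reg nx v₀).store S'⟩ := by
  induction h generalizing o with
  | halt h hr hn => exact exec_node h o (stepAux_exit_none hr hn _ _ _)
  | halt_pop h hr hn =>
    rw [store_update]
    exact exec_node h o (stepAux_exit_some hr _ _ _ hn)
  | next h hr hn h' ih =>
    exact (exec_node h o (stepAux_exit_none' hr hn _ _ _)).trans (ih none)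
  | @next_pop v S w S₁ n i v' w' S' n' h hr hn h' ih =>
    have := ih (S₁ i).head?
    rw [store_update] at this
    exact (exec_node h o (stepAux_exit_some' hr _ _ _ hn)).trans this

theorem GRun.exec {S S' : ι → List A} {w : Str} {n : ℕ} (h : GRun F reg nx v₀ S w S' n) :
    (graph F reg nx v₀).Exec S w S' n :=
  h.exec_aux none

end Graph

section Primitives

/-- The fragment that consists of one statement. -/
def single (q q' : TM2.Stmt (Sum.elim (fun _ : ι => A) (fun _ : Empty => Unit)) Unit Unit)
    (b : Bool) : Frag A ι where
  H := Empty
  Γ _ := Unit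
  Λ := Unit
  σ := Unit
  guessing _ := b
  m _ := q
  alt _ := q'
  main := ()
  s0 := ()

/-- The fragment that does nothing. -/
def skip : Frag A ι := single .halt .halt false

theorem exec_skip (S : ι → List A) : (skip : Frag A ι).Exec S [] S 1 :=
  .det _ _ _ rfl (.refl _)

/-- Push a symbol onto a register. -/
def push (i : ι) (x : A) : Frag A ι := single (.push (.inl i) (fun _ => x) .halt) .halt false

theorem exec_push (i : ι) (x : A) (S : ι → List A) :
    (push i x).Exec S [] (Function.update S i (x :: S i)) 1 := by
  refine .det _ _ _ rfl ?_
  rw [store_update]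
  exact .refl _

/-- Push a guessed symbol onto a register. -/
def guess (i : ι) (x y : A) : Frag A ι :=
  single (.push (.inl i) (fun _ => x) .halt) (.push (.inl i) (fun _ => y) .halt) true

theorem exec_guess (i : ι) (x y : A) (b : Bool) (S : ι → List A) :
    (guess i x y).Exec S [b] (Function.update S i ((if b then y else x) :: S i)) 1 := by
  refine .guess _ _ _ b rfl ?_
  rw [store_update]
  cases b <;> exact .refl _

end Primitives

section Control

variable [Fintype A] [DecidableEq A]

/-- Sequential composition. -/
def seq (F G : Frag A ι) : Frag A ι :=
  graph (fun b : Bool => if b then G else F) (fun _ => none)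
    (fun b _ => if b then none else some true) false

theorem exec_seq {F G : Frag A ι} {S S₁ S₂ : ι → List A} {w w' : Str} {n n' : ℕ}
    (h : F.Exec S w S₁ n) (h' : G.Exec S₁ w' S₂ n') : (seq F G).Exec S (w ++ w') S₂ (n + n') :=
  GRun.exec (.next (v := false) h rfl rfl (.halt (v := true) h' rfl rfl))

/-- Case distinction: pop the register `i` and continue with `B o`, where `o` is the symbol that
has been found. -/
def cas (i : ι) (B : Option A → Frag A ι) : Frag A ι :=
  graph (fun v : Option (Option A) => v.elim skip B) (fun v => v.elim (some i) fun _ => none)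
    (fun v o => v.elim (some (some o)) fun _ => none) none

theorem exec_cas {i : ι} {B : Option A → Frag A ι} {S S' : ι → List A} {w : Str} {n : ℕ}
    (h : (B (S i).head?).Exec (Function.update S i (S i).tail) w S' n) :
    (cas i B).Exec S w S' (1 + n) :=
  GRun.exec (.next_pop (v := none) (w := []) (v' := some (S i).head?) (exec_skip S) rfl rfl
    (.halt (v := some (S i).head?) h rfl rfl))

/-- Loop: as long as the register `i` is not empty, pop a symbol `x` from it and execute `B x`. -/
def loop (i : ι) (B : A → Frag A ι) : Frag A ι :=
  graph (fun v : Option A => v.elim skip B) (fun v => v.elim (some i) fun _ => none)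
    (fun v o => v.elim (o.map some) fun _ => some none) none

/-- Runs of a loop. -/
inductive Loops (i : ι) (B : A → Frag A ι) : (ι → List A) → Str → (ι → List A) → ℕ → Prop
  | nil {S} (h : S i = []) : Loops i B S [] S 1
  | cons {S x l w S₁ n w' S' n'} (h : S i = x :: l)
      (h₁ : (B x).Exec (Function.update S i l) w S₁ n) (h₂ : Loops i B S₁ w' S' n') :
      Loops i B S (w ++ w') S' (1 + n + n')

theorem Loops.exec {i : ι} {B : A → Frag A ι} {S S' : ι → List A} {w : Str} {n : ℕ}
    (h : Loops i B S w S' n) : (loop i B).Exec S w S' n := by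
  refine GRun.exec ?_
  induction h with
  | @nil S h =>
    have := GRun.halt_pop (F := fun v : Option A => v.elim skip B)
      (reg := fun v => v.elim (some i) fun _ => none)
      (nx := fun v o => v.elim (o.map some) fun _ => some none) (v := none)
      (exec_skip S) rfl (by simp [h])
    rw [h, List.tail_nil] at this
    rwa [← h, Function.update_eq_self] at this
  | @cons S x l w S₁ n w' S' n' h h₁ h₂ ih =>
    rw [Nat.add_assoc]
    refine GRun.next_pop (v := none) (w := []) (v' := some x) (exec_skip S) rfl (by simp [h]) ?_
    refine GRun.next (v := some x) (v' := none) ?_ rfl rfl ih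
    simpa [h] using h₁

end Control

end Frag

end

/-! ### Simulation of a machine by a fragment, with the guesses in a register -/

section

/-- A loop that moves the contents of one stack to another one. -/
theorem NRun.move_aux {K : Type} [DecidableEq K] {Γ : K → Type} {Λ σ : Type} {g : Λ → Bool}
    {m a : Λ → TM2.Stmt Γ Λ σ} {L : Λ} {k k' : K} {f : σ → Option (Γ k) → σ} {p : σ → Bool}
    {h : σ → Γ k'} {q : TM2.Stmt Γ Λ σ} {conv : Γ k → Γ k'} (hk : k ≠ k') (hg : g L = false)
    (hm : m L = .pop k f (.branch p (.push k' h (.goto fun _ => L)) q))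
    (hf : ∀ v o o', f (f v o) o' = f v o') (hp : ∀ v, p (f v none) = false)
    (hp' : ∀ v x, p (f v (some x)) = true) (hh : ∀ v x, h (f v (some x)) = conv x)
    (v : σ) (S : ∀ k, List (Γ k)) (l : List (Γ k)) (hl : S k = l) :
    NRun g m a (l.length + 1) [] ⟨some L, v, S⟩ (TM2.stepAux q (f v none)
      (Function.update (Function.update S k []) k' (l.reverse.map conv ++ S k'))) := by
  induction l generalizing v S with
  | nil =>
    refine .det _ _ _ hg ?_
    rw [hm]
    simp only [TM2.stepAux, hl, List.head?_nil, hp, cond_false, List.tail_nil, List.reverse_nil,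
      List.map_nil, List.nil_append]
    have h1 : Function.update S k [] = S := by rw [← hl, Function.update_eq_self]
    rw [h1, Function.update_eq_self]
    exact .refl _
  | cons x l ih =>
    refine .det _ _ _ hg ?_
    rw [hm]
    simp only [TM2.stepAux, hl, List.head?_cons, hp', cond_true, List.tail_cons, hh]
    have := ih (f v (some x)) (Function.update (Function.update S k l) k'
      (conv x :: Function.update S k l k')) (by simp [hk])
    rw [hf] at this
    have e : Function.update (Function.update (Function.update (Function.update S k l) k'
        (conv x :: Function.update S k l k')) k []) k' (List.map conv l.reverse ++
          Function.update (Function.update S k l) k' (conv x :: Function.update S k l k') k') =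
        Function.update (Function.update S k []) k' (List.map conv (x :: l).reverse ++ S k') := by
      funext j
      by_cases hj : j = k'
      · subst hj; simp [Function.update_of_ne hk.symm]
      · simp only [Function.update_of_ne hj]
        by_cases hj' : j = k
        · subst hj'; simp
        · simp [hj', hj]
    rwa [e] at this

/-- The resulting stacks are described pointwise, so that the statement fits stores that are not
written as updates. -/
theorem NRun.move {K : Type} [DecidableEq K] {Γ : K → Type} {Λ σ : Type} {g : Λ → Bool}
    {m a : Λ → TM2.Stmt Γ Λ σ} {L : Λ} {k k' : K} {f : σ → Option (Γ k) → σ} {p : σ → Bool}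
    {h : σ → Γ k'} {q : TM2.Stmt Γ Λ σ} {conv : Γ k → Γ k'} (hk : k ≠ k') (hg : g L = false)
    (hm : m L = .pop k f (.branch p (.push k' h (.goto fun _ => L)) q))
    (hf : ∀ v o o', f (f v o) o' = f v o') (hp : ∀ v, p (f v none) = false)
    (hp' : ∀ v x, p (f v (some x)) = true) (hh : ∀ v x, h (f v (some x)) = conv x)
    (v : σ) (S S' : ∀ k, List (Γ k)) (h1 : S' k = [])
    (h2 : S' k' = (S k).reverse.map conv ++ S k') (h3 : ∀ j, j ≠ k → j ≠ k' → S' j = S j)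
    {c : TM2.Cfg Γ Λ σ} (hc : TM2.stepAux q (f v none) S' = c) :
    NRun g m a ((S k).length + 1) [] ⟨some L, v, S⟩ c := by
  have := NRun.move_aux (a := a) hk hg hm hf hp hp' hh v S (S k) rfl
  have e : Function.update (Function.update S k []) k' ((S k).reverse.map conv ++ S k') = S' := by
    funext j
    by_cases hj : j = k'
    · subst hj; simp [h2]
    · by_cases hj' : j = k
      · subst hj'; simp [hj, h1]
      · simp [hj, hj', h3 j hj' hj]
  rwa [e, hc] at this

/-- A nondeterministic machine with arbitrary input and output alphabets. -/
structure Mach (Γ₀ Γ₁ : Type) extends TM2ComputableAux Γ₀ Γ₁ where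
  guessing : tm.Λ → Bool
  alt : tm.Λ → tm.Stmt
  accept : tm.σ → Bool

theorem NRun.det_of_eq {K : Type} [DecidableEq K] {Γ : K → Type} {Λ σ : Type} {g : Λ → Bool}
    {m a : Λ → TM2.Stmt Γ Λ σ} {n : ℕ} {w : Str} {l : Λ} {v : σ} {S : ∀ k, List (Γ k)}
    {c c' : TM2.Cfg Γ Λ σ} (hl : g l = false) (hc : TM2.stepAux (m l) v S = c)
    (h : NRun g m a n w c c') : NRun g m a (n + 1) w ⟨some l, v, S⟩ c' := by
  subst hc
  exact .det l v S hl h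

namespace Mach

variable {Γ₀ Γ₁ A ι : Type} [DecidableEq ι] [Fintype A] (M : Mach Γ₀ Γ₁)

instance : Fintype M.tm.σ := M.tm.σFin
instance : Fintype M.tm.Λ := M.tm.ΛFin
instance : Fintype M.tm.K := M.tm.kFin

/-- Runs of a machine. -/
abbrev Run (n : ℕ) (w : Str) (c c' : M.tm.Cfg) : Prop :=
  NRun (K := M.tm.K) M.guessing M.tm.m M.alt n w c c'

/-- The initial configuration. -/
abbrev init (x : List Γ₀) : M.tm.Cfg := initList M.tm (x.map M.inputAlphabet.symm)

/-- A bound for the number of symbols written in one step. -/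
def rate : ℕ := ∑ l : M.tm.Λ, (pushes (M.tm.m l) + pushes (M.alt l))

theorem stk_init_self (x : List Γ₀) :
    (M.init x).stk M.tm.k₀ = x.map M.inputAlphabet.symm := by
  simp only [init, initList, dif_pos]
  rfl

theorem stk_init_ne (x : List Γ₀) {k : M.tm.K} (hk : k ≠ M.tm.k₀) : (M.init x).stk k = [] := by
  simp only [init, initList, dif_neg hk]

/-- The stacks of the simulating fragment. -/
def stks (R : ι → List A) (T : ∀ k, List (M.tm.Γ k)) :
    ∀ k : ι ⊕ M.tm.K, List (Sum.elim (fun _ : ι => A) M.tm.Γ k)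
  | .inl i => R i
  | .inr k => T k

theorem update_stks_inl (R : ι → List A) (T : ∀ k, List (M.tm.Γ k)) (i : ι) (l : List A) :
    Function.update (M.stks R T) (.inl i) l = M.stks (Function.update R i l) T := by
  funext k
  by_cases h : k = .inl i
  · subst h
    exact (Function.update_self (Sum.inl i : ι ⊕ M.tm.K) l (M.stks R T)).trans
      (Function.update_self i l R).symm
  · refine (Function.update_of_ne h _ _).trans ?_
    rcases k with j | k
    · exact (Function.update_of_ne (fun e => h (congrArg Sum.inl e)) l R).symm
    · rfl

/-- Labels of the simulating fragment. -/
abbrev SLab : Type := Fin 5 ⊕ M.tm.Λ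

/-- Statements of the simulating fragment. -/
abbrev SStmt (A ι : Type) : Type :=
  TM2.Stmt (Sum.elim (fun _ : ι => A) M.tm.Γ) M.SLab (M.tm.σ × Option A)

/-- The translation of statements used in the simulation. -/
def simTr : Tr M.tm.Γ (Sum.elim (fun _ : ι => A) M.tm.Γ) M.tm.Λ M.SLab M.tm.σ
    (M.tm.σ × Option A) where
  e := Sum.inr
  φ _ := id
  ψ _ := id
  lab := Sum.inr
  get := Prod.fst
  upd s a := (a, s.2)

theorem simTr_sound (R : ι → List A) (o : Option A) :
    (M.simTr (A := A) (ι := ι)).Sound (fun v => (v, o)) (M.stks R) where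
  ψ_φ _ _ := rfl
  get_emb _ := rfl
  upd_emb _ _ := rfl
  mrg_e T k := (List.map_id (T k)).symm
  mrg_ne T k l k' hk := by
    rcases k' with j | k'
    · rfl
    · exact Function.update_of_ne (fun e => hk (congrArg Sum.inr e)) l T

section Sim

variable (enc : A → Γ₀) (out : Γ₁ → A) (em : Bool → A) (bit : A → Bool) (i t g : ι)

/-- Reject: the result is `em false`. -/
def rej : M.SStmt A ι := .push (.inl i) (fun _ => em false) (.goto fun _ => .inl 4)

/-- After the simulated machine has halted. -/
def simExit : M.SStmt A ι :=
  -- Acceptance requires that no guess is left over, because a path is named by exactly the guesses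
  -- that it uses.
  .peek (.inl g) (fun s o => (s.1, o))
    (.branch (fun s => s.2.isNone && M.accept s.1) (.goto fun _ => .inl 2) (M.rej em i))

/-- Pop all the given stks, and record whether one of them was not empty. -/
noncomputable def popAll (ks : List (ι ⊕ M.tm.K)) (q : M.SStmt A ι) : M.SStmt A ι :=
  ks.foldr (fun k q => .pop k (fun s o => (s.1, if o.isSome then some (em true) else s.2)) q) q

/-- The statements of the simulating fragment. -/
noncomputable def simStmt : M.SLab → M.SStmt A ι
  -- Phases 0 and 1 carry the input from `i` through `t` to the input stack, the two reversals
  -- cancelling each other. Phases 2 and 3 carry the output back in the same way and put the verdict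
  -- `em true` in front. Phase 4 empties the guess register and the private stacks. A guess of the
  -- machine is a pop from `g`; if `g` is empty at that moment, the verdict is `em false`.
  | .inl 0 => .pop (.inl i) (fun s o => (s.1, o)) (.branch (fun s => s.2.isSome)
      (.push (.inl t) (fun s => s.2.getD (em false)) (.goto fun _ => .inl 0))
      (.goto fun _ => .inl 1))
  | .inl 1 => .pop (.inl t) (fun s o => (s.1, o)) (.branch (fun s => s.2.isSome)
      (.push (.inr M.tm.k₀) (fun s => M.inputAlphabet.symm (enc (s.2.getD (em false))))
        (.goto fun _ => .inl 1))
      (.goto fun _ => .inr M.tm.main))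
  | .inl 2 => .pop (.inr M.tm.k₁) (fun s o => (s.1, o.map fun y => out (M.outputAlphabet y)))
      (.branch (fun s => s.2.isSome)
      (.push (.inl t) (fun s => s.2.getD (em false)) (.goto fun _ => .inl 2))
      (.goto fun _ => .inl 3))
  | .inl 3 => .pop (.inl t) (fun s o => (s.1, o)) (.branch (fun s => s.2.isSome)
      (.push (.inl i) (fun s => s.2.getD (em false)) (.goto fun _ => .inl 3))
      (.push (.inl i) (fun _ => em true) (.goto fun _ => .inl 4)))
  | .inl 4 => .load (fun s => (s.1, none))
      (M.popAll em (.inl g :: (Finset.univ : Finset M.tm.K).toList.map .inr)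
        (.branch (fun s => s.2.isSome) (.goto fun _ => .inl 4)
          (.load (fun _ => (M.tm.initialState, none)) .halt)))
  | .inr l => if M.guessing l then
      .pop (.inl g) (fun s o => (s.1, o)) (.branch (fun s => s.2.isSome)
        (.branch (fun s => bit (s.2.getD (em false)))
          (M.simTr.stmt (M.simExit em i g) (M.alt l))
          (M.simTr.stmt (M.simExit em i g) (M.tm.m l)))
        (M.rej em i))
      else M.simTr.stmt (M.simExit em i g) (M.tm.m l)

/-- The fragment that simulates `M` on the input in the register `i` and with the guesses in
the register `g`. -/
noncomputable def sim : Frag A ι where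
  H := M.tm.K
  Γ := M.tm.Γ
  Λ := M.SLab
  σ := M.tm.σ × Option A
  guessing _ := false
  m := M.simStmt enc out em bit i t g
  alt := M.simStmt enc out em bit i t g
  main := .inl 0
  s0 := (M.tm.initialState, none)

/-- Runs of the simulating fragment. -/
abbrev SimRun (n : ℕ) (c c' : TM2.Cfg (Sum.elim (fun _ : ι => A) M.tm.Γ) M.SLab
    (M.tm.σ × Option A)) : Prop :=
  NRun (fun _ => false) (M.simStmt enc out em bit i t g) (M.simStmt enc out em bit i t g) n [] c c'

variable {M enc out em bit i t g}

theorem simRun_load (hit : i ≠ t) (R : ι → List A) (ht : R t = []) (v : M.tm.σ) (o : Option A) :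
    M.SimRun enc out em bit i t g ((R i).length + 1)
      ⟨some (.inl 0), (v, o), M.stks R fun _ => []⟩
      ⟨some (.inl 1), (v, none), M.stks (Function.update (Function.update R i []) t (R i).reverse)
        fun _ => []⟩ := by
  refine NRun.move (g := fun _ => false) (m := M.simStmt enc out em bit i t g)
    (L := .inl 0) (k := .inl i) (k' := .inl t) (f := fun s o => (s.1, o)) (p := fun s => s.2.isSome)
    (h := fun s => s.2.getD (em false)) (conv := id) (by simpa using hit) rfl rfl
    (fun _ _ _ => rfl) (fun _ => rfl) (fun _ _ => rfl) (fun _ _ => rfl) (v, o)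
    (M.stks R fun _ => []) _ ?_ ?_ ?_ rfl
  · exact (Function.update_of_ne hit _ _).trans (Function.update_self _ _ _)
  · refine (Function.update_self _ _ _).trans ?_
    exact ((List.append_nil _).symm.trans (congrArg _ ht.symm)).trans
      (congrArg (· ++ R t) (List.map_id _).symm)
  · rintro (j | j) h h'
    · refine (Function.update_of_ne ?_ _ _).trans (Function.update_of_ne ?_ _ _)
      · simpa using h'
      · simpa using h
    · rfl

theorem simRun_load' (R : ι → List A) (v : M.tm.σ) (o : Option A) :
    M.SimRun enc out em bit i t g ((R t).length + 1)
      ⟨some (.inl 1), (v, o), M.stks R fun _ => []⟩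
      ⟨some (.inr M.tm.main), (v, none), M.stks (Function.update R t [])
        (M.init ((R t).reverse.map enc)).stk⟩ := by
  refine NRun.move (g := fun _ => false) (m := M.simStmt enc out em bit i t g)
    (L := .inl 1) (k := .inl t) (k' := .inr M.tm.k₀) (f := fun s o => (s.1, o)) (p := fun s => s.2.isSome)
    (h := fun s => M.inputAlphabet.symm (enc (s.2.getD (em false)))) 
    (conv := fun x => M.inputAlphabet.symm (enc x)) (by simp) rfl rfl
    (fun _ _ _ => rfl) (fun _ => rfl) (fun _ _ => rfl) (fun _ _ => rfl) (v, o)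
    (M.stks R fun _ => []) _ ?_ ?_ ?_ rfl
  · exact Function.update_self _ _ _
  · refine (M.stk_init_self _).trans ?_
    rw [List.map_map]
    exact (List.append_nil _).symm
  · rintro (j | j) h h'
    · exact Function.update_of_ne (by simpa using h) _ _
    · exact M.stk_init_ne _ (by simpa using h')

theorem simRun_out (R : ι → List A) (ht : R t = []) (T : ∀ k, List (M.tm.Γ k)) (v : M.tm.σ)
    (o : Option A) :
    M.SimRun enc out em bit i t g ((T M.tm.k₁).length + 1)
      ⟨some (.inl 2), (v, o), M.stks R T⟩
      ⟨some (.inl 3), (v, none), M.stks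
        (Function.update R t ((T M.tm.k₁).reverse.map fun y => out (M.outputAlphabet y)))
        (Function.update T M.tm.k₁ [])⟩ := by
  refine NRun.move (g := fun _ => false) (m := M.simStmt enc out em bit i t g)
    (L := .inl 2) (k := .inr M.tm.k₁) (k' := .inl t)
    (f := fun s o => (s.1, o.map fun y => out (M.outputAlphabet y)))
    (p := fun s => s.2.isSome) (h := fun s => s.2.getD (em false))
    (conv := fun y => out (M.outputAlphabet y)) (by simp) rfl rfl
    (fun _ _ _ => rfl) (fun _ => rfl) (fun _ _ => rfl) (fun _ _ => rfl) (v, o)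
    (M.stks R T) _ ?_ ?_ ?_ rfl
  · exact Function.update_self _ _ _
  · refine (Function.update_self _ _ _).trans ?_
    exact (List.append_nil _).symm.trans (congrArg _ ht.symm)
  · rintro (j | j) h h'
    · exact Function.update_of_ne (by simpa using h') _ _
    · exact Function.update_of_ne (by simpa using h) _ _

theorem simRun_out' (hit : i ≠ t) (R : ι → List A) (hi : R i = []) (T : ∀ k, List (M.tm.Γ k))
    (v : M.tm.σ) (o : Option A) :
    M.SimRun enc out em bit i t g ((R t).length + 1)
      ⟨some (.inl 3), (v, o), M.stks R T⟩
      ⟨some (.inl 4), (v, none), M.stks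
        (Function.update (Function.update R t []) i (em true :: (R t).reverse)) T⟩ := by
  refine NRun.move (g := fun _ => false) (m := M.simStmt enc out em bit i t g)
    (L := .inl 3) (k := .inl t) (k' := .inl i) (f := fun s o => (s.1, o)) (p := fun s => s.2.isSome)
    (h := fun s => s.2.getD (em false)) (conv := id) (by simpa using hit.symm) rfl rfl
    (fun _ _ _ => rfl) (fun _ => rfl) (fun _ _ => rfl) (fun _ _ => rfl) (v, o)
    (M.stks R T) (M.stks (Function.update (Function.update R t []) i (R t).reverse) T) ?_ ?_ ?_ ?_
  · exact (Function.update_of_ne hit.symm _ _).trans (Function.update_self _ _ _)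
  · refine (Function.update_self _ _ _).trans ?_
    exact ((List.append_nil _).symm.trans (congrArg _ hi.symm)).trans
      (congrArg (· ++ R i) (List.map_id _).symm)
  · rintro (j | j) h h'
    · refine (Function.update_of_ne ?_ _ _).trans (Function.update_of_ne ?_ _ _)
      · simpa using h'
      · simpa using h
    · rfl
  · have e : em true :: Function.update (Function.update R t []) i (R t).reverse i =
        em true :: (R t).reverse := by rw [Function.update_self]
    have h := M.update_stks_inl (Function.update (Function.update R t []) i (R t).reverse) T i
      (em true :: (R t).reverse)
    rw [Function.update_idem, ← e] at h
    rw [← e]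
    exact congrArg (TM2.Cfg.mk _ _) h

open scoped Classical in
-- Distinctness of the listed stacks ensures that each of them loses just one symbol; the second
-- component of the state records whether there was anything to lose.
theorem stepAux_popAll (ks : List (ι ⊕ M.tm.K)) (hks : ks.Nodup) (q : M.SStmt A ι) (v : M.tm.σ)
    (o : Option A) (S : ∀ k, List (Sum.elim (fun _ : ι => A) M.tm.Γ k)) :
    TM2.stepAux (M.popAll em ks q) (v, o) S = TM2.stepAux q
      (v, if ∃ k ∈ ks, S k ≠ [] then some (em true) else o)
      (fun k => if k ∈ ks then (S k).tail else S k) := by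
  induction ks generalizing o S with
  | nil => simp [popAll]
  | cons k ks ih =>
    rw [List.nodup_cons] at hks
    have h := ih hks.2 (if (S k).head?.isSome then some (em true) else o)
      (Function.update S k (S k).tail)
    refine Eq.trans (by exact h) ?_
    have hne : ∀ j ∈ ks, Function.update S k (S k).tail j = S j := fun j hj =>
      Function.update_of_ne (fun e => hks.1 (by rwa [e] at hj)) _ _
    congr 1
    · have : (∃ j ∈ ks, Function.update S k (S k).tail j ≠ []) ↔ ∃ j ∈ ks, S j ≠ [] :=
        exists_congr fun j => and_congr_right fun hj => by rw [hne j hj]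
      simp only [this, List.mem_cons, exists_eq_or_imp]
      by_cases h1 : ∃ j ∈ ks, S j ≠ []
      · simp [h1]
      · simp only [h1, if_false, or_false]
        cases hS : S k <;> simp
    · funext j
      by_cases hj : j = k
      · subst hj; simp [hks.1]
      · simp [hj]

open scoped Classical in
-- One step pops all the stacks at once, so the longest stack determines the number of steps; one
-- more step finds everything empty.
theorem simRun_clear (B : ℕ) (R : ι → List A) (T : ∀ k, List (M.tm.Γ k)) (v : M.tm.σ)
    (o : Option A) (hR : (R g).length ≤ B) (hT : ∀ k, (T k).length ≤ B) :
    ∃ N ≤ B + 1, M.SimRun enc out em bit i t g N ⟨some (.inl 4), (v, o), M.stks R T⟩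
      ⟨none, (M.tm.initialState, none), M.stks (Function.update R g []) fun _ => []⟩ := by
  have hnd : (.inl g :: (Finset.univ : Finset M.tm.K).toList.map .inr : List (ι ⊕ M.tm.K)).Nodup := by
    rw [List.nodup_cons]
    exact ⟨by simp, (Finset.nodup_toList _).map Sum.inr_injective⟩
  have hst : (fun k : ι ⊕ M.tm.K => if k ∈ (.inl g :: (Finset.univ : Finset M.tm.K).toList.map .inr :
      List (ι ⊕ M.tm.K)) then (M.stks R T k).tail else M.stks R T k) =
      M.stks (Function.update R g (R g).tail) (fun k => (T k).tail) := by
    funext k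
    rcases k with j | k
    · by_cases hj : j = g
      · subst hj
        refine (if_pos (by simp)).trans ?_
        exact (Function.update_self j (R j).tail R).symm
      · refine (if_neg (by simp [hj])).trans ?_
        exact (Function.update_of_ne hj (R g).tail R).symm
    · exact if_pos (by simp)
  have step := stepAux_popAll (M := M) (em := em) _ hnd
    (.branch (fun s => s.2.isSome) (.goto fun _ => .inl 4)
          (.load (fun _ => (M.tm.initialState, none)) .halt)) v none (M.stks R T)
  rw [hst] at step
  by_cases he : ∃ k ∈ (.inl g :: (Finset.univ : Finset M.tm.K).toList.map .inr :
      List (ι ⊕ M.tm.K)), M.stks R T k ≠ []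
  · rw [if_pos he] at step
    cases B with
    | zero =>
      exfalso
      obtain ⟨k, hk, h⟩ := he
      rcases k with j | k
      · obtain rfl : j = g := by simpa using hk
        exact h (List.length_eq_zero_iff.mp (Nat.le_zero.mp hR))
      · exact h (List.length_eq_zero_iff.mp (Nat.le_zero.mp (hT k)))
    | succ B =>
      obtain ⟨N, hN, r⟩ := simRun_clear B (Function.update R g (R g).tail) (fun k => (T k).tail)
        v (some (em true)) (by simp; omega) (fun k => by have := hT k; simp; omega)
      rw [Function.update_idem] at r
      refine ⟨N + 1, by omega, .det _ _ _ rfl ?_⟩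
      have e : TM2.stepAux (M.simStmt enc out em bit i t g (.inl 4)) (v, o) (M.stks R T) = _ := step
      rw [e]
      exact r
  · rw [if_neg he] at step
    refine ⟨1, by omega, .det _ _ _ rfl ?_⟩
    have e : TM2.stepAux (M.simStmt enc out em bit i t g (.inl 4)) (v, o) (M.stks R T) = _ := step
    rw [e]
    have hR' : R g = [] := by
      by_contra h
      exact he ⟨.inl g, by simp, h⟩
    have hT' : (fun k => (T k).tail) = fun k : M.tm.K => ([] : List (M.tm.Γ k)) := by
      funext k
      by_contra h
      exact he ⟨.inr k, by simp, fun h' => h (by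
        have : T k = [] := h'
        rw [this]; rfl)⟩
    rw [hT', hR']
    exact .refl _

/-- The configuration of the simulating fragment that represents a configuration of `M`. -/
abbrev simCfg (em : Bool → A) (i g : ι) (R : ι → List A) (o : Option A) (c : M.tm.Cfg) :
    TM2.Cfg (Sum.elim (fun _ : ι => A) M.tm.Γ) M.SLab (M.tm.σ × Option A) :=
  M.simTr.cfg (M.simExit em i g) (fun v => (v, o)) (M.stks R) c

theorem stepAux_simStmt_guess {l : M.tm.Λ} (hl : M.guessing l = true) (R : ι → List A)
    (T : ∀ k, List (M.tm.Γ k)) (v : M.tm.σ) (o : Option A) :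
    TM2.stepAux (M.simStmt enc out em bit i t g (.inr l)) (v, o) (M.stks R T) =
      bif (R g).head?.isSome then bif bit ((R g).head?.getD (em false)) then
        TM2.stepAux (M.simTr.stmt (M.simExit em i g) (M.alt l)) (v, (R g).head?)
          (M.stks (Function.update R g (R g).tail) T)
      else TM2.stepAux (M.simTr.stmt (M.simExit em i g) (M.tm.m l)) (v, (R g).head?)
          (M.stks (Function.update R g (R g).tail) T)
      else TM2.stepAux (M.rej em i) (v, (R g).head?)
          (M.stks (Function.update R g (R g).tail) T) := by
  rw [← M.update_stks_inl R T g (R g).tail]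
  have e : M.simStmt enc out em bit i t g (.inr l) =
      .pop (.inl g) (fun s o => (s.1, o)) (.branch (fun s => s.2.isSome)
        (.branch (fun s => bit (s.2.getD (em false)))
          (M.simTr.stmt (M.simExit em i g) (M.alt l))
          (M.simTr.stmt (M.simExit em i g) (M.tm.m l)))
        (M.rej em i)) := by simp [simStmt, hl]
  exact congrArg (fun q => TM2.stepAux q (v, o) (M.stks R T)) e

/-- A guess is read from the register within the step that uses it, so the number of steps is
preserved. The consumed part `ws` and the remainder `r` are kept apart because a rejected guess
sequence may be too long. -/
theorem simRun_run {n : ℕ} {w : Str} {c c' : M.tm.Cfg} (h : M.Run n w c c') (R : ι → List A)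
    (o : Option A) (ws r : List A) (hw : ws.map bit = w) (hR : R g = ws ++ r) :
    ∃ o', M.SimRun enc out em bit i t g n (simCfg em i g R o c)
      (simCfg em i g (Function.update R g r) o' c') := by
  induction h generalizing R o ws with
  | refl c =>
    rw [List.map_eq_nil_iff] at hw
    subst hw
    refine ⟨o, ?_⟩
    rw [List.nil_append] at hR
    rw [← hR, Function.update_eq_self]
    exact .refl _
  | det l v S hl h ih =>
    obtain ⟨o', h'⟩ := ih R o ws hw hR
    refine ⟨o', .det _ _ _ rfl ?_⟩
    have e : M.simStmt enc out em bit i t g (.inr l) =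
      M.simTr.stmt (M.simExit em i g) (M.tm.m l) := by simp [simStmt, hl]
    rw [show M.simStmt enc out em bit i t g (M.simTr.lab l) = _ from e,
      (M.simTr_sound R o).stepAux_stmt]
    exact h'
  | @guess n w c' l v S b hl h ih =>
    obtain ⟨y, ws, rfl, rfl, rfl⟩ : ∃ y ws', ws = y :: ws' ∧ bit y = b ∧ ws'.map bit = w := by
      cases ws <;> simp_all
    obtain ⟨o', h'⟩ := ih (Function.update R g (ws ++ r)) (some y) ws rfl (by simp)
    rw [Function.update_idem] at h'
    refine ⟨o', ?_⟩
    have h4 : TM2.stepAux (M.simTr.stmt (M.simExit em i g) (if bit y then M.alt l else M.tm.m l))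
      (v, some y) (M.stks (Function.update R g (ws ++ r)) S) = _ :=
      (M.simTr_sound (Function.update R g (ws ++ r)) (some y)).stepAux_stmt _ _ _ _
    replace h' := Eq.mpr (congrArg (fun c => M.SimRun enc out em bit i t g n c
      (simCfg em i g (Function.update R g r) o' c')) h4) h'
    refine NRun.det_of_eq rfl (stepAux_simStmt_guess hl R S v o) ?_
    rw [hR]
    simp only [List.cons_append, List.head?_cons, Option.isSome_some, cond_true, Option.getD_some,
      List.tail_cons]
    cases hb : bit y
    · rw [hb] at h'; exact h'
    · rw [hb] at h'; exact h'

theorem stepAux_rej (R : ι → List A) (T : ∀ k, List (M.tm.Γ k)) (v : M.tm.σ) (o : Option A) :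
    TM2.stepAux (M.rej em i) (v, o) (M.stks R T) =
      ⟨some (.inl 4), (v, o), M.stks (Function.update R i (em false :: R i)) T⟩ := by
  simp only [rej, TM2.stepAux]
  rw [← update_stks_inl]
  rfl

theorem stepAux_simExit (R : ι → List A) (T : ∀ k, List (M.tm.Γ k)) (v : M.tm.σ)
    (o : Option A) : TM2.stepAux (M.simExit em i g) (v, o) (M.stks R T) =
      bif (R g).head?.isNone && M.accept v then ⟨some (.inl 2), (v, (R g).head?), M.stks R T⟩
      else TM2.stepAux (M.rej em i) (v, (R g).head?) (M.stks R T) := rfl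

theorem stepAux_simExit_accept (R : ι → List A) (T : ∀ k, List (M.tm.Γ k)) (v : M.tm.σ)
    (o : Option A) (hR : R g = []) (hv : M.accept v = true) :
    TM2.stepAux (M.simExit em i g) (v, o) (M.stks R T) =
      ⟨some (.inl 2), (v, none), M.stks R T⟩ := by
  rw [stepAux_simExit, hR, hv]
  rfl

theorem stepAux_simExit_reject (R : ι → List A) (T : ∀ k, List (M.tm.Γ k)) (v : M.tm.σ)
    (o : Option A) (h : R g = [] → M.accept v = false) :
    TM2.stepAux (M.simExit em i g) (v, o) (M.stks R T) =
      ⟨some (.inl 4), (v, (R g).head?), M.stks (Function.update R i (em false :: R i)) T⟩ := by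
  rw [stepAux_simExit, ← stepAux_rej]
  have : ((R g).head?.isNone && M.accept v) = false := by
    cases hg : R g with
    | nil => simp [h hg]
    | cons => simp
  rw [this]
  rfl

theorem length_stk_init_le (x : List Γ₀) (k : M.tm.K) : ((M.init x).stk k).length ≤ x.length := by
  by_cases hk : k = M.tm.k₀
  · subst hk; rw [stk_init_self]; simp
  · rw [stk_init_ne _ _ hk]; simp

theorem length_stk_le {n : ℕ} {w : Str} {x : List Γ₀} {c : M.tm.Cfg} (h : M.Run n w (M.init x) c)
    (k : M.tm.K) : (c.stk k).length ≤ x.length + n * M.rate :=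
  (h.length_stk_le k).trans (Nat.add_le_add_right (length_stk_init_le x k) _)

theorem sim_load (hit : i ≠ t) (R : ι → List A) (ht : R t = []) :
    M.SimRun enc out em bit i t g (2 * (R i).length + 2)
      ⟨some (.inl 0), (M.tm.initialState, none), M.stks R fun _ => []⟩
      (simCfg em i g (Function.update R i []) none (M.init ((R i).map enc))) := by
  have h1 := simRun_load (M := M) (enc := enc) (out := out) (em := em) (bit := bit) (g := g) hit R
    ht M.tm.initialState none
  have h2 := simRun_load' (M := M) (enc := enc) (out := out) (em := em) (bit := bit) (i := i)
    (t := t) (g := g) (Function.update (Function.update R i []) t (R i).reverse)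
    M.tm.initialState none
  refine h1.trans' (w' := []) (n' := (R i).length + 1) ?_ (by omega) rfl
  rw [Function.update_self, Function.update_idem, List.reverse_reverse, List.length_reverse] at h2
  have : Function.update (Function.update R i []) t [] = Function.update R i [] := by
    rw [Function.update_eq_self_iff, Function.update_of_ne hit.symm, ht]
  rwa [this] at h2

theorem exec_sim_of_simRun {R R' : ι → List A} {n : ℕ} (h : M.SimRun enc out em bit i t g n
    ⟨some (.inl 0), (M.tm.initialState, none), M.stks R fun _ => []⟩
    ⟨none, (M.tm.initialState, none), M.stks R' fun _ => []⟩) :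
    (M.sim enc out em bit i t g).Exec R [] R' n := by
  have e : ∀ R : ι → List A, (M.sim enc out em bit i t g).store R = M.stks R fun _ => [] := by
    intro R
    funext k
    rcases k with j | k <;> rfl
  rw [Frag.Exec, e, e]
  exact h

/-- Besides the `n` simulated steps there is only the cost of moving the input and the output and of
clearing the stacks, all of whose lengths are controlled by `rate`. The factor 10 is generous. -/
theorem exec_sim_accept (hit : i ≠ t) (hig : i ≠ g) (htg : t ≠ g) (R : ι → List A) (ht : R t = [])
    {n : ℕ} {c : M.tm.Cfg} (h : M.Run n ((R g).map bit) (M.init ((R i).map enc)) c)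
    (hc : c.l = none) (ha : M.accept c.var = true) :
    ∃ N ≤ 10 * ((R i).length + n + n * M.rate + (R g).length + 1),
      (M.sim enc out em bit i t g).Exec R [] (Function.update (Function.update R g []) i
        (em true :: (c.stk M.tm.k₁).map fun y => out (M.outputAlphabet y))) N := by
  have h1 := sim_load (M := M) (enc := enc) (out := out) (em := em) (bit := bit) (g := g) hit R ht
  obtain ⟨o, h2⟩ := simRun_run (M := M) (enc := enc) (out := out) (em := em) (bit := bit) (i := i)
    (t := t) (g := g) h (Function.update R i []) none (R g) [] rfl
    (by rw [Function.update_of_ne hig.symm, List.append_nil])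
  set R₁ := Function.update (Function.update R i []) g [] with hR₁
  have h3 : simCfg em i g R₁ o c = ⟨some (.inl 2), (c.var, none), M.stks R₁ c.stk⟩ := by
    rw [← stepAux_simExit_accept R₁ c.stk c.var o (by simp [hR₁]) ha (em := em) (i := i) (g := g)]
    simp only [simCfg, Tr.cfg, hc]
  rw [h3] at h2
  have h4 := simRun_out (M := M) (enc := enc) (out := out) (em := em) (bit := bit) (i := i)
    (t := t) (g := g) R₁ (by simp [hR₁, htg, hit.symm, ht]) c.stk c.var none
  set R₂ := Function.update R₁ t ((c.stk M.tm.k₁).reverse.map fun y => out (M.outputAlphabet y))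
    with hR₂
  have h5 := simRun_out' (M := M) (enc := enc) (out := out) (em := em) (bit := bit) (i := i)
    (t := t) (g := g) hit R₂ (by simp [hR₂, hR₁, hit, hig])
    (Function.update c.stk M.tm.k₁ []) c.var none
  have hlen : ∀ k, (Function.update c.stk M.tm.k₁ [] k).length ≤
      (R i).length + n * M.rate := by
    intro k
    refine le_trans ?_ (by simpa using length_stk_le h k)
    by_cases hk : k = M.tm.k₁
    · subst hk; simp
    · simp [hk]
  obtain ⟨N, hN, h6⟩ := simRun_clear (M := M) (enc := enc) (out := out) (em := em) (bit := bit)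
    (i := i) (t := t) (g := g) ((R i).length + n * M.rate)
    (Function.update (Function.update R₂ t []) i (em true :: (R₂ t).reverse))
    (Function.update c.stk M.tm.k₁ []) c.var none
    (by simp [hR₂, hR₁, hig.symm, htg.symm]) hlen
  have hfin : Function.update (Function.update (Function.update R₂ t []) i
      (em true :: (R₂ t).reverse)) g [] = Function.update (Function.update R g []) i
        (em true :: (c.stk M.tm.k₁).map fun y => out (M.outputAlphabet y)) := by
    funext j
    by_cases hji : j = i
    · subst hji
      simp [hR₂, hig]
    · by_cases hjg : j = g
      · subst hjg; simp [hji]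
      · by_cases hjt : j = t
        · subst hjt; simp [hji, hjg, ht]
        · simp [hR₂, hR₁, hji, hjg, hjt]
  rw [hfin] at h6
  have hk1 : (c.stk M.tm.k₁).length ≤ (R i).length + n * M.rate := by
    simpa using length_stk_le h M.tm.k₁
  have hR2t : (R₂ t).length = (c.stk M.tm.k₁).length := by simp [hR₂]
  refine ⟨2 * (R i).length + 2 + (n + ((c.stk M.tm.k₁).length + 1 + ((R₂ t).length + 1 + N))), ?_,
    exec_sim_of_simRun <| h1.trans (w := []) (w' := []) (h2.trans (w := []) (w' := []) (h4.trans (w := []) (w' := [])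
      (h5.trans (w := []) (w' := []) h6)))⟩
  omega

/-- There are three ways to fail: halting in a rejecting state, halting with guesses left over, and
running out of guesses at a guessing label. Each leads to the clearing phase with verdict `em
false`. -/
theorem exec_sim_reject (hit : i ≠ t) (hig : i ≠ g) (htg : t ≠ g) (R : ι → List A) (ht : R t = [])
    {n : ℕ} (hn : ∀ k w c, M.Run k w (M.init ((R i).map enc)) c → k ≤ n)
    (h : ∀ k c, M.Run k ((R g).map bit) (M.init ((R i).map enc)) c → c.l = none →
      M.accept c.var = false) :
    ∃ N ≤ 10 * ((R i).length + n + n * M.rate + (R g).length + 1),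
      (M.sim enc out em bit i t g).Exec R [] (Function.update (Function.update R g []) i
        [em false]) N := by
  have h1 := sim_load (M := M) (enc := enc) (out := out) (em := em) (bit := bit) (g := g) hit R ht
  -- No run has `n + 1` steps, so this one stops by halting or for lack of a guess.
  obtain ⟨k, w₁, w₂, c, hw, hr, -, hk⟩ := NRun.exists_run M.guessing M.tm.m M.alt (n + 1)
    ((R g).map bit) (M.init ((R i).map enc))
  have hkn := hn _ _ _ hr
  obtain ⟨ws, r, hwr, hws, hr2⟩ := List.map_eq_append_iff.mp hw
  obtain ⟨o, h2⟩ := simRun_run (M := M) (enc := enc) (out := out) (em := em) (bit := bit) (i := i)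
    (t := t) (g := g) hr (Function.update R i []) none ws r hws
    (by rw [Function.update_of_ne hig.symm, hwr])
  set R₁ := Function.update (Function.update R i []) g r with hR₁
  have hfin : ∀ o' T, (∀ k, (T k).length ≤ (R i).length + n * M.rate + (R g).length) →
      ∃ N ≤ (R i).length + n * M.rate + (R g).length + 1, M.SimRun enc out em bit i t g N
      ⟨some (.inl 4), (c.var, o'), M.stks (Function.update R₁ i (em false :: R₁ i)) T⟩
      ⟨none, (M.tm.initialState, none), M.stks (Function.update (Function.update R g []) i
        [em false]) fun _ => []⟩ := by
    intro o' T hT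
    obtain ⟨N, hN, h3⟩ := simRun_clear (M := M) (enc := enc) (out := out) (em := em) (bit := bit)
      (i := i) (t := t) (g := g) ((R i).length + n * M.rate + (R g).length)
      (Function.update R₁ i (em false :: R₁ i)) T c.var o'
      (by simp [hR₁, hig.symm, hwr]; omega) hT
    refine ⟨N, hN, ?_⟩
    have : Function.update (Function.update R₁ i (em false :: R₁ i)) g [] =
        Function.update (Function.update R g []) i [em false] := by
      funext j
      by_cases hji : j = i
      · subst hji
        simp [hR₁, hig]
      · by_cases hjg : j = g
        · subst hjg; simp [hji]
        · simp [hR₁, hji, hjg]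
    rwa [this] at h3
  have hrate : k * M.rate ≤ n * M.rate := Nat.mul_le_mul_right _ hkn
  have hlen : ∀ j, (c.stk j).length ≤ (R i).length + n * M.rate + (R g).length := by
    intro j
    have := length_stk_le hr j
    rw [List.length_map] at this
    omega
  obtain ⟨N, hN, h3⟩ : ∃ N ≤ (R i).length + n * M.rate + (R g).length + 2,
      M.SimRun enc out em bit i t g N (simCfg em i g R₁ o c)
      ⟨none, (M.tm.initialState, none), M.stks (Function.update (Function.update R g []) i
        [em false]) fun _ => []⟩ := by
    rcases hk with hk | hk | ⟨l, hl, hgl, rfl⟩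
    · omega
    · have hex : simCfg em i g R₁ o c = TM2.stepAux (M.simExit em i g) (c.var, o)
          (M.stks R₁ c.stk) := by
        simp only [simCfg, Tr.cfg, hk]
      rw [hex, stepAux_simExit_reject]
      · obtain ⟨N, hN, h3⟩ := hfin _ c.stk hlen
        exact ⟨N, by omega, h3⟩
      · intro hr0
        obtain rfl : r = [] := by simpa [hR₁] using hr0
        rw [List.map_nil] at hr2
        subst hr2
        rw [List.append_nil] at hw
        rw [← hw] at hr
        exact h _ _ hr hk
    · obtain ⟨_ | l', v, T⟩ := c
      · simp at hl
      obtain rfl : l' = l := by simpa using hl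
      obtain rfl : r = [] := by simpa using hr2
      obtain ⟨N, hN, h3⟩ := hfin none T hlen
      refine ⟨N + 1, by omega, NRun.det_of_eq rfl (stepAux_simStmt_guess hgl R₁ T v o) ?_⟩
      have h6 : R₁ g = [] := by simp [hR₁]
      have h5 : Function.update R₁ g [] = R₁ := by rw [Function.update_eq_self_iff, h6]
      rw [h6, List.tail_nil, h5, stepAux_rej]
      exact h3
  refine ⟨2 * (R i).length + 2 + (k + N), ?_,
    exec_sim_of_simRun <| h1.trans (w := []) (w' := []) (h2.trans (w := []) (w' := []) h3)⟩
  omega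

end Sim

end Mach

end

/-! ### Fragments as deterministic machines -/

section

namespace Frag

variable {Γ₀ Γ₁ A ι : Type} [DecidableEq ι] [Fintype ι] [Fintype A] [Fintype Γ₀]

/-- The stacks of the machine that runs a fragment: those of the fragment, the input stack
and the output stack. -/
abbrev MStk (F : Frag A ι) (Γ₀ Γ₁ : Type) : (ι ⊕ F.H) ⊕ Bool → Type
  | .inl k => Sum.elim (fun _ : ι => A) F.Γ k
  | .inr false => Γ₀
  | .inr true => Γ₁

/-- The contents of the stacks of the machine that runs a fragment. -/
def mstk (F : Frag A ι) (T : ∀ k, List (Sum.elim (fun _ : ι => A) F.Γ k)) (x : List Γ₀)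
    (y : List Γ₁) : ∀ k, List (F.MStk Γ₀ Γ₁ k)
  | .inl k => T k
  | .inr false => x
  | .inr true => y

/-- The translation of statements used by the machine that runs a fragment. -/
def machTr (F : Frag A ι) (Γ₀ Γ₁ : Type) : Tr (Sum.elim (fun _ : ι => A) F.Γ) (F.MStk Γ₀ Γ₁) F.Λ
    (Fin 4 ⊕ F.Λ) F.σ (F.σ × Option A) where
  e := Sum.inl
  φ _ := id
  ψ _ := id
  lab := Sum.inr
  get := Prod.fst
  upd s a := (a, s.2)

theorem machTr_sound (F : Frag A ι) (x : List Γ₀) (y : List Γ₁) (o : Option A) :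
    (F.machTr Γ₀ Γ₁).Sound (fun v => (v, o)) (fun T => F.mstk T x y) where
  ψ_φ _ _ := rfl
  get_emb _ := rfl
  upd_emb _ _ := rfl
  mrg_e T k := (List.map_id (T k)).symm
  mrg_ne T k l k' hk := by
    rcases k' with k' | b
    · exact Function.update_of_ne (fun e => hk (congrArg Sum.inl e)) l T
    · cases b <;> rfl

/-- The statements of the machine that runs a fragment with input and output in the register `i`;
the register `t` is used in between. -/
def machStmt (F : Frag A ι) (enc : Γ₀ → A) (dec : A → Γ₁) (a₀ : A) (i t : ι) :
    Fin 4 ⊕ F.Λ → TM2.Stmt (F.MStk Γ₀ Γ₁) (Fin 4 ⊕ F.Λ) (F.σ × Option A)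
  | .inl 0 => .pop (.inr false) (fun s o => (s.1, o.map enc)) (.branch (fun s => s.2.isSome)
      (.push (.inl (.inl t)) (fun s => s.2.getD a₀) (.goto fun _ => .inl 0))
      (.goto fun _ => .inl 1))
  | .inl 1 => .pop (.inl (.inl t)) (fun s o => (s.1, o)) (.branch (fun s => s.2.isSome)
      (.push (.inl (.inl i)) (fun s => s.2.getD a₀) (.goto fun _ => .inl 1))
      (.goto fun _ => .inr F.main))
  | .inl 2 => .pop (.inl (.inl i)) (fun s o => (s.1, o)) (.branch (fun s => s.2.isSome)
      (.push (.inl (.inl t)) (fun s => s.2.getD a₀) (.goto fun _ => .inl 2))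
      (.goto fun _ => .inl 3))
  | .inl 3 => .pop (.inl (.inl t)) (fun s o => (s.1, o)) (.branch (fun s => s.2.isSome)
      (.push (.inr true) (fun s => dec (s.2.getD a₀)) (.goto fun _ => .inl 3))
      .halt)
  | .inr l => (F.machTr Γ₀ Γ₁).stmt (.goto fun _ => .inl 2) (F.m l)

/-- The machine that runs a fragment. -/
def toTM (F : Frag A ι) (enc : Γ₀ → A) (dec : A → Γ₁) (a₀ : A) (i t : ι) :
    TM2ComputableAux Γ₀ Γ₁ where
  tm :=
    { K := (ι ⊕ F.H) ⊕ Bool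
      k₀ := .inr false
      k₁ := .inr true
      Γ := F.MStk Γ₀ Γ₁
      Λ := Fin 4 ⊕ F.Λ
      main := .inl 0
      σ := F.σ × Option A
      initialState := (F.s0, none)
      Γk₀Fin := inferInstanceAs (Fintype Γ₀)
      m := F.machStmt enc dec a₀ i t }
  inputAlphabet := Equiv.refl Γ₀
  outputAlphabet := Equiv.refl Γ₁

variable {F : Frag A ι} {enc : Γ₀ → A} {dec : A → Γ₁} {a₀ : A} {i t : ι}

/-- A run with no guesses takes no step at a guessing label, so switching all guessing off leaves it
intact. -/
theorem NRun.unguess {K : Type} [DecidableEq K] {Γ : K → Type} {Λ σ : Type} {g : Λ → Bool}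
    {m a : Λ → TM2.Stmt Γ Λ σ} {n : ℕ} {w : Str} {c c' : TM2.Cfg Γ Λ σ}
    (h : NRun g m a n w c c') (hw : w = []) : NRun (fun _ => false) m m n [] c c' := by
  induction h with
  | refl => exact .refl _
  | det l v S hl h ih => exact .det l v S rfl (ih hw)
  | guess => cases hw

/-- The registers when all are empty except one. -/
def only (i : ι) (l : List A) : ι → List A := Function.update (fun _ => []) i l

theorem only_self (i : ι) (l : List A) : only i l i = l := Function.update_self _ _ _

theorem only_ne {i j : ι} (h : j ≠ i) (l : List A) : only i l j = [] :=
  Function.update_of_ne h _ _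

theorem NRun.of_steps {K : Type} [DecidableEq K] {Γ : K → Type} {Λ σ : Type} {g : Λ → Bool}
    {m a : Λ → TM2.Stmt Γ Λ σ} {n n' : ℕ} {w : Str} {c c' : TM2.Cfg Γ Λ σ}
    (h : NRun g m a n w c c') (hn : n = n') : NRun g m a n' w c c' := hn ▸ h

theorem toTM_run (hit : i ≠ t) (x : List Γ₀) (y : List A) {n : ℕ}
    (h : F.Exec (only i (x.map enc)) [] (only i y) n) :
    NRun (fun _ => false) (F.machStmt enc dec a₀ i t) (F.machStmt enc dec a₀ i t)
      (2 * x.length + 2 + n + (2 * y.length + 2)) []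
      ⟨some (.inl 0), (F.s0, none), F.mstk (F.store fun _ => []) x []⟩
      ⟨none, (F.s0, none), F.mstk (F.store fun _ => []) [] (y.map dec)⟩ := by
  have h1 : NRun (fun _ => false) (F.machStmt enc dec a₀ i t) (F.machStmt enc dec a₀ i t)
      (x.length + 1) [] ⟨some (.inl 0), (F.s0, none), F.mstk (F.store fun _ => []) x []⟩
      ⟨some (.inl 1), (F.s0, none), F.mstk (F.store (only t (x.map enc).reverse)) [] []⟩ := by
    refine NRun.move (g := fun _ => false) (m := F.machStmt enc dec a₀ i t) (L := .inl 0)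
      (k := .inr false) (k' := .inl (.inl t)) (f := fun s o => (s.1, o.map enc))
      (p := fun s => s.2.isSome) (h := fun s => s.2.getD a₀) (conv := enc) (by simp) rfl rfl
      (fun _ _ _ => rfl) (fun _ => rfl) (fun _ _ => rfl) (fun _ _ => rfl) (F.s0, none)
      (F.mstk (F.store fun _ => []) x []) _ ?_ ?_ ?_ rfl
    · rfl
    · have : only t (x.map enc).reverse t = x.reverse.map enc ++ [] := by rw [only_self]; simp
      exact this
    · rintro ((j | j) | b) hj hj'
      · exact only_ne (by simpa using hj') (x.map enc).reverse
      · rfl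
      · cases b
        · exact absurd rfl hj
        · rfl
  have h2 : NRun (fun _ => false) (F.machStmt enc dec a₀ i t) (F.machStmt enc dec a₀ i t)
      (x.length + 1) []
      ⟨some (.inl 1), (F.s0, none), F.mstk (F.store (only t (x.map enc).reverse)) [] []⟩
      ⟨some (.inr F.main), (F.s0, none), F.mstk (F.store (only i (x.map enc))) [] []⟩ := by
    refine NRun.of_steps (NRun.move (g := fun _ => false) (m := F.machStmt enc dec a₀ i t)
      (L := .inl 1) (k := .inl (.inl t)) (k' := .inl (.inl i)) (f := fun s o => (s.1, o))
      (p := fun s => s.2.isSome) (h := fun s => s.2.getD a₀) (conv := fun x => x)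
      (by simpa using hit.symm) rfl rfl
      (fun _ _ _ => rfl) (fun _ => rfl) (fun _ _ => rfl) (fun _ _ => rfl) (F.s0, none)
      (F.mstk (F.store (only t (x.map enc).reverse)) [] []) _ ?_ ?_ ?_ rfl) ?_
    · exact only_ne hit.symm (x.map enc)
    · have : only i (x.map enc) i = (only t (x.map enc).reverse t).reverse.map (fun x => x) ++
        only t (x.map enc).reverse i := by rw [only_self, only_self, only_ne hit]; simp
      exact this
    · rintro ((j | j) | b) hj hj'
      · exact (only_ne (by simpa using hj') _).trans (only_ne (by simpa using hj) _).symm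
      · rfl
      · cases b <;> rfl
    · change (only t (x.map enc).reverse t).length + 1 = _
      rw [only_self]; simp
  have h3 : NRun (fun _ => false) (F.machStmt enc dec a₀ i t) (F.machStmt enc dec a₀ i t) n []
      ⟨some (.inr F.main), (F.s0, none), F.mstk (F.store (only i (x.map enc))) [] []⟩
      ⟨some (.inl 2), (F.s0, none), F.mstk (F.store (only i y)) [] []⟩ :=
    NRun.translate (g := fun _ => false) (m := F.m) (a := F.m)
      (c := ⟨some F.main, F.s0, F.store (only i (x.map enc))⟩) (c' := ⟨none, F.s0, F.store (only i y)⟩)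
      (ex := .goto fun _ => .inl 2) (F.machTr_sound (Γ₀ := Γ₀) (Γ₁ := Γ₁) [] [] none) (fun _ => rfl) (fun _ => rfl)
      (fun _ => rfl) (NRun.unguess h rfl)
  have h4 : NRun (fun _ => false) (F.machStmt enc dec a₀ i t) (F.machStmt enc dec a₀ i t)
      (y.length + 1) []
      ⟨some (.inl 2), (F.s0, none), F.mstk (F.store (only i y)) [] []⟩
      ⟨some (.inl 3), (F.s0, none), F.mstk (F.store (only t y.reverse)) [] []⟩ := by
    refine NRun.of_steps (NRun.move (g := fun _ => false) (m := F.machStmt enc dec a₀ i t)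
      (L := .inl 2) (k := .inl (.inl i)) (k' := .inl (.inl t)) (f := fun s o => (s.1, o))
      (p := fun s => s.2.isSome) (h := fun s => s.2.getD a₀) (conv := fun x => x)
      (by simpa using hit) rfl rfl
      (fun _ _ _ => rfl) (fun _ => rfl) (fun _ _ => rfl) (fun _ _ => rfl) (F.s0, none)
      (F.mstk (F.store (only i y)) [] []) _ ?_ ?_ ?_ rfl) ?_
    · exact only_ne hit y.reverse
    · have : only t y.reverse t = (only i y i).reverse.map (fun x => x) ++ only i y t := by
        rw [only_self, only_self, only_ne hit.symm]; simp
      exact this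
    · rintro ((j | j) | b) hj hj'
      · exact (only_ne (by simpa using hj') _).trans (only_ne (by simpa using hj) _).symm
      · rfl
      · cases b <;> rfl
    · change (only i y i).length + 1 = _
      rw [only_self]
  have h5 : NRun (fun _ => false) (F.machStmt enc dec a₀ i t) (F.machStmt enc dec a₀ i t)
      (y.length + 1) []
      ⟨some (.inl 3), (F.s0, none), F.mstk (F.store (only t y.reverse)) [] []⟩
      ⟨none, (F.s0, none), F.mstk (F.store fun _ => []) [] (y.map dec)⟩ := by
    refine NRun.of_steps (NRun.move (g := fun _ => false) (m := F.machStmt enc dec a₀ i t)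
      (L := .inl 3) (k := .inl (.inl t)) (k' := .inr true) (f := fun s o => (s.1, o))
      (p := fun s => s.2.isSome) (h := fun s => dec (s.2.getD a₀)) (conv := dec)
      (by simp) rfl rfl
      (fun _ _ _ => rfl) (fun _ => rfl) (fun _ _ => rfl) (fun _ _ => rfl) (F.s0, none)
      (F.mstk (F.store (only t y.reverse)) [] []) _ ?_ ?_ ?_ rfl) ?_
    · rfl
    · have : y.map dec = (only t y.reverse t).reverse.map dec ++ [] := by rw [only_self]; simp
      exact this
    · rintro ((j | j) | b) hj hj'
      · exact (only_ne (by simpa using hj) y.reverse).symm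
      · rfl
      · cases b
        · rfl
        · exact absurd rfl hj'
    · change (only t y.reverse t).length + 1 = _
      rw [only_self]; simp
  refine h1.trans' (w' := []) (h2.trans (w := []) (w' := []) (h3.trans (w := []) (w' := [])
    (h4.trans (w := []) (w' := []) h5))) ?_ rfl
  omega

end Frag

/-- A bound for the number of symbols written by a fragment in one step. -/
def Frag.rate {A ι : Type} [DecidableEq ι] (F : Frag A ι) : ℕ :=
  ∑ l, (pushes (F.m l) + pushes (F.alt l))

theorem Frag.Exec.length_le {A ι : Type} [DecidableEq ι] {F : Frag A ι} {S S' : ι → List A}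
    {w : Str} {n : ℕ} (h : F.Exec S w S' n) (i : ι) :
    (S' i).length ≤ (S i).length + n * F.rate :=
  NRun.length_stk_le h (.inl i)

/-- A fragment that computes `f` in polynomial time gives a machine that does. -/
theorem computable_of_frag {α β Γ₀ Γ₁ A ι : Type} [DecidableEq ι] [Fintype ι] [Fintype A]
    [Fintype Γ₀] {ea : α → List Γ₀} {eb : β → List Γ₁} {f : α → β} (F : Frag A ι) (enc : Γ₀ → A)
    (dec : A → Γ₁) (a₀ : A) {i t : ι} (hit : i ≠ t) (P : Polynomial ℕ) (y : α → List A)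
    (hy : ∀ a, (y a).map dec = eb (f a))
    (h : ∀ a, ∃ n ≤ P.eval (ea a).length,
      F.Exec (Frag.only i ((ea a).map enc)) [] (Frag.only i (y a)) n) :
    Nonempty (TM2ComputableInPolyTime ea eb f) := by
  -- The last summand pays for unloading the output; its length is at most that of the input plus
  -- what can be pushed within the time `P`.
  refine ⟨⟨F.toTM enc dec a₀ i t, 2 * .X + 2 + P + (2 * (.X + P * .C F.rate) + 2), fun a => ?_⟩⟩
  choose n hn h using h
  refine ⟨⟨2 * (ea a).length + 2 + n a + (2 * (y a).length + 2), ?_⟩, ?_⟩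
  · have h0 := (Frag.toTM_run (dec := dec) (a₀ := a₀) hit (ea a) (y a) (h a)).iterate_step rfl
    have h1 : initList (F.toTM enc dec a₀ i t).tm
        (List.map (F.toTM enc dec a₀ i t).inputAlphabet.invFun (ea a)) =
        ⟨some (.inl 0), (F.s0, none), F.mstk (F.store fun _ => []) (ea a) []⟩ := by
      refine congrArg (TM2.Cfg.mk _ _) (funext fun k => ?_)
      rcases k with (k | k) | b
      · rfl
      · rfl
      · cases b
        · exact List.map_id _
        · rfl
    have h2 : haltList (F.toTM enc dec a₀ i t).tm
        (List.map (F.toTM enc dec a₀ i t).outputAlphabet.invFun (eb (f a))) =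
        ⟨none, (F.s0, none), F.mstk (F.store fun _ => []) [] ((y a).map dec)⟩ := by
      refine congrArg (TM2.Cfg.mk _ _) (funext fun k => ?_)
      rcases k with (k | k) | b
      · rfl
      · rfl
      · cases b
        · rfl
        · exact (List.map_id _).trans (hy a).symm
    rw [h1]
    exact h0.trans (congrArg some h2.symm)
  · have h1 := hn a
    have h2 := (h a).length_le i
    have h3 : n a * F.rate ≤ P.eval (ea a).length * F.rate := Nat.mul_le_mul_right _ h1
    rw [Frag.only_self, Frag.only_self, List.length_map] at h2
    simp only [Polynomial.eval_C, Polynomial.eval_add, Polynomial.eval_mul, Polynomial.eval_X, Polynomial.eval_ofNat]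
    omega

end

/-! ### Guess-free execution with time bounds, and calls of machines -/

section

theorem eval_mono (P : Polynomial ℕ) {a b : ℕ} (h : a ≤ b) : P.eval a ≤ P.eval b := by
  rw [Polynomial.eval_eq_sum, Polynomial.eval_eq_sum]
  exact Finset.sum_le_sum fun i _ => Nat.mul_le_mul_left _ (Nat.pow_le_pow_left h i)

namespace Frag

section Does

variable {A ι : Type} [DecidableEq ι] [Fintype A] [DecidableEq A]

/-- `F` transforms the registers `S` into `S'` in at most `T` steps, without guessing. -/
def Does (F : Frag A ι) (S S' : ι → List A) (T : ℕ) : Prop := ∃ n ≤ T, F.Exec S [] S' n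

/-- The same for the runs of a loop. -/
def LoopDoes (i : ι) (B : A → Frag A ι) (S S' : ι → List A) (T : ℕ) : Prop :=
  ∃ n ≤ T, Loops i B S [] S' n

theorem Does.mono {F : Frag A ι} {S S' : ι → List A} {T T' : ℕ} (h : F.Does S S' T) (hT : T ≤ T') :
    F.Does S S' T' := by
  obtain ⟨n, hn, h⟩ := h
  exact ⟨n, hn.trans hT, h⟩

theorem Does.seq {F G : Frag A ι} {S S₁ S₂ : ι → List A} {T T' : ℕ} (h : F.Does S S₁ T)
    (h' : G.Does S₁ S₂ T') : (F.seq G).Does S S₂ (T + T') := by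
  obtain ⟨n, hn, h⟩ := h
  obtain ⟨n', hn', h'⟩ := h'
  exact ⟨n + n', by omega, exec_seq h h'⟩

theorem does_skip (S : ι → List A) : (skip : Frag A ι).Does S S 1 := ⟨1, le_rfl, exec_skip S⟩

theorem does_push (i : ι) (x : A) (S : ι → List A) :
    (push i x).Does S (Function.update S i (x :: S i)) 1 := ⟨1, le_rfl, exec_push i x S⟩

theorem does_cas {i : ι} {B : Option A → Frag A ι} {S S' : ι → List A} {T : ℕ} (o : Option A)
    (l : List A) (ho : (S i).head? = o) (hl : (S i).tail = l)
    (h : (B o).Does (Function.update S i l) S' T) : (cas i B).Does S S' (1 + T) := by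
  subst ho hl
  obtain ⟨n, hn, h⟩ := h
  exact ⟨1 + n, by omega, exec_cas h⟩

theorem LoopDoes.does {i : ι} {B : A → Frag A ι} {S S' : ι → List A} {T : ℕ}
    (h : LoopDoes i B S S' T) : (loop i B).Does S S' T := by
  obtain ⟨n, hn, h⟩ := h
  exact ⟨n, hn, h.exec⟩

theorem LoopDoes.mono {i : ι} {B : A → Frag A ι} {S S' : ι → List A} {T T' : ℕ}
    (h : LoopDoes i B S S' T) (hT : T ≤ T') : LoopDoes i B S S' T' := by
  obtain ⟨n, hn, h⟩ := h
  exact ⟨n, hn.trans hT, h⟩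

theorem loopDoes_nil {i : ι} {B : A → Frag A ι} {S : ι → List A} (h : S i = []) :
    LoopDoes i B S S 1 := ⟨1, le_rfl, .nil h⟩

theorem loopDoes_cons {i : ι} {B : A → Frag A ι} {S S₁ S' : ι → List A} {x : A} {l : List A}
    {T T' : ℕ} (h : S i = x :: l) (h₁ : (B x).Does (Function.update S i l) S₁ T)
    (h₂ : LoopDoes i B S₁ S' T') : LoopDoes i B S S' (1 + T + T') := by
  obtain ⟨n, hn, h₁⟩ := h₁
  obtain ⟨n', hn', h₂⟩ := h₂
  exact ⟨1 + n + n', by omega, .cons (w := []) (w' := []) h h₁ h₂⟩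

/-- Move the contents of a register to another register (in reverse order). -/
def move (i j : ι) : Frag A ι := loop i fun x => push j x

theorem does_move {i j : ι} (hij : i ≠ j) (S : ι → List A) :
    (move i j).Does S (Function.update (Function.update S i []) j ((S i).reverse ++ S j))
      (2 * (S i).length + 1) := by
  refine LoopDoes.does ?_
  generalize hl : S i = l
  induction l generalizing S with
  | nil =>
    have : Function.update S i [] = S := by rw [← hl, Function.update_eq_self]
    rw [this, List.reverse_nil, List.nil_append, Function.update_eq_self]
    exact loopDoes_nil hl
  | cons x l ih =>
    have h := loopDoes_cons (B := fun x => push j x) hl (does_push j x _) (ih _ (by simp [hij]))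
    refine (?_ : LoopDoes _ _ _ _ _).mono (?_ : 1 + 1 + (2 * l.length + 1) ≤ _)
    · convert h using 1
      funext k
      by_cases hk : k = j
      · subst hk; simp [Function.update_of_ne hij.symm]
      · by_cases hk' : k = i
        · subst hk'; simp [hk]
        · simp [hk, hk']
    · simp only [List.length_cons]; omega

/-- Empty a register. -/
def clear (i : ι) : Frag A ι := loop i fun _ => skip

theorem does_clear (i : ι) (S : ι → List A) :
    (clear i).Does S (Function.update S i []) (2 * (S i).length + 1) := by
  refine LoopDoes.does ?_
  generalize hl : S i = l
  induction l generalizing S with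
  | nil =>
    have : Function.update S i [] = S := by rw [← hl, Function.update_eq_self]
    rw [this]
    exact loopDoes_nil hl
  | cons x l ih =>
    have h := loopDoes_cons (B := fun _ => skip) hl (does_skip _) (ih _ (by simp))
    rw [Function.update_idem] at h
    refine h.mono ?_
    simp only [List.length_cons]; omega

end Does

section Call

variable {A α β αΓ βΓ : Type} [Fintype A] [DecidableEq A] {ea : α → List αΓ} {eb : β → List βΓ}
  {f : α → β}

/-- A deterministic machine as a nondeterministic one that does not guess. -/
def ofAux (M : TM2ComputableAux αΓ βΓ) : Mach αΓ βΓ where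
  toTM2ComputableAux := M
  guessing _ := false
  alt := M.tm.m
  accept _ := true

theorem ofAux_run (h : TM2ComputableInPolyTime ea eb f) (a : α) :
    ∃ n ≤ h.time.eval (ea a).length, (ofAux h.toTM2ComputableAux).Run n []
      ((ofAux h.toTM2ComputableAux).init (ea a))
      (haltList h.tm ((eb (f a)).map h.outputAlphabet.symm)) :=
  ⟨(h.outputsFun a).steps, (h.outputsFun a).steps_le_m,
    NRun.of_iterate_step (fun _ => rfl) (h.outputsFun a).evals_in_steps⟩

theorem haltList_stk (tm : FinTM2) (s : List (tm.Γ tm.k₁)) : (haltList tm s).stk tm.k₁ = s := by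
  simp only [haltList, dif_pos]
  rfl

/-- A machine cannot write more than its running time allows. Composition needs this, because the
second function is timed in the length of the output of the first. -/
theorem exists_length_le (h : TM2ComputableInPolyTime ea eb f) :
    ∃ P : Polynomial ℕ, ∀ a, (eb (f a)).length ≤ P.eval (ea a).length := by
  refine ⟨.X + h.time * .C (ofAux h.toTM2ComputableAux).rate, fun a => ?_⟩
  obtain ⟨n, hn, r⟩ := ofAux_run h a
  have h1 : ((haltList h.tm ((eb (f a)).map h.outputAlphabet.symm)).stk h.tm.k₁).length ≤ _ :=
    Mach.length_stk_le r h.tm.k₁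
  rw [haltList_stk, List.length_map] at h1
  have h2 := Nat.mul_le_mul_right (ofAux h.toTM2ComputableAux).rate hn
  simp only [Polynomial.eval_add, Polynomial.eval_mul, Polynomial.eval_X, Polynomial.eval_C]
  omega

/-- A fragment that calls a machine. -/
theorem exists_call (h : TM2ComputableInPolyTime ea eb f) (enc : A → αΓ) (out : βΓ → A) (a₀ : A) :
    ∃ P : Polynomial ℕ, ∀ {ι : Type} [DecidableEq ι] (i t g : ι), i ≠ t → i ≠ g → t ≠ g →
      ∃ F : Frag A ι, ∀ (R : ι → List A) (a : α), R t = [] → R g = [] → (R i).map enc = ea a →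
        F.Does R (Function.update R i ((eb (f a)).map out)) (P.eval (ea a).length) := by
  set M := ofAux h.toTM2ComputableAux with hM
  refine ⟨10 * (.X + h.time + h.time * .C M.rate + 1) + 2, ?_⟩
  intro ι _ i t g hit hig htg
  -- A machine without guesses that always accepts leaves the verdict `a₀` in front of its output;
  -- the final `cas` removes it.
  refine ⟨(M.sim enc out (fun _ => a₀) (fun _ => false) i t g).seq (cas i fun _ => skip),
    fun R a ht hg ha => ?_⟩
  obtain ⟨n, hn, r⟩ := ofAux_run h a
  rw [← ha] at r
  obtain ⟨N, hN, r'⟩ := Mach.exec_sim_accept (M := M) (enc := enc) (out := out)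
    (em := fun _ => a₀) (bit := fun _ => false) hit hig htg R ht
    (by rw [hg, List.map_nil]; exact r) rfl rfl
  have h0 : ((haltList h.tm ((eb (f a)).map h.outputAlphabet.symm)).stk h.tm.k₁).map
      (fun y => out (h.outputAlphabet y)) = (eb (f a)).map out := by
    rw [haltList_stk, List.map_map]
    refine List.map_congr_left fun y _ => ?_
    exact congrArg out (h.outputAlphabet.apply_symm_apply y)
  have h1 : ((haltList h.tm ((eb (f a)).map h.outputAlphabet.symm)).stk M.tm.k₁).map
      (fun y => out (M.outputAlphabet y)) = (eb (f a)).map out := h0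
  have h2 : Function.update R g [] = R := by rw [← hg, Function.update_eq_self]
  rw [h1, h2] at r'
  refine Does.mono (Does.seq ⟨N, hN, r'⟩ (does_cas (some a₀) ((eb (f a)).map out) (by simp)
    (by simp) ?_)) (?_ : _ + (1 + 1) ≤ _)
  · rw [Function.update_idem]
    exact does_skip _
  · have hl : (R i).length = (ea a).length := by rw [← ha, List.length_map]
    rw [hl, hg]
    have h2 := Nat.mul_le_mul_right M.rate hn
    simp only [Polynomial.eval_add, Polynomial.eval_mul, Polynomial.eval_X, Polynomial.eval_C,
      Polynomial.eval_ofNat, Polynomial.eval_one, List.length_nil]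
    omega

end Call

end Frag

end

/-! ### A calculus of polynomial-time functions between encoded types -/

section

/-- Types whose elements are encoded by strings. -/
class Enc (α : Type) where
  enc : α → Str

open Enc (enc)

/-- Write every bit with a marker in front of it. -/
def dbl (x : Str) : Str := x.flatMap fun b => [true, b]

instance : Enc Str := ⟨id⟩
instance : Enc Bool := ⟨fun b => [b]⟩
-- Only the first component is marked bit by bit, which suffices to find the separating `false`.
instance {α β : Type} [Enc α] [Enc β] : Enc (α × β) := ⟨fun a => dbl (enc a.1) ++ false :: enc a.2⟩

@[simp] theorem enc_str (x : Str) : enc x = x := rfl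
@[simp] theorem enc_bool (b : Bool) : enc b = [b] := rfl
@[simp] theorem enc_pair {α β : Type} [Enc α] [Enc β] (a : α) (b : β) :
    enc (a, b) = dbl (enc a) ++ false :: enc b := rfl
@[simp] theorem dbl_nil : dbl [] = [] := rfl
@[simp] theorem dbl_cons (b : Bool) (x : Str) : dbl (b :: x) = true :: b :: dbl x := rfl
@[simp] theorem dbl_append (x y : Str) : dbl (x ++ y) = dbl x ++ dbl y := by
  simp [dbl]
@[simp] theorem length_dbl (x : Str) : (dbl x).length = 2 * x.length := by
  induction x with
  | nil => rfl
  | cons b x ih => simp [ih]; omega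

variable {α β γ δ : Type} [Enc α] [Enc β] [Enc γ] [Enc δ]

/-- Polynomial-time computability of functions between encoded types. -/
def PT (f : α → β) : Prop := Nonempty (TM2ComputableInPolyTime (enc : α → Str) (enc : β → Str) f)

/-- Polynomially bounded functions. -/
def PB (T : α → ℕ) : Prop := ∃ P : Polynomial ℕ, ∀ a, T a ≤ P.eval (enc a).length

theorem PB.mono {T T' : α → ℕ} (h : PB T') (hT : ∀ a, T a ≤ T' a) : PB T := by
  obtain ⟨P, hP⟩ := h
  exact ⟨P, fun a => (hT a).trans (hP a)⟩

theorem pb_len : PB fun a : α => (enc a).length := ⟨.X, fun a => by simp⟩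

theorem pb_const (n : ℕ) : PB fun _ : α => n := ⟨.C n, fun a => by simp⟩

theorem PB.add {T T' : α → ℕ} (h : PB T) (h' : PB T') : PB fun a => T a + T' a := by
  obtain ⟨P, hP⟩ := h
  obtain ⟨Q, hQ⟩ := h'
  exact ⟨P + Q, fun a => by rw [Polynomial.eval_add]; exact Nat.add_le_add (hP a) (hQ a)⟩

theorem PB.mul {T T' : α → ℕ} (h : PB T) (h' : PB T') : PB fun a => T a * T' a := by
  obtain ⟨P, hP⟩ := h
  obtain ⟨Q, hQ⟩ := h'
  exact ⟨P * Q, fun a => by rw [Polynomial.eval_mul]; exact Nat.mul_le_mul (hP a) (hQ a)⟩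

theorem PB.comp {T : β → ℕ} {f : α → β} (h : PB T) (hf : PB fun a => (enc (f a)).length) :
    PB fun a => T (f a) := by
  obtain ⟨P, hP⟩ := h
  obtain ⟨Q, hQ⟩ := hf
  exact ⟨P.comp Q, fun a => by
    rw [Polynomial.eval_comp]; exact (hP _).trans (eval_mono _ (hQ a))⟩

theorem PT.pb {f : α → β} (h : PT f) : PB fun a => (enc (f a)).length := by
  obtain ⟨h⟩ := h
  exact Frag.exists_length_le h

theorem pb_fst {f : α → γ × δ} (h : PB fun a => (enc (f a)).length) :
    PB fun a => (enc (f a).1).length := h.mono fun a => by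
  obtain ⟨c, d⟩ := f a
  simp; omega

theorem pb_snd {f : α → γ × δ} (h : PB fun a => (enc (f a)).length) :
    PB fun a => (enc (f a).2).length := h.mono fun a => by
  obtain ⟨c, d⟩ := f a
  simp; omega

namespace Frag

variable {A : Type} [Fintype A] [DecidableEq A]

theorem upd_zero (a b c d x : List A) : Function.update ![a, b, c, d] 0 x = ![x, b, c, d] := by
  funext k; fin_cases k <;> rfl
theorem upd_one (a b c d x : List A) : Function.update ![a, b, c, d] 1 x = ![a, x, c, d] := by
  funext k; fin_cases k <;> rfl
theorem upd_two (a b c d x : List A) : Function.update ![a, b, c, d] 2 x = ![a, b, x, d] := by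
  funext k; fin_cases k <;> rfl
theorem upd_three (a b c d x : List A) : Function.update ![a, b, c, d] 3 x = ![a, b, c, x] := by
  funext k; fin_cases k <;> rfl

theorem only_zero (x : List A) : only (0 : Fin 4) x = ![x, [], [], []] := by
  funext k; fin_cases k <;> rfl

theorem Does.congr {ι : Type} [DecidableEq ι] {F : Frag A ι} {S S' S'' : ι → List A} {T : ℕ}
    (h : F.Does S S' T) (hS : S' = S'') : F.Does S S'' T := hS ▸ h

theorem move_to {i j : Fin 4} (hij : i ≠ j) {S S' : Fin 4 → List A}
    (hS : Function.update (Function.update S i []) j ((S i).reverse ++ S j) = S') :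
    (move i j).Does S S' (2 * (S i).length + 1) := (does_move hij S).congr hS

theorem push_to {i : Fin 4} {x : A} {S S' : Fin 4 → List A}
    (hS : Function.update S i (x :: S i) = S') : (push i x).Does S S' 1 := (does_push i x S).congr hS

theorem clear_to {i : Fin 4} {S S' : Fin 4 → List A} (hS : Function.update S i [] = S') :
    (clear i).Does S S' (2 * (S i).length + 1) := (does_clear i S).congr hS

/-- Split the encoding of a pair in register `0` into its components, in the registers `1` and
`3`, both reversed. -/
def parse (em : Bool → A) : Frag A (Fin 4) :=
  loop 0 fun a => if a = em true then cas 0 fun o => push 1 (o.getD (em false)) else move 0 3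

theorem does_parse {em : Bool → A} (hem : em false ≠ em true) (x w : Str) (r₁ r₂ r₃ : List A) :
    (parse em).Does ![(dbl x ++ false :: w).map em, r₁, r₂, r₃]
      ![[], (x.map em).reverse ++ r₁, r₂, (w.map em).reverse ++ r₃]
      (3 * x.length + 2 * w.length + 3) := by
  refine LoopDoes.does ?_
  induction x generalizing r₁ with
  | nil =>
    refine (loopDoes_cons (T := 2 * w.length + 1) (x := em false) (l := w.map em)
      (S₁ := ![[], r₁, r₂, (w.map em).reverse ++ r₃]) rfl ?_ (loopDoes_nil rfl)).mono ?_
    · rw [if_neg hem, upd_zero]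
      refine (move_to (by decide) ?_).mono ?_
      · exact (congrArg (fun R => Function.update R 3 ((w.map em).reverse ++ r₃))
          (upd_zero _ _ _ _ _)).trans (upd_three _ _ _ _ _)
      · show 2 * (w.map em).length + 1 ≤ _
        simp
    · simp; omega
  | cons b x ih =>
    have h := ih (em b :: r₁)
    refine (loopDoes_cons (T := 1 + 1) (x := em true) (l := em b :: (dbl x ++ false :: w).map em)
      (S₁ := ![(dbl x ++ false :: w).map em, em b :: r₁, r₂, r₃]) rfl ?_ (?_)).mono
      (?_ : 1 + (1 + 1) + (3 * x.length + 2 * w.length + 3) ≤ _)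
    · rw [if_pos rfl, upd_zero]
      refine does_cas (some (em b)) ((dbl x ++ false :: w).map em) rfl rfl ?_
      rw [upd_zero]
      exact push_to (upd_one _ _ _ _ _)
    · simpa using h
    · simp; omega

/-- Split a list over `A` in register `1` onto the registers `0` and `3`. -/
def dup : Frag A (Fin 4) := (move 0 1).seq (loop 1 fun x => (push 0 x).seq (push 3 x))

theorem does_dup_aux (l r₀ r₂ r₃ : List A) :
    LoopDoes 1 (fun x => (push 0 x).seq (push 3 x)) ![r₀, l, r₂, r₃]
      ![l.reverse ++ r₀, [], r₂, l.reverse ++ r₃] (3 * l.length + 1) := by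
  induction l generalizing r₀ r₃ with
  | nil => exact loopDoes_nil rfl
  | cons x l ih =>
    refine (loopDoes_cons (x := x) (l := l) rfl (T := 1 + 1) (S₁ := ![x :: r₀, l, r₂, x :: r₃]) ?_
      (T' := 3 * l.length + 1) ?_).mono ?_
    · rw [upd_one]
      exact (push_to (upd_zero _ _ _ _ _)).seq (push_to (upd_three _ _ _ _ _))
    · simpa using ih (x :: r₀) (x :: r₃)
    · simp; omega

theorem does_dup (l r₂ : List A) :
    dup.Does ![l, [], r₂, []] ![l, [], r₂, l] (5 * l.length + 2) := by
  refine (Does.seq (move_to (S' := ![[], l.reverse, r₂, []]) (by decide) ?_)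
    (does_dup_aux l.reverse [] r₂ []).does).congr ?_ |>.mono ?_
  · rw [upd_zero, upd_one]; simp
  · simp
  · simp; omega

/-- Encode the pair whose components are in the registers `0` and `3`. -/
def mkPair (em : Bool → A) : Frag A (Fin 4) :=
  (move 0 1).seq ((move 3 2).seq ((move 2 0).seq ((push 0 (em false)).seq
    (loop 1 fun x => (push 0 x).seq (push 0 (em true))))))

theorem does_mkPair_aux (em : Bool → A) (x : Str) (r₀ r₂ r₃ : List A) :
    LoopDoes 1 (fun x => (push 0 x).seq (push 0 (em true))) ![r₀, (x.map em).reverse, r₂, r₃]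
      ![(dbl x).map em ++ r₀, [], r₂, r₃] (3 * x.length + 1) := by
  induction x using List.reverseRecOn generalizing r₀ with
  | nil => exact loopDoes_nil rfl
  | append_singleton x b ih =>
    refine (loopDoes_cons (x := em b) (l := (x.map em).reverse) (by simp) (T := 1 + 1)
      (S₁ := ![em true :: em b :: r₀, (x.map em).reverse, r₂, r₃]) ?_
      (T' := 3 * x.length + 1) ?_).mono ?_
    · rw [upd_one]
      exact (push_to (upd_zero _ _ _ _ _)).seq (push_to (upd_zero _ _ _ _ _))
    · simpa using ih (em true :: em b :: r₀)
    · simp; omega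

theorem does_mkPair (em : Bool → A) (x w : Str) :
    (mkPair em).Does ![x.map em, [], [], w.map em] ![(dbl x ++ false :: w).map em, [], [], []]
      (5 * x.length + 4 * w.length + 5) := by
  refine (Does.seq (move_to (S' := ![[], (x.map em).reverse, [], w.map em]) (by decide) ?_)
    (Does.seq (move_to (S' := ![[], (x.map em).reverse, (w.map em).reverse, []]) (by decide) ?_)
    (Does.seq (move_to (S' := ![w.map em, (x.map em).reverse, [], []]) (by decide) ?_)
    (Does.seq (push_to (upd_zero _ _ _ _ _)) (does_mkPair_aux em x _ [] []).does)))).congr ?_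
    |>.mono ?_
  · rw [upd_zero, upd_one]; simp
  · rw [upd_three, upd_two]; simp
  · rw [upd_two, upd_zero]; simp
  · simp
  · simp; omega

/-- A fragment that calls a polynomial-time function. -/
theorem exists_call_pt {f : α → β} (h : PT f) :
    ∃ T : α → ℕ, PB T ∧ ∀ i t g : Fin 4, i ≠ t → i ≠ g → t ≠ g → ∃ F : Frag Bool (Fin 4),
      ∀ (R : Fin 4 → Str) (a : α), R t = [] → R g = [] → R i = enc a →
        F.Does R (Function.update R i (enc (f a))) (T a) := by
  obtain ⟨h⟩ := h
  obtain ⟨P, hP⟩ := exists_call h (id : Bool → Bool) id false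
  refine ⟨fun a => P.eval (enc a).length, ⟨P, fun _ => le_rfl⟩, fun i t g hit hig htg => ?_⟩
  obtain ⟨F, hF⟩ := hP i t g hit hig htg
  refine ⟨F, fun R a ht hg ha => ?_⟩
  simpa using hF R a ht hg (by simpa using ha)

end Frag

open Frag

/-- Four registers suffice throughout: register 0 for input and output, another one for a second
value, and two as scratch space for calls. -/
theorem PT.of_does {f : α → β} (F : Frag Bool (Fin 4)) {T : α → ℕ} (hT : PB T)
    (h : ∀ a, F.Does ![enc a, [], [], []] ![enc (f a), [], [], []] (T a)) : PT f := by
  obtain ⟨P, hP⟩ := hT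
  refine computable_of_frag F id id false (i := 0) (t := 1) (by decide) P (fun a => enc (f a))
    (fun a => List.map_id _) fun a => ?_
  obtain ⟨n, hn, r⟩ := h a
  refine ⟨n, hn.trans (hP a), ?_⟩
  rw [only_zero, only_zero, List.map_id]
  exact r

theorem pt_id : PT fun a : α => a := PT.of_does skip (pb_const 1) fun _ => does_skip _

theorem PT.comp {f : α → β} {g : β → γ} (hg : PT g) (hf : PT f) : PT fun a => g (f a) := by
  obtain ⟨T, hT, hF⟩ := exists_call_pt hf
  obtain ⟨T', hT', hG⟩ := exists_call_pt hg
  obtain ⟨F, hF⟩ := hF 0 1 2 (by decide) (by decide) (by decide)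
  obtain ⟨G, hG⟩ := hG 0 1 2 (by decide) (by decide) (by decide)
  refine PT.of_does (F.seq G) (hT.add (hT'.comp hf.pb)) fun a => ?_
  have h1 := (hF ![enc a, [], [], []] a rfl rfl rfl).congr (upd_zero _ _ _ _ _)
  have h2 := (hG ![enc (f a), [], [], []] (f a) rfl rfl rfl).congr (upd_zero _ _ _ _ _)
  exact h1.seq h2

/-- The input is copied to register 3, so that the two calls can work on their own copies and share
the scratch registers 1 and 2. -/
theorem PT.pair {f : α → β} {g : α → γ} (hf : PT f) (hg : PT g) : PT fun a => (f a, g a) := by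
  obtain ⟨T, hT, hF⟩ := exists_call_pt hf
  obtain ⟨T', hT', hG⟩ := exists_call_pt hg
  obtain ⟨F, hF⟩ := hF 0 1 2 (by decide) (by decide) (by decide)
  obtain ⟨G, hG⟩ := hG 3 1 2 (by decide) (by decide) (by decide)
  refine PT.of_does (dup.seq (F.seq (G.seq (mkPair id)))) (T := fun a => 5 * (enc a).length + 2 +
    (T a + (T' a + (5 * (enc (f a)).length + 4 * (enc (g a)).length + 5)))) ?_ fun a => ?_
  · exact (((pb_const 5).mul pb_len).add (pb_const 2)).add (hT.add (hT'.add
      ((((pb_const 5).mul hf.pb).add ((pb_const 4).mul hg.pb)).add (pb_const 5))))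
  have h1 := (hF ![enc a, [], [], enc a] a rfl rfl rfl).congr (upd_zero _ _ _ _ _)
  have h2 := (hG ![enc (f a), [], [], enc a] a rfl rfl rfl).congr (upd_three _ _ _ _ _)
  have h3 := does_mkPair id (enc (f a)) (enc (g a))
  simp only [List.map_id] at h3
  exact (does_dup _ _).seq (h1.seq (h2.seq h3))

theorem does_parse_id (x w r₁ r₂ r₃ : Str) :
    (parse id).Does ![dbl x ++ false :: w, r₁, r₂, r₃] ![[], x.reverse ++ r₁, r₂, w.reverse ++ r₃]
      (3 * x.length + 2 * w.length + 3) := by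
  simpa using does_parse (em := (id : Bool → Bool)) (by decide) x w r₁ r₂ r₃

theorem pt_fst : PT fun a : α × β => a.1 := by
  refine PT.of_does ((parse id).seq ((clear 3).seq (move 1 0))) (T := fun a =>
    3 * (enc a.1).length + 2 * (enc a.2).length + 3 + (2 * (enc a.2).length + 1 +
      (2 * (enc a.1).length + 1))) ?_ fun a => ?_
  · exact ((((pb_const 3).mul (pb_fst pb_len)).add ((pb_const 2).mul (pb_snd pb_len))).add
      (pb_const 3)).add ((((pb_const 2).mul (pb_snd pb_len)).add (pb_const 1)).add
      (((pb_const 2).mul (pb_fst pb_len)).add (pb_const 1)))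
  refine ((does_parse_id (enc a.1) (enc a.2) [] [] []).seq
    ((clear_to (i := 3) (S' := ![[], (enc a.1).reverse, [], []]) ?_).seq
      (move_to (S' := ![enc a.1, [], [], []]) (by decide) ?_))).mono ?_
  · rw [upd_three]; simp
  · rw [upd_one, upd_zero]; simp
  · simp

theorem pt_snd : PT fun a : α × β => a.2 := by
  refine PT.of_does ((parse id).seq ((clear 1).seq (move 3 0))) (T := fun a =>
    3 * (enc a.1).length + 2 * (enc a.2).length + 3 + (2 * (enc a.1).length + 1 +
      (2 * (enc a.2).length + 1))) ?_ fun a => ?_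
  · exact ((((pb_const 3).mul (pb_fst pb_len)).add ((pb_const 2).mul (pb_snd pb_len))).add
      (pb_const 3)).add ((((pb_const 2).mul (pb_fst pb_len)).add (pb_const 1)).add
      (((pb_const 2).mul (pb_snd pb_len)).add (pb_const 1)))
  refine ((does_parse_id (enc a.1) (enc a.2) [] [] []).seq
    ((clear_to (i := 1) (S' := ![[], [], [], (enc a.2).reverse]) ?_).seq
      (move_to (S' := ![enc a.2, [], [], []]) (by decide) ?_))).mono ?_
  · rw [upd_one]; simp
  · rw [upd_three, upd_zero]; simp
  · simp

theorem PT.fst {f : α → β × γ} (h : PT f) : PT fun a => (f a).1 := pt_fst.comp h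

theorem PT.snd {f : α → β × γ} (h : PT f) : PT fun a => (f a).2 := pt_snd.comp h

theorem pt_const (b : β) : PT fun _ : α => b := by
  have key : ∀ l r : Str, ∃ F : Frag Bool (Fin 4), F.Does ![r, [], [], []] ![l ++ r, [], [], []]
      (l.length + 1) := by
    intro l
    induction l with
    | nil => exact fun r => ⟨skip, does_skip _⟩
    | cons x l ih =>
      intro r
      obtain ⟨F, hF⟩ := ih r
      refine ⟨F.seq (push 0 x), (hF.seq (push_to (upd_zero _ _ _ _ _))).mono ?_⟩
      simp
  obtain ⟨F, hF⟩ := key (enc b) []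
  rw [List.append_nil] at hF
  refine PT.of_does ((clear 0).seq F) (T := fun a => 2 * (enc a).length + 1 +
    ((enc b).length + 1)) ?_ fun a => ?_
  · exact (((pb_const 2).mul pb_len).add (pb_const 1)).add (pb_const _)
  · exact (clear_to (upd_zero _ _ _ _ _)).seq hF

theorem pt_cond {f g : α → β} (hf : PT f) (hg : PT g) :
    PT fun a : Bool × α => if a.1 then f a.2 else g a.2 := by
  obtain ⟨T, hT, hF⟩ := exists_call_pt hf
  obtain ⟨T', hT', hG⟩ := exists_call_pt hg
  obtain ⟨F, hF⟩ := hF 0 1 2 (by decide) (by decide) (by decide)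
  obtain ⟨G, hG⟩ := hG 0 1 2 (by decide) (by decide) (by decide)
  -- The code of `(b, a)` is `true, b, false` followed by the code of `a`: the condition is the
  -- second of three pops.
  refine PT.of_does (cas 0 fun _ => cas 0 fun o => cas 0 fun _ => if o = some true then F else G)
    (T := fun a => 3 + (T a.2 + T' a.2)) ?_ fun a => ?_
  · exact (pb_const 3).add ((hT.comp (pb_snd pb_len)).add (hT'.comp (pb_snd pb_len)))
  obtain ⟨b, a⟩ := a
  refine (does_cas (some true) ([b, false] ++ enc a) rfl rfl ?_).mono
    (T := 1 + (1 + (1 + (T a + T' a)))) (by simp only; omega)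
  rw [upd_zero]
  refine does_cas (some b) ([false] ++ enc a) rfl rfl ?_
  rw [upd_zero]
  refine does_cas (some false) (enc a) rfl rfl ?_
  rw [upd_zero]
  cases b
  · simp only [Option.some.injEq, Bool.false_eq_true, if_false]
    exact ((hG ![enc a, [], [], []] a rfl rfl rfl).congr (upd_zero _ _ _ _ _)).mono (by omega)
  · simp only [if_true]
    exact ((hF ![enc a, [], [], []] a rfl rfl rfl).congr (upd_zero _ _ _ _ _)).mono (by omega)

theorem PT.ite {c : α → Bool} {f g : α → β} (hc : PT c) (hf : PT f) (hg : PT g) :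
    PT fun a => if c a then f a else g a :=
  (pt_cond hf hg).comp (hc.pair pt_id)

/-- The string is parsed into register 1 in reverse, so that popping delivers its bits from the
right, as `foldr` consumes them. The hypothesis `hb` is what keeps the iteration polynomial: each
intermediate value is the fold of a suffix and hence bounded by the same polynomial. -/
theorem pt_foldr_aux {h : Bool → β → β} (h0 : PT (h false)) (h1 : PT (h true))
    (hb : PB fun a : Str × β => (enc (a.1.foldr h a.2)).length) :
    PT fun a : Str × β => a.1.foldr h a.2 := by
  obtain ⟨T₀, hT₀, hF⟩ := exists_call_pt h0
  obtain ⟨T₁, hT₁, hG⟩ := exists_call_pt h1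
  obtain ⟨F, hF⟩ := hF 0 2 3 (by decide) (by decide) (by decide)
  obtain ⟨G, hG⟩ := hG 0 2 3 (by decide) (by decide) (by decide)
  obtain ⟨P₀, hP₀⟩ := hT₀
  obtain ⟨P₁, hP₁⟩ := hT₁
  obtain ⟨Q, hQ⟩ := hb
  -- Loop invariant: the prefix `y` is still to be read, and the fold of the remaining suffix has
  -- been computed.
  have loop_does : ∀ (N : ℕ) (x : Str) (s : β), (enc (x, s)).length ≤ N →
      ∀ y, x = y ++ (x.drop y.length) →
      LoopDoes 1 (fun b => if b then G else F)
        ![enc ((x.drop y.length).foldr h s), y.reverse, [], []]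
        ![enc (x.foldr h s), [], [], []]
        (y.length * (1 + (P₀.eval (Q.eval N) + P₁.eval (Q.eval N))) + 1) := by
    intro N x s hN y
    induction y using List.reverseRecOn with
    | nil =>
      intro _
      exact (loopDoes_nil (i := 1) (S := ![enc (x.foldr h s), [], [], []]) rfl).mono (by simp)
    | append_singleton y b ih =>
      intro hx
      have hd : x.drop y.length = b :: x.drop (y ++ [b]).length := by
        conv_lhs => rw [hx]
        simp
      have hx' : x = y ++ x.drop y.length := by rw [hd]; simpa using hx
      have h2 := ih hx'
      have hle : (enc ((x.drop (y ++ [b]).length).foldr h s)).length ≤ Q.eval N := by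
        refine (hQ (x.drop (y ++ [b]).length, s)).trans (eval_mono _ (le_trans ?_ hN))
        simp
      rw [hd, List.foldr_cons] at h2
      refine (loopDoes_cons (x := b) (l := y.reverse) (by simp)
        (T := P₀.eval (Q.eval N) + P₁.eval (Q.eval N)) ?_ h2).mono ?_
      · rw [upd_one]
        cases b
        · exact ((hF ![_, y.reverse, [], []] _ rfl rfl rfl).congr (upd_zero _ _ _ _ _)).mono
            (((hP₀ _).trans (eval_mono _ hle)).trans (by omega))
        · exact ((hG ![_, y.reverse, [], []] _ rfl rfl rfl).congr (upd_zero _ _ _ _ _)).mono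
            (((hP₁ _).trans (eval_mono _ hle)).trans (by omega))
      · simp only [List.length_append, List.length_singleton, Nat.succ_mul]; omega
  refine PT.of_does ((parse id).seq ((move 3 0).seq (loop 1 fun b => if b then G else F)))
    (T := fun a => 3 * (enc a.1).length + 2 * (enc a.2).length + 3 + (2 * (enc a.2).length + 1 +
      ((enc a.1).length * (1 + (P₀.eval (Q.eval (enc a).length) +
        P₁.eval (Q.eval (enc a).length))) + 1))) ?_ fun a => ?_
  · refine ((((pb_const 3).mul (pb_fst pb_len)).add ((pb_const 2).mul (pb_snd pb_len))).add
      (pb_const 3)).add ((((pb_const 2).mul (pb_snd pb_len)).add (pb_const 1)).add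
      (((pb_fst pb_len).mul ((pb_const 1).add (PB.add ?_ ?_))).add (pb_const 1)))
    · exact ⟨P₀.comp Q, fun a => by rw [Polynomial.eval_comp]⟩
    · exact ⟨P₁.comp Q, fun a => by rw [Polynomial.eval_comp]⟩
  · obtain ⟨x, s⟩ := a
    have h3 := (loop_does _ x s le_rfl x (by simp)).does
    rw [List.drop_length, List.foldr_nil] at h3
    refine ((does_parse_id x (enc s) [] [] []).seq
      ((move_to (S' := ![enc s, x.reverse, [], []]) (by decide) ?_).seq h3)).mono ?_
    · rw [upd_three, upd_zero]; simp
    · simp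

/-- Structural recursion along a string, with a parameter. -/
theorem PT.foldr {l : α → Str} {s : α → β} {h : Bool → β → α → β} (hl : PT l) (hs : PT s)
    (h0 : PT fun a : β × α => h false a.1 a.2) (h1 : PT fun a : β × α => h true a.1 a.2)
    (hb : PB fun a : (Str × β) × α => (enc (a.1.1.foldr (fun b s => h b s a.2) a.1.2)).length) :
    PT fun a => (l a).foldr (fun b s => h b s a) (s a) := by
  have key : ∀ (x : Str) (s : β) (a : α),
      x.foldr (fun b (t : β × α) => (h b t.1 t.2, t.2)) (s, a) =
        (x.foldr (fun b s => h b s a) s, a) := by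
    intro x s a
    induction x with
    | nil => rfl
    | cons b x ih => simp [ih]
  have hp : PT fun a : Str × (β × α) =>
      a.1.foldr (fun b (t : β × α) => (h b t.1 t.2, t.2)) a.2 := by
    refine pt_foldr_aux (h0.pair pt_snd) (h1.pair pt_snd) ?_
    have : PB fun a : Str × (β × α) => (enc (a.1.foldr (fun b s => h b s a.2.2) a.2.1)).length := by
      refine (hb.comp (f := fun a : Str × (β × α) => ((a.1, a.2.1), a.2.2)) ?_)
      exact ((pt_fst.pair pt_snd.fst).pair pt_snd.snd).pb
    refine (((pb_const 2).mul this).add ((pb_const 1).add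
      (pb_snd (f := fun a : Str × (β × α) => a.2) (pb_snd pb_len)))).mono fun a => ?_
    obtain ⟨x, s, a⟩ := a
    simp only [key, enc_pair, List.length_append, length_dbl, List.length_cons]
    omega
  have := (hp.comp (hl.pair (hs.pair pt_id))).fst
  simpa only [key] using this

end

section

open Frag
open Enc (enc)

variable {α β γ : Type} [Enc α] [Enc β] [Enc γ]

/-! ### Polynomial-time functions on strings -/

theorem pt_cons (b : Bool) : PT fun x : Str => b :: x :=
  PT.of_does (push 0 b) (pb_const 1) fun _ => push_to (upd_zero _ _ _ _ _)

theorem pt_tail : PT fun x : Str => x.tail :=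
  PT.of_does (cas 0 fun _ => skip) (pb_const (1 + 1)) fun x =>
    does_cas x.head? x.tail rfl rfl ((does_skip _).congr (upd_zero _ _ _ _ _))

theorem pt_head : PT fun x : Str => x.headD false := by
  refine PT.of_does (cas 0 fun o => (clear 0).seq (push 0 (o.getD false)))
    (T := fun x => 1 + ((2 * (enc x).length + 1) + 1))
    ((pb_const 1).add ((((pb_const 2).mul pb_len).add (pb_const 1)).add (pb_const 1))) fun x => ?_
  refine does_cas x.head? x.tail rfl rfl ?_
  rw [upd_zero]
  refine (((clear_to (upd_zero _ _ _ _ _)).mono ?_).seq (push_to (upd_zero _ _ _ _ _))).congr ?_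
  · show 2 * x.tail.length + 1 ≤ _
    simp
  · cases x <;> rfl

theorem pt_isEmpty : PT fun x : Str => x.isEmpty := by
  refine PT.of_does (cas 0 fun o => (clear 0).seq (push 0 o.isNone))
    (T := fun x => 1 + ((2 * (enc x).length + 1) + 1))
    ((pb_const 1).add ((((pb_const 2).mul pb_len).add (pb_const 1)).add (pb_const 1))) fun x => ?_
  refine does_cas x.head? x.tail rfl rfl ?_
  rw [upd_zero]
  refine (((clear_to (upd_zero _ _ _ _ _)).mono ?_).seq (push_to (upd_zero _ _ _ _ _))).congr ?_
  · show 2 * x.tail.length + 1 ≤ _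
    simp
  · cases x <;> rfl

theorem PT.cons {f : α → Str} (b : Bool) (hf : PT f) : PT fun a => b :: f a := (pt_cons b).comp hf

theorem PT.tail {f : α → Str} (hf : PT f) : PT fun a => (f a).tail := pt_tail.comp hf

theorem PT.head {f : α → Str} (hf : PT f) : PT fun a => (f a).headD false := pt_head.comp hf

theorem PT.isEmpty {f : α → Str} (hf : PT f) : PT fun a => (f a).isEmpty := pt_isEmpty.comp hf

theorem PT.congr {f g : α → β} (hf : PT f) (h : ∀ a, f a = g a) : PT g := by
  rwa [← funext h]

theorem PT.not {f : α → Bool} (hf : PT f) : PT fun a => !f a :=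
  (hf.ite (pt_const false) (pt_const true)).congr fun a => by cases f a <;> rfl

theorem PT.and {f g : α → Bool} (hf : PT f) (hg : PT g) : PT fun a => f a && g a :=
  (hf.ite hg (pt_const false)).congr fun a => by cases f a <;> rfl

theorem PT.or {f g : α → Bool} (hf : PT f) (hg : PT g) : PT fun a => f a || g a :=
  (hf.ite (pt_const true) hg).congr fun a => by cases f a <;> rfl

theorem PT.append {f g : α → Str} (hf : PT f) (hg : PT g) : PT fun a => f a ++ g a := by
  have key : ∀ x y : Str, x.foldr (fun b s => b :: s) y = x ++ y := by simp
  have := PT.foldr (h := fun b s _ => b :: s) hf hg (pt_fst.cons false) (pt_fst.cons true)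
    (((pb_fst (pb_fst pb_len)).add (pb_snd (pb_fst pb_len))).mono fun a => by
      simp [key])
  exact this.congr fun a => key _ _

theorem pt_singleton : PT fun b : Bool => [b] :=
  PT.of_does skip (pb_const 1) fun _ => does_skip _

theorem PT.reverse {f : α → Str} (hf : PT f) : PT fun a => (f a).reverse := by
  have key : ∀ x y : Str, x.foldr (fun b s => s ++ [b]) y = y ++ x.reverse := fun x y => by
    induction x with
    | nil => simp
    | cons b x ih => simp [ih]
  have := PT.foldr (h := fun b s _ => s ++ [b]) hf (pt_const ([] : Str))
    (pt_fst.append (pt_const [false])) (pt_fst.append (pt_const [true]))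
    (((pb_fst (pb_fst pb_len)).add (pb_snd (pb_fst pb_len))).mono fun a => by
      simp [key]; omega)
  exact this.congr fun a => by simpa using key (f a) []

theorem PT.drop {f g : α → Str} (hf : PT f) (hg : PT g) : PT fun a => (g a).drop (f a).length := by
  have key : ∀ x y : Str, x.foldr (fun _ s => s.tail) y = y.drop x.length := fun x y => by
    induction x with
    | nil => rfl
    | cons b x ih => simp [ih, List.tail_drop]
  have := PT.foldr (h := fun _ s _ => s.tail) hf hg pt_fst.tail pt_fst.tail
    ((pb_snd (pb_fst pb_len)).mono fun a => by simp [key])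
  exact this.congr fun a => key _ _

/-- Taking a prefix means dropping from the reversed string as many bits as would remain after the
prefix. -/
theorem PT.take {f g : α → Str} (hf : PT f) (hg : PT g) : PT fun a => (g a).take (f a).length :=
  ((hf.drop hg).drop hg.reverse).reverse.congr fun a => by
    rw [List.drop_reverse, List.reverse_reverse, List.length_drop]
    rcases le_total (f a).length (g a).length with h | h
    · rw [Nat.sub_sub_self h]
    · rw [List.take_of_length_le h, List.take_of_length_le]; omega

theorem PT.replicate {f : α → Str} (b : Bool) (hf : PT f) :
    PT fun a => List.replicate (f a).length b := by
  have key : ∀ x y : Str, x.foldr (fun _ s => b :: s) y = List.replicate x.length b ++ y :=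
    fun x y => by
      induction x with
      | nil => rfl
      | cons c x ih => simp [ih, List.replicate_succ]
  have := PT.foldr (h := fun _ s _ => b :: s) hf (pt_const ([] : Str)) (pt_fst.cons b)
    (pt_fst.cons b) (((pb_fst (pb_fst pb_len)).add (pb_snd (pb_fst pb_len))).mono fun a => by
      simp [key])
  exact this.congr fun a => by simp [key]

/-- A clock for a polynomial. -/
theorem PT.clock {f : α → Str} (P : Polynomial ℕ) (hf : PT f) :
    PT fun a => List.replicate (P.eval (f a).length) false := by
  induction P using Polynomial.induction_on' with
  | add P Q hP hQ =>
    exact (hP.append hQ).congr fun a => by rw [Polynomial.eval_add, List.replicate_add]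
  | monomial n c =>
    induction n with
    | zero => exact (pt_const (List.replicate c false)).congr fun a => by simp
    | succ n ih =>
      have key : ∀ x y z : Str, x.foldr (fun _ s => y ++ s) z =
          (List.replicate x.length y).flatten ++ z := fun x y z => by
        induction x with
        | nil => rfl
        | cons c x ih => simp [ih, List.replicate_succ]
      -- One copy of the previous clock for each bit of `f a` multiplies its length by that of `f
      -- a`.
      have := PT.foldr (h := fun _ s (p : α × Str) => p.2 ++ s) (pt_fst.comp (f := fun a : α × Str =>
        (f a.1, a.2)) ((hf.comp pt_fst).pair pt_snd)) (pt_const ([] : Str))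
        (pt_snd.snd.append pt_fst) (pt_snd.snd.append pt_fst)
        ((((pb_fst (pb_fst pb_len)).mul (pb_snd (pb_snd pb_len))).add
          (pb_snd (pb_fst pb_len))).mono fun a => by simp [key])
      refine (this.comp (pt_id.pair ih)).congr fun a => ?_
      rw [key, List.append_nil]
      simp only [List.flatten_replicate_replicate, Polynomial.eval_monomial]
      congr 1; ring

/-- Simultaneous recursion along two strings of the same length. -/
def foldr₂ (h : Bool → Bool → Bool → Bool) (s : Bool) (x y : Str) : Bool :=
  (x.foldr (fun b (t : Bool × Str) => (h b (t.2.headD false) t.1, t.2.tail)) (s, y.reverse)).1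

/-- The fold reads `x` from the right, so `y` is kept reversed and consumed from its head. The
surplus `r` lets the induction on `x` go through. -/
theorem foldr₂_aux (h : Bool → Bool → Bool → Bool) (s : Bool) (x y r : Str)
    (hxy : x.length = y.length) :
    x.foldr (fun b (t : Bool × Str) => (h b (t.2.headD false) t.1, t.2.tail)) (s, y.reverse ++ r) =
      ((x.zip y).foldr (fun b s => h b.1 b.2 s) s, r) := by
  induction x generalizing y r with
  | nil => cases y <;> simp_all
  | cons b x ih =>
    cases y with
    | nil => simp at hxy
    | cons c y =>
      rw [List.reverse_cons, List.append_assoc, List.foldr_cons, List.singleton_append,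
        ih y (c :: r) (by simpa using hxy)]
      rfl

@[simp] theorem foldr₂_nil (h : Bool → Bool → Bool → Bool) (s : Bool) : foldr₂ h s [] [] = s := rfl

theorem foldr₂_cons (h : Bool → Bool → Bool → Bool) (s b c : Bool) {x y : Str}
    (hxy : x.length = y.length) :
    foldr₂ h s (b :: x) (c :: y) = h b c (foldr₂ h s x y) := by
  have h1 := foldr₂_aux h s (b :: x) (c :: y) [] (by simpa using hxy)
  have h2 := foldr₂_aux h s x y [] hxy
  rw [List.append_nil] at h1 h2
  rw [foldr₂, foldr₂, h1, h2]
  rfl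

theorem PT.of_bool {f : Bool → α → β} (h0 : PT (f false)) (h1 : PT (f true)) :
    PT fun a : Bool × α => f a.1 a.2 :=
  (pt_fst.ite (h1.comp pt_snd) (h0.comp pt_snd)).congr fun a => by
    obtain ⟨b, a⟩ := a
    cases b <;> rfl

theorem pt_bool₂ (h : Bool → Bool → Bool) : PT fun a : Bool × Bool => h a.1 a.2 := by
  have key : ∀ u : Bool → Bool, PT u := fun u =>
    (pt_id.ite (pt_const (u true)) (pt_const (u false))).congr fun b => by cases b <;> rfl
  exact PT.of_bool (f := h) (key _) (key _)

theorem PT.foldr₂ {f g : α → Str} (h : Bool → Bool → Bool → Bool) (s : Bool) (hf : PT f)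
    (hg : PT g) : PT fun a => foldr₂ h s (f a) (g a) := by
  have step : ∀ b, PT fun a : (Bool × Str) × α => (h b (a.1.2.headD false) a.1.1, a.1.2.tail) :=
    fun b => ((pt_bool₂ (h b)).comp (pt_fst.snd.head.pair pt_fst.fst)).pair pt_fst.snd.tail
  refine (PT.foldr (β := Bool × Str)
    (h := fun b t _ => (h b (t.2.headD false) t.1, t.2.tail)) hf
    ((pt_const s).pair hg.reverse) (step false) (step true) ?_).fst
  have key : ∀ (x y : Str) (s : Bool), (enc (x.foldr
      (fun b (t : Bool × Str) => (h b (t.2.headD false) t.1, t.2.tail)) (s, y))).length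
      ≤ (enc (s, y)).length := by
    intro x y s
    induction x with
    | nil => rfl
    | cons b x ih =>
      refine le_trans ?_ ih
      rw [List.foldr_cons]
      generalize x.foldr _ _ = t
      obtain ⟨u, v⟩ := t
      simp
  exact (pb_snd (pb_fst pb_len)).mono fun a => key _ _ _

/-- Simultaneous recursion pairs the bits correctly only if the lengths agree; this is tested by
dropping each length from the other string. -/
theorem PT.decide_eq {f g : α → Str} (hf : PT f) (hg : PT g) : PT fun a => decide (f a = g a) := by
  refine (((hf.drop hg).isEmpty.and (hg.drop hf).isEmpty).and
    (PT.foldr₂ (fun b c s => (b == c) && s) true hf hg)).congr fun a => ?_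
  generalize f a = x
  generalize g a = y
  rw [Bool.eq_iff_iff]
  by_cases hl : x.length = y.length
  · have : ((y.drop x.length).isEmpty && (x.drop y.length).isEmpty) = true := by simp [hl]
    rw [this, Bool.true_and, decide_eq_true_iff]
    induction x generalizing y with
    | nil => cases y <;> simp_all
    | cons b x ih =>
      cases y with
      | nil => simp at hl
      | cons c y =>
        have hl' : x.length = y.length := by simpa using hl
        rw [foldr₂_cons _ _ _ _ hl']
        simp [ih y hl' (by simp [hl'])]
  · simp only [Bool.and_eq_true, List.isEmpty_iff, List.drop_eq_nil_iff, decide_eq_true_iff]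
    constructor
    · rintro ⟨⟨h1, h2⟩, -⟩
      omega
    · rintro rfl
      exact absurd rfl hl

/-! ### Strings as binary numbers -/

/-- The value of a string that is read as a binary number, the most significant bit first. -/
def val : Str → ℕ
  | [] => 0
  | b :: w => (if b then 2 ^ w.length else 0) + val w

theorem val_lt (w : Str) : val w < 2 ^ w.length := by
  induction w with
  | nil => simp [val]
  | cons b w ih =>
    rw [val, List.length_cons, pow_succ]
    split_ifs <;> omega

theorem val_inj {x y : Str} (hl : x.length = y.length) (h : val x = val y) : x = y := by
  induction x generalizing y with
  | nil => cases y <;> simp_all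
  | cons b x ih =>
    cases y with
    | nil => simp at hl
    | cons c y =>
      have hl' : x.length = y.length := by simpa using hl
      have h1 := val_lt x
      have h2 := val_lt y
      rw [val, val] at h
      rw [hl'] at h h1
      cases b <;> cases c <;> simp at h
      · rw [ih hl' h]
      · omega
      · omega
      · rw [ih hl' h]

/-- The string of length `n` with value `k`. -/
def bin : ℕ → ℕ → Str
  | 0, _ => []
  | n + 1, k => if 2 ^ n ≤ k then true :: bin n (k - 2 ^ n) else false :: bin n k

@[simp] theorem length_bin (n k : ℕ) : (bin n k).length = n := by
  induction n generalizing k with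
  | zero => rfl
  | succ n ih => rw [bin]; split_ifs <;> simp [ih]

theorem val_bin {n k : ℕ} (h : k < 2 ^ n) : val (bin n k) = k := by
  induction n generalizing k with
  | zero => simp at h; simp [bin, val, h]
  | succ n ih =>
    rw [pow_succ] at h
    rw [bin]
    split_ifs with hk
    · rw [val, ih (by omega)]; simp; omega
    · rw [val, ih (by omega)]; simp

theorem bin_val (w : Str) : bin w.length (val w) = w :=
  val_inj (by simp) (val_bin (val_lt w))

theorem val_append (x y : Str) : val (x ++ y) = val x * 2 ^ y.length + val y := by
  induction x with
  | nil => simp [val]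
  | cons b x ih =>
    rw [List.cons_append, val, val, ih, List.length_append, pow_add]
    split_ifs <;> ring

theorem val_zeros (n : ℕ) : val (List.replicate n false) = 0 := by
  induction n with
  | zero => rfl
  | succ n ih => simp [List.replicate_succ, val, ih]

theorem val_ones (n : ℕ) : val (List.replicate n true) = 2 ^ n - 1 := by
  induction n with
  | zero => rfl
  | succ n ih =>
    have := Nat.one_le_two_pow (n := n)
    simp [List.replicate_succ, val, ih, pow_succ]; omega

theorem lexLt_iff {x y : Str} (hl : x.length = y.length) : LexLt x y ↔ val x < val y := by
  induction x generalizing y with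
  | nil => cases y <;> simp_all [LexLt, val]
  | cons b x ih =>
    cases y with
    | nil => simp at hl
    | cons c y =>
      have hl' : x.length = y.length := by simpa using hl
      have h1 := val_lt x
      have h2 := val_lt y
      have ih := ih hl'
      rw [LexLt, List.shortlex_def] at ih ⊢
      simp only [hl', List.length_cons, lt_irrefl, true_and, false_or] at ih ⊢
      rw [val, val]
      rw [hl'] at h1 ⊢
      cases b <;> cases c <;> simp [List.cons_lex_cons_iff, ih, show ¬ (true < false) by decide] <;> omega

theorem lexLe_iff {x y : Str} (hl : x.length = y.length) : LexLe x y ↔ val x ≤ val y := by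
  rw [LexLe, lexLt_iff hl, le_iff_eq_or_lt]
  exact or_congr_left ⟨fun h => h ▸ rfl, val_inj hl⟩

/-- On strings of one length, shortlex is the numerical order of values. A string strictly between
two of them has the same length, so strings of other lengths cannot spoil the successor relation. -/
theorem lexSucc_iff {x y : Str} (hl : x.length = y.length) : LexSucc x y ↔ val y = val x + 1 := by
  rw [LexSucc, lexLt_iff hl]
  constructor
  · rintro ⟨h, h'⟩
    by_contra hne
    have h1 := val_lt y
    refine h' (bin x.length (val x + 1)) ?_
    rw [lexLt_iff (by simp), lexLt_iff (by simp [hl]), val_bin (by rw [hl]; omega)]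
    omega
  · intro h
    refine ⟨by omega, fun c hc => ?_⟩
    have hl1 : x.length = c.length := by
      have h1 := hc.1
      have h2 := hc.2
      rw [LexLt, List.shortlex_def] at h1 h2
      omega
    rw [lexLt_iff hl1, lexLt_iff (hl1.symm.trans hl)] at hc
    omega

/-- Comparison of the values of strings of the same length. -/
def ltb (x y : Str) : Bool := foldr₂ (fun b c s => (!b && c) || ((b == c) && s)) false x y

theorem ltb_iff {x y : Str} (hl : x.length = y.length) : ltb x y = true ↔ val x < val y := by
  induction x generalizing y with
  | nil => cases y <;> simp_all [ltb, val]
  | cons b x ih =>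
    cases y with
    | nil => simp at hl
    | cons c y =>
      have hl' : x.length = y.length := by simpa using hl
      have h1 := val_lt x
      have h2 := val_lt y
      have ih := ih hl'
      rw [ltb] at ih ⊢
      rw [foldr₂_cons _ _ _ _ hl', val, val]
      rw [hl'] at h1 ⊢
      cases b <;> cases c <;> simp [ih] <;> omega

theorem PT.ltb {f g : α → Str} (hf : PT f) (hg : PT g) : PT fun a => ltb (f a) (g a) :=
  hf.foldr₂ _ _ hg

/-- Increment of a binary number, together with the carry. -/
def incr (x : Str) : Bool × Str :=
  x.foldr (fun b t => (b && t.1, (xor b t.1) :: t.2)) (true, [])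

theorem length_incr (x : Str) : (incr x).2.length = x.length := by
  induction x with
  | nil => rfl
  | cons b x ih => simpa [incr] using ih

/-- The carry stands for `2 ^ x.length`; a string of ones overflows to zeros, which is why `succb`
excludes a carry. -/
theorem val_incr (x : Str) :
    (if (incr x).1 then 2 ^ x.length else 0) + val (incr x).2 = val x + 1 := by
  induction x with
  | nil => rfl
  | cons b x ih =>
    have h1 : incr (b :: x) = (b && (incr x).1, (xor b (incr x).1) :: (incr x).2) := rfl
    rw [h1, val, val, List.length_cons, pow_succ, length_incr]
    cases b <;> cases hc : (incr x).1 <;> simp [hc] at ih ⊢ <;> omega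

/-- The test whether the value of the second string is the successor of that of the first one. -/
def succb (x y : Str) : Bool := !(incr x).1 && decide ((incr x).2 = y)

theorem succb_iff {x y : Str} (hl : x.length = y.length) :
    succb x y = true ↔ val y = val x + 1 := by
  have h1 := val_incr x
  have h2 := val_lt y
  have h3 := length_incr x
  rw [succb]
  cases hc : (incr x).1
  · simp only [hc, Bool.false_eq_true, if_false, zero_add] at h1
    simp only [Bool.not_false, Bool.true_and, decide_eq_true_iff]
    rw [← h1]
    exact ⟨fun h => by rw [h], fun h => val_inj (by omega) h.symm⟩
  · rw [hc, if_pos rfl, hl] at h1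
    simp only [Bool.not_true, Bool.false_and, Bool.false_eq_true, false_iff]
    omega

theorem PT.succb {f g : α → Str} (hf : PT f) (hg : PT g) : PT fun a => succb (f a) (g a) := by
  have step : ∀ b, PT fun a : (Bool × Str) × α => (b && a.1.1, (xor b a.1.1) :: a.1.2) := fun b =>
    (((pt_bool₂ fun _ c => b && c).comp (pt_fst.fst.pair pt_fst.fst)).pair
      ((pt_singleton.comp ((pt_bool₂ fun _ c => xor b c).comp
        (pt_fst.fst.pair pt_fst.fst))).append pt_fst.snd)).congr fun a => by simp
  have hi : PT fun a => incr (f a) := by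
    refine PT.foldr (β := Bool × Str) (h := fun b t _ => (b && t.1, (xor b t.1) :: t.2)) hf
      (pt_const (true, [])) (step false) (step true) ?_
    have key : ∀ (x : Str) (s : Bool × Str), (enc (x.foldr
        (fun b (t : Bool × Str) => (b && t.1, (xor b t.1) :: t.2)) s)).length
        ≤ x.length + (enc s).length := by
      intro x s
      induction x with
      | nil => simp
      | cons b x ih =>
        rw [List.foldr_cons]
        revert ih
        generalize x.foldr _ _ = t
        obtain ⟨u, v⟩ := t
        obtain ⟨u', v'⟩ := s
        simp
        omega
    exact ((pb_fst (pb_fst pb_len)).add (pb_snd (pb_fst pb_len))).mono fun a => key _ _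
  exact (hi.fst.not.and (hi.snd.decide_eq hg))

/-- Remove the leading zeros and the first one. -/
def strip : Str → Str
  | [] => []
  | true :: w => w
  | false :: w => strip w

theorem PT.strip {f : α → Str} (hf : PT f) : PT fun a => strip (f a) := by
  have key : ∀ (x : Str), x.foldr
      (fun b (t : Str × Str) => (if b then t.2 else t.1, b :: t.2)) ([], []) = (ClusterComputing.strip x, x) := by
    intro x
    induction x with
    | nil => rfl
    | cons b x ih => cases b <;> simp [ih, ClusterComputing.strip]
  have step : ∀ b, PT fun a : (Str × Str) × α => (if b then a.1.2 else a.1.1, b :: a.1.2) := by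
    rintro (_ | _)
    · exact pt_fst.fst.pair (pt_fst.snd.cons false)
    · exact pt_fst.snd.pair (pt_fst.snd.cons true)
  have h := PT.foldr (β := Str × Str) (h := fun b t _ => (if b then t.2 else t.1, b :: t.2)) hf
      (pt_const ([], [])) (step false) (step true) ?_
  · exact h.fst.congr fun a => by rw [key]
  · have key : ∀ (x : Str) (s : Str × Str),
        (x.foldr (fun b (t : Str × Str) => (if b then t.2 else t.1, b :: t.2)) s).1.length
          ≤ s.1.length + s.2.length + x.length ∧
        (x.foldr (fun b (t : Str × Str) => (if b then t.2 else t.1, b :: t.2)) s).2.length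
          = s.2.length + x.length := by
      intro x s
      induction x with
      | nil => simp
      | cons b x ih =>
        obtain ⟨h1, h2⟩ := ih
        cases b <;> simp only [List.foldr_cons, List.length_cons, h2, if_true, Bool.false_eq_true,
          if_false] <;> omega
    refine ((pb_const 3).mul ((pb_const 1).add ((pb_fst (pb_fst pb_len)).add
      (pb_snd (pb_fst pb_len))))).mono fun a => ?_
    obtain ⟨⟨x, y, z⟩, a⟩ := a
    have := key x (y, z)
    revert this
    simp only
    generalize x.foldr _ _ = t
    obtain ⟨u, v⟩ := t
    intro this
    simp only [enc_pair, enc_str, List.length_append, length_dbl, List.length_cons] at this ⊢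
    omega

end

section

open Frag
open Enc (enc)

/-! ### Predicates with three arguments -/

theorem update_update_one_zero {A : Type} [Fintype A] [DecidableEq A]
    (a b c d x y : List A) :
    Function.update (Function.update ![a, b, c, d] 1 x) 0 y = ![y, x, c, d] := by
  rw [upd_one, upd_zero]

theorem update_update_three_zero {A : Type} [Fintype A] [DecidableEq A]
    (a b c d x y : List A) :
    Function.update (Function.update ![a, b, c, d] 3 x) 0 y = ![y, b, c, x] := by
  rw [upd_three, upd_zero]

theorem update_update_zero_one {A : Type} [Fintype A] [DecidableEq A]
    (a b c d x y : List A) :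
    Function.update (Function.update ![a, b, c, d] 0 x) 1 y = ![x, y, c, d] := by
  rw [upd_zero, upd_one]

/-- Write the encoding of a triple of strings with separators. -/
def toTriple : Frag (Option Bool) (Fin 4) :=
  (parse some).seq ((push 1 none).seq ((move 3 0).seq ((parse some).seq ((push 1 none).seq
    ((move 3 0).seq (move 1 0))))))

/-- Register 1 accumulates the reversed text of `x # y #`. Moving it in front of `z` at the end
reverses it once more. -/
theorem does_toTriple (x y z : Str) :
    toTriple.Does ![(enc (x, y, z)).map some, [], [], []] ![encodeTriple (x, y, z), [], [], []]
      (20 * (enc (x, y, z)).length + 20) := by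
  have p1 := does_parse (em := (some : Bool → Option Bool)) (by decide) x (enc (y, z)) [] [] []
  have p2 := does_parse (em := (some : Bool → Option Bool)) (by decide) y z
    (none :: (x.map some).reverse) [] []
  have m1 : (move (A := Option Bool) 3 0).Does
      ![[], none :: (x.map some).reverse, [], ((enc (y, z)).map some).reverse]
      ![(enc (y, z)).map some, none :: (x.map some).reverse, [], []] _ :=
    move_to (by decide) ((update_update_three_zero _ _ _ _ _ _).trans (by simp))
  have m2 : (move (A := Option Bool) 3 0).Does
      ![[], none :: ((y.map some).reverse ++ none :: (x.map some).reverse), [], (z.map some).reverse]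
      ![z.map some, none :: ((y.map some).reverse ++ none :: (x.map some).reverse), [], []] _ :=
    move_to (by decide) ((update_update_three_zero _ _ _ _ _ _).trans (by simp))
  have m3 : (move (A := Option Bool) 1 0).Does
      ![z.map some, none :: ((y.map some).reverse ++ none :: (x.map some).reverse), [], []]
      ![encodeTriple (x, y, z), [], [], []] _ :=
    move_to (by decide) ((update_update_one_zero _ _ _ _ _ _).trans (by simp [encodeTriple]))
  simp only [List.append_nil] at p1 p2
  refine (p1.seq ((push_to (upd_one _ _ _ _ _)).seq (m1.seq (p2.seq
    ((push_to (upd_one _ _ _ _ _)).seq (m2.seq m3)))))).mono ?_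
  simp
  omega

/-- Encode a triple of strings that is given with separators. -/
def ofTriple : Frag (Option Bool) (Fin 4) :=
  (move 0 1).seq (loop 1 fun o => match o with
    | some b => push 0 (some b)
    | none => (push 0 (some false)).seq (loop 1 fun o => match o with
      | some b => (push 0 (some b)).seq (push 0 (some true))
      | none => push 0 (some false)))

theorem does_ofTriple_inner (x y r : Str) (o : List (Option Bool)) (n : ℕ)
    (h : LoopDoes (ι := Fin 4) 1 (fun o => match o with
      | some b => (push 0 (some b)).seq (push 0 (some true))
      | none => push 0 (some false)) ![(dbl x ++ r).map some, o, [], []]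
        ![y.map some, [], [], []] n) :
    LoopDoes (ι := Fin 4) 1 (fun o => match o with
      | some b => (push 0 (some b)).seq (push 0 (some true))
      | none => push 0 (some false)) ![r.map some, (x.map some).reverse ++ o, [], []]
        ![y.map some, [], [], []] (3 * x.length + n) := by
  induction x using List.reverseRecOn generalizing r with
  | nil => simpa using h
  | append_singleton x b ih =>
    refine (loopDoes_cons (x := some b) (l := (x.map some).reverse ++ o) (by simp) (T := 1 + 1)
      (S₁ := ![(true :: b :: r).map some, (x.map some).reverse ++ o, [], []]) ?_
      (T' := 3 * x.length + n) (ih _ ?_)).mono ?_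
    · rw [upd_one]
      exact (push_to (upd_zero _ _ _ _ _)).seq (push_to (upd_zero _ _ _ _ _))
    · simpa using h
    · simp; omega

theorem does_ofTriple (x y z : Str) :
    ofTriple.Does ![encodeTriple (x, y, z), [], [], []] ![(enc (x, y, z)).map some, [], [], []]
      (10 * (encodeTriple (x, y, z)).length + 10) := by
  have outer : ∀ (z r : Str) (o : List (Option Bool)) (y : Str) (n : ℕ),
      LoopDoes (ι := Fin 4) 1 (fun o => match o with
        | some b => push 0 (some b)
        | none => (push 0 (some false)).seq (loop 1 fun o => match o with
          | some b => (push 0 (some b)).seq (push 0 (some true))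
          | none => push 0 (some false))) ![(z ++ r).map some, o, [], []]
          ![y.map some, [], [], []] n →
      LoopDoes (ι := Fin 4) 1 (fun o => match o with
        | some b => push 0 (some b)
        | none => (push 0 (some false)).seq (loop 1 fun o => match o with
          | some b => (push 0 (some b)).seq (push 0 (some true))
          | none => push 0 (some false))) ![r.map some, (z.map some).reverse ++ o, [], []]
          ![y.map some, [], [], []] (2 * z.length + n) := by
    intro z r o y n h
    induction z using List.reverseRecOn generalizing r with
    | nil => simpa using h
    | append_singleton z b ih =>
      refine (loopDoes_cons (x := some b) (l := (z.map some).reverse ++ o) (by simp) (T := 1)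
        (S₁ := ![(b :: r).map some, (z.map some).reverse ++ o, [], []]) ?_
        (T' := 2 * z.length + n) (ih _ ?_)).mono ?_
      · rw [upd_one]
        exact push_to (upd_zero _ _ _ _ _)
      · simpa using h
      · simp; omega
  have hm : (move (A := Option Bool) 0 1).Does ![encodeTriple (x, y, z), [], [], []]
      ![[], (z.map some).reverse ++ none :: ((y.map some).reverse ++ none :: (x.map some).reverse),
        [], []] _ :=
    move_to (by decide) ((update_update_zero_one _ _ _ _ _ _).trans (by simp [encodeTriple]))
  have hx := does_ofTriple_inner x (enc (x, y, z)) (false :: (dbl y ++ false :: z)) [] 1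
    (loopDoes_nil rfl)
  rw [List.append_nil] at hx
  have hy := does_ofTriple_inner y (enc (x, y, z)) (false :: z) (none :: (x.map some).reverse) _
    (loopDoes_cons (x := none) (l := (x.map some).reverse) rfl (T := 1)
      (S₁ := ![(false :: (dbl y ++ false :: z)).map some, (x.map some).reverse, [], []])
      (by rw [upd_one]; exact push_to (upd_zero _ _ _ _ _)) hx)
  have hz := outer z [] (none :: ((y.map some).reverse ++ none :: (x.map some).reverse))
    (enc (x, y, z)) _ (loopDoes_cons (x := none)
      (l := (y.map some).reverse ++ none :: (x.map some).reverse) rfl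
      (S₁ := ![(enc (x, y, z)).map some, [], [], []])
      (by
        rw [upd_one]
        refine (push_to (S' := ![(false :: z).map some,
          (y.map some).reverse ++ none :: (x.map some).reverse, [], []]) ?_).seq hy.does
        rw [upd_zero]; simp) (loopDoes_nil rfl))
  refine (hm.seq hz.does).mono ?_
  simp [encodeTriple]
  omega

theorem length_encodeTriple (a : Str × Str × Str) : (encodeTriple a).length ≤ (enc a).length := by
  obtain ⟨x, y, z⟩ := a
  simp [encodeTriple]; omega

theorem length_enc_triple (a : Str × Str × Str) :
    (enc a).length ≤ 2 * (encodeTriple a).length := by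
  obtain ⟨x, y, z⟩ := a
  simp [encodeTriple]; omega

/-- The tape format with separators and the pair encoding are converted into each other in linear
time, so either may serve as input for the same machine. -/
theorem polyTimePred₃_iff {r : Str → Str → Str → Bool} :
    PolyTimePred₃ r ↔ PT fun a : Str × Str × Str => r a.1 a.2.1 a.2.2 := by
  constructor
  · rintro ⟨h⟩
    obtain ⟨P, hP⟩ := exists_call h (id : Option Bool → Option Bool) some none
    obtain ⟨F, hF⟩ := hP (0 : Fin 4) 1 2 (by decide) (by decide) (by decide)
    refine computable_of_frag (toTriple.seq F) some (·.getD false) none (i := 0) (t := 1)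
      (by decide) (20 * .X + 20 + P) (fun a => [some (r a.1 a.2.1 a.2.2)]) (fun a => rfl)
      fun a => ?_
    rw [only_zero, only_zero]
    refine ((does_toTriple a.1 a.2.1 a.2.2).seq ((hF ![encodeTriple a, [], [], []] a rfl rfl
      (List.map_id _)).congr (upd_zero _ _ _ _ _))).mono ?_
    simp only [Polynomial.eval_add, Polynomial.eval_mul, Polynomial.eval_X, Polynomial.eval_ofNat]
    exact Nat.add_le_add_left (eval_mono P (length_encodeTriple a)) _
  · rintro ⟨h⟩
    obtain ⟨P, hP⟩ := exists_call h (fun o : Option Bool => o.getD false) some none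
    obtain ⟨F, hF⟩ := hP (0 : Fin 4) 1 2 (by decide) (by decide) (by decide)
    refine computable_of_frag (ofTriple.seq F) id (·.getD false) none (i := 0) (t := 1)
      (by decide) (10 * .X + 10 + P.comp (2 * .X)) (fun a => [some (r a.1 a.2.1 a.2.2)])
      (fun a => rfl) fun a => ?_
    rw [only_zero, only_zero, List.map_id]
    refine ((does_ofTriple a.1 a.2.1 a.2.2).seq ((hF ![(enc a).map some, [], [], []] a rfl rfl
      ?_).congr (upd_zero _ _ _ _ _))).mono ?_
    · show ((enc a).map some).map _ = _
      rw [List.map_map]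
      exact List.map_id _
    · simp only [Polynomial.eval_add, Polynomial.eval_mul, Polynomial.eval_X, Polynomial.eval_ofNat,
        Polynomial.eval_comp]
      exact Nat.add_le_add_left (eval_mono P (length_enc_triple a)) _

/-! ### The paths of a nondeterministic machine as certificates -/

/-- A machine with binary alphabets. -/
def NTM.toMach (M : NTM) : Mach Bool Bool where
  toTM2ComputableAux := M.toTM2ComputableAux
  guessing := M.guessing
  alt := M.alt
  accept := M.accept

theorem NTM.Outputs.unique {M : NTM} {x w s s' : Str} (h : M.Outputs x w s)
    (h' : M.Outputs x w s') : s = s' := by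
  obtain ⟨c, ⟨⟨n, r⟩, hc⟩, -, rfl⟩ := h
  obtain ⟨c', ⟨⟨n', r'⟩, hc'⟩, -, rfl⟩ := h'
  rw [NTM.run_iff_nrun] at r r'
  rw [(r.eq_of_halt r' hc hc' (.inl (List.prefix_refl _))).2.2]

theorem NTM.mem_acc_iff {M : NTM} {x w : Str} : w ∈ M.acc x ↔ ∃ s, M.Outputs x w s :=
  ⟨fun ⟨c, h1, h2⟩ => ⟨_, c, h1, h2, rfl⟩, fun ⟨_, c, h1, h2, _⟩ => ⟨c, h1, h2⟩⟩

theorem NTM.IsPolyTime.length_le {M : NTM} (h : M.IsPolyTime) :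
    ∃ t : Polynomial ℕ, ∀ x, ∀ w ∈ M.paths x, w.length ≤ t.eval x.length := by
  obtain ⟨t, ht⟩ := h
  refine ⟨t, fun x w ⟨c, ⟨n, r⟩, _⟩ => ?_⟩
  exact (NRun.length_guesses_le (NTM.run_iff_nrun.mp r)).trans (ht x n w c r)

/-- A polynomial-time function that follows a given path of a machine. -/
theorem exists_pt_outputs {M : NTM} (hM : M.IsPolyTime) :
    ∃ V : Str × Str → Str, PT V ∧ (∀ x w s, M.Outputs x w s → V (x, w) = true :: s) ∧
      ∀ x w, w ∉ M.acc x → V (x, w) = [false] := by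
  classical
  obtain ⟨t, ht⟩ := hM
  -- The function is specified by a choice of output; since a path has only one output, the
  -- simulation computes just this function.
  set V : Str × Str → Str := fun a =>
    if h : ∃ s, M.Outputs a.1 a.2 s then true :: h.choose else [false] with hV
  have V_out : ∀ x w s, M.Outputs x w s → V (x, w) = true :: s := by
    intro x w s h
    have h' : ∃ s, M.Outputs x w s := ⟨s, h⟩
    simp only [hV, dif_pos h']
    rw [h'.choose_spec.unique h]
  have V_not : ∀ x w, w ∉ M.acc x → V (x, w) = [false] := by
    intro x w h
    rw [NTM.mem_acc_iff] at h
    simp only [hV, dif_neg h]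
  refine ⟨V, ?_, V_out, V_not⟩
  refine PT.of_does ((parse id).seq ((move 1 0).seq ((move 3 2).seq
    (M.toMach.sim id id id id 0 1 2)))) (T := fun a : Str × Str =>
    3 * (enc a.1).length + 2 * (enc a.2).length + 3 + (2 * (enc a.1).length + 1 +
      (2 * (enc a.2).length + 1 + 10 * ((enc a.1).length + t.eval (enc a.1).length +
        t.eval (enc a.1).length * M.toMach.rate + (enc a.2).length + 1)))) ?_ fun a => ?_
  · have h1 : PB fun a : Str × Str => (enc a.1).length := pb_fst pb_len
    have h2 : PB fun a : Str × Str => (enc a.2).length := pb_snd pb_len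
    have h3 : PB fun a : Str × Str => t.eval (enc a.1).length :=
      PB.comp (T := fun x : Str => t.eval (enc x).length) ⟨t, fun _ => le_rfl⟩ h1
    exact ((((pb_const 3).mul h1).add ((pb_const 2).mul h2)).add (pb_const 3)).add
      ((((pb_const 2).mul h1).add (pb_const 1)).add ((((pb_const 2).mul h2).add (pb_const 1)).add
        ((pb_const 10).mul ((((h1.add h3).add (h3.mul (pb_const _))).add h2).add (pb_const 1)))))
  obtain ⟨x, w⟩ := a
  have p := does_parse_id x w [] [] []
  rw [List.append_nil, List.append_nil] at p
  have m1 : (move (A := Bool) 1 0).Does ![[], x.reverse, [], w.reverse] ![x, [], [], w.reverse]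
      (2 * x.length + 1) :=
    (move_to (by decide) ((update_update_one_zero _ _ _ _ _ _).trans (by simp))).mono
      (by simp)
  have m2 : (move (A := Bool) 3 2).Does ![x, [], [], w.reverse] ![x, [], w, []]
      (2 * w.length + 1) :=
    (move_to (by decide) (by rw [upd_three, upd_two]; simp)).mono (by simp)
  refine p.seq (m1.seq (m2.seq ?_))
  have hx : (![x, [], w, []] (0 : Fin 4)).map id = x := List.map_id x
  have hw : (![x, [], w, []] (2 : Fin 4)).map id = w := List.map_id w
  by_cases h : w ∈ M.acc x
  · obtain ⟨s, hs⟩ := NTM.mem_acc_iff.mp h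
    obtain ⟨c, ⟨⟨n, r⟩, hc⟩, ha, hcs⟩ := id hs
    rw [V_out x w s hs]
    have hn := ht _ _ _ _ r
    rw [NTM.run_iff_nrun] at r
    obtain ⟨N, hN, hE⟩ := Mach.exec_sim_accept (M := M.toMach) (enc := id) (out := id) (em := id)
      (bit := id) (i := 0) (t := 1) (g := 2) (by decide) (by decide) (by decide) ![x, [], w, []]
      rfl (n := n) (c := c) (by rw [hx, hw]; exact r) hc ha
    refine ⟨N, hN.trans ?_, ?_⟩
    · have := Nat.mul_le_mul_right M.toMach.rate hn
      show 10 * (x.length + n + n * M.toMach.rate + w.length + 1) ≤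
        10 * (x.length + t.eval x.length + t.eval x.length * M.toMach.rate + w.length + 1)
      omega
    · have : Function.update (Function.update ![x, [], w, []] 2 []) 0 (true :: s) =
          ![true :: s, [], [], []] := by rw [upd_two, upd_zero]
      refine Eq.mp ?_ hE
      refine congrArg (fun R => Frag.Exec _ _ _ R _) (Eq.trans ?_ this)
      exact congrArg (fun l => Function.update (Function.update ![x, [], w, []] 2 []) 0 (true :: l))
        hcs
  · rw [V_not x w h]
    -- `M` obeys its time bound whatever is guessed, so the simulation ends without a clock.
    obtain ⟨N, hN, hE⟩ := Mach.exec_sim_reject (M := M.toMach) (enc := id) (out := id) (em := id)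
      (bit := id) (i := 0) (t := 1) (g := 2) (by decide) (by decide) (by decide) ![x, [], w, []]
      rfl (n := t.eval x.length)
      (fun k w' c r => ht x k w' c (NTM.run_iff_nrun.mpr (by rw [hx] at r; exact r)))
      (fun k c r hc => by
        rw [hx, hw] at r
        by_contra ha
        exact h ⟨c, ⟨⟨k, NTM.run_iff_nrun.mpr r⟩, hc⟩, Bool.eq_true_of_not_eq_false ha⟩)
    refine ⟨N, hN, ?_⟩
    have : Function.update (Function.update ![x, [], w, []] 2 []) 0 [false] =
        ![[false], [], [], []] := by rw [upd_two, upd_zero]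
    rw [enc_str, ← this]
    exact hE

end

section

open Frag
open Enc (enc)

/-! ### Nondeterministic machines that run fragments -/

namespace Frag

variable {ι : Type} [DecidableEq ι] [Fintype ι]

/-- The statements of the nondeterministic machine that runs a fragment with its input and
its verdict in the register `i`; the register `t` is used for loading the input. -/
def ntmStmt (F : Frag Bool ι) (i t : ι) (m : F.Λ → TM2.Stmt (Sum.elim (fun _ : ι => Bool) F.Γ) F.Λ F.σ) :
    Fin 4 ⊕ F.Λ → TM2.Stmt (F.MStk Bool Bool) (Fin 4 ⊕ F.Λ) (F.σ × Option Bool)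
  | .inl 0 => .pop (.inr false) (fun s o => (s.1, o)) (.branch (fun s => s.2.isSome)
      (.push (.inl (.inl t)) (fun s => s.2.getD false) (.goto fun _ => .inl 0))
      (.goto fun _ => .inl 1))
  | .inl _ => .pop (.inl (.inl t)) (fun s o => (s.1, o)) (.branch (fun s => s.2.isSome)
      (.push (.inl (.inl i)) (fun s => s.2.getD false) (.goto fun _ => .inl 1))
      (.goto fun _ => .inr F.main))
  | .inr l => (F.machTr Bool Bool).stmt (.pop (.inl (.inl i)) (fun s o => (s.1, o)) .halt) (m l)

/-- The nondeterministic machine that runs a fragment. -/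
def toNTM (F : Frag Bool ι) (i t : ι) : NTM where
  tm :=
    { K := (ι ⊕ F.H) ⊕ Bool
      k₀ := .inr false
      k₁ := .inr true
      Γ := F.MStk Bool Bool
      Λ := Fin 4 ⊕ F.Λ
      main := .inl 0
      σ := F.σ × Option Bool
      initialState := (F.s0, none)
      Γk₀Fin := inferInstanceAs (Fintype Bool)
      m := F.ntmStmt i t F.m }
  inputAlphabet := Equiv.refl Bool
  outputAlphabet := Equiv.refl Bool
  guessing := Sum.elim (fun _ => false) F.guessing
  alt := F.ntmStmt i t F.alt
  accept s := s.2 == some true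

variable {F : Frag Bool ι} {i t : ι}

/-- The last step of the fragment also pops the verdict into the internal state, where `accept`
reads it. -/
theorem toNTM_run (hit : i ≠ t) (x y w : Str) {n : ℕ} (h : F.Exec (only i x) w (only i y) n) :
    ∃ c, (F.toNTM i t).Run (2 * x.length + 2 + n) w ((F.toNTM i t).init x) c ∧ c.l = none ∧
      ((F.toNTM i t).accept c.var = true ↔ y.head? = some true) := by
  have h1 : NRun (Sum.elim (fun _ => false) F.guessing) (F.ntmStmt i t F.m) (F.ntmStmt i t F.alt)
      (x.length + 1) [] ⟨some (.inl 0), (F.s0, none), F.mstk (F.store fun _ => []) x []⟩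
      ⟨some (.inl 1), (F.s0, none), F.mstk (F.store (only t x.reverse)) [] []⟩ := by
    refine NRun.move (g := Sum.elim (fun _ => false) F.guessing) (m := F.ntmStmt i t F.m)
      (L := .inl 0) (k := .inr false) (k' := .inl (.inl t)) (f := fun s o => (s.1, o))
      (p := fun s => s.2.isSome) (h := fun s => s.2.getD false) (conv := fun x => x) (by simp)
      rfl rfl (fun _ _ _ => rfl) (fun _ => rfl) (fun _ _ => rfl) (fun _ _ => rfl) (F.s0, none)
      (F.mstk (F.store fun _ => []) x []) _ ?_ ?_ ?_ rfl
    · rfl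
    · have : only t x.reverse t = x.reverse.map (fun x => x) ++ [] := by rw [only_self]; simp
      exact this
    · rintro ((j | j) | b) hj hj'
      · exact only_ne (by simpa using hj') x.reverse
      · rfl
      · cases b
        · exact absurd rfl hj
        · rfl
  have h2 : NRun (Sum.elim (fun _ => false) F.guessing) (F.ntmStmt i t F.m) (F.ntmStmt i t F.alt)
      (x.length + 1) []
      ⟨some (.inl 1), (F.s0, none), F.mstk (F.store (only t x.reverse)) [] []⟩
      ⟨some (.inr F.main), (F.s0, none), F.mstk (F.store (only i x)) [] []⟩ := by
    refine NRun.of_steps (NRun.move (g := Sum.elim (fun _ => false) F.guessing)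
      (m := F.ntmStmt i t F.m)
      (L := .inl 1) (k := .inl (.inl t)) (k' := .inl (.inl i)) (f := fun s o => (s.1, o))
      (p := fun s => s.2.isSome) (h := fun s => s.2.getD false) (conv := fun x => x)
      (by simpa using hit.symm) rfl rfl
      (fun _ _ _ => rfl) (fun _ => rfl) (fun _ _ => rfl) (fun _ _ => rfl) (F.s0, none)
      (F.mstk (F.store (only t x.reverse)) [] []) _ ?_ ?_ ?_ rfl) ?_
    · exact only_ne hit.symm x
    · have : only i x i = (only t x.reverse t).reverse.map (fun x => x) ++
        only t x.reverse i := by rw [only_self, only_self, only_ne hit]; simp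
      exact this
    · rintro ((j | j) | b) hj hj'
      · exact (only_ne (by simpa using hj') _).trans (only_ne (by simpa using hj) _).symm
      · rfl
      · cases b <;> rfl
    · change (only t x.reverse t).length + 1 = _
      rw [only_self]; simp
  have h3 := NRun.translate (g := F.guessing) (m := F.m) (a := F.alt)
      (g' := Sum.elim (fun _ => false) F.guessing) (m' := F.ntmStmt i t F.m)
      (a' := F.ntmStmt i t F.alt) (n := n) (w := w)
      (c := ⟨some F.main, F.s0, F.store (only i x)⟩) (c' := ⟨none, F.s0, F.store (only i y)⟩)
      (ex := TM2.Stmt.pop (Γ := F.MStk Bool Bool) (Sum.inl (Sum.inl i)) (fun s o => (s.1, o)) .halt)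
      (F.machTr_sound (Γ₀ := Bool) (Γ₁ := Bool) [] [] none) (fun _ => rfl) (fun _ => rfl)
      (fun _ => rfl) h
  have h0 : (F.toNTM i t).init x =
      ⟨some (.inl 0), (F.s0, none), F.mstk (F.store fun _ => []) x []⟩ := by
    refine congrArg (TM2.Cfg.mk _ _) (funext fun k => ?_)
    rcases k with (k | k) | b
    · rfl
    · rfl
    · cases b
      · exact List.map_id _
      · rfl
  have h4 := h1.trans' (w' := w) (N := 2 * x.length + 2 + n) (h2.trans (w := []) (w' := w) h3)
    (by omega) rfl
  have h5 : (F.toNTM i t).Run (2 * x.length + 2 + n) w ((F.toNTM i t).init x) _ :=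
    NTM.run_iff_nrun.mpr (by rw [h0]; exact h4)
  refine ⟨_, h5, rfl, ?_⟩
  · have : only i y i = y := only_self i y
    show (((only i y i).head? == some true) = true) ↔ _
    rw [this]
    simp

end Frag

/-- Guess a string that is as long as the contents of register `0`. -/
def guessLike : Frag Bool (Fin 4) := loop 0 fun _ => guess 1 false true

theorem exec_guessLike (x w r r₂ r₃ : Str) (h : w.length = x.length) :
    ∃ n ≤ 2 * x.length + 1,
      guessLike.Exec ![x, r, r₂, r₃] w ![[], w.reverse ++ r, r₂, r₃] n := by
  suffices h : ∃ n ≤ 2 * x.length + 1, Loops (0 : Fin 4) (fun _ => guess 1 false true)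
      ![x, r, r₂, r₃] w ![[], w.reverse ++ r, r₂, r₃] n by
    obtain ⟨n, hn, h⟩ := h
    exact ⟨n, hn, h.exec⟩
  induction x generalizing w r with
  | nil =>
    obtain rfl : w = [] := by simpa using h
    exact ⟨1, by simp, .nil rfl⟩
  | cons b x ih =>
    cases w with
    | nil => simp at h
    | cons c w =>
      obtain ⟨n, hn, h'⟩ := ih w (c :: r) (by simpa using h)
      have h1 := exec_guess (A := Bool) (1 : Fin 4) false true c ![x, r, r₂, r₃]
      have hc : (if c then true else false) = c := by cases c <;> rfl
      rw [hc, upd_one] at h1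
      refine ⟨1 + 1 + n, by simp; omega, ?_⟩
      have := Loops.cons (S := ![b :: x, r, r₂, r₃]) (i := (0 : Fin 4))
        (B := fun _ => guess 1 false true) (x := b) (l := x) rfl (w := [c])
        (S₁ := ![x, c :: r, r₂, r₃]) (by rw [upd_zero]; exact h1) h'
      simpa using this

/-- Exhibiting one halting run for each string of the prescribed length determines all runs: every
guess sequence is comparable with such a string, and runs with comparable guesses agree as far as
they go. -/
theorem NTM.of_runs {M : NTM} {n : Str → ℕ} {R : Str → Str → Prop} (t : Polynomial ℕ)
    (h : ∀ x w, w.length = n x → ∃ k ≤ t.eval x.length, ∃ c, M.Run k w (M.init x) c ∧ c.l = none ∧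
      (M.accept c.var = true ↔ R x w)) :
    M.IsPolyTime ∧ (∀ x, M.paths x = strs (n x)) ∧
      ∀ x, M.acc x = {w | w.length = n x ∧ R x w} := by
  -- Truncate `w` or pad it with zeros.
  have key : ∀ x w, ∃ W : Str, W.length = n x ∧ (w <+: W ∨ W <+: w) := fun x w =>
    ⟨(w ++ List.replicate (n x) false).take (n x), by simp,
      List.prefix_or_prefix_of_prefix (List.prefix_append _ _) (List.take_prefix _ _)⟩
  have halts : ∀ x w c, M.HaltsWith x w c → w.length = n x ∧ (M.accept c.var = true ↔ R x w) := by
    rintro x w c ⟨⟨k, r⟩, hc⟩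
    obtain ⟨W, hW, hp⟩ := key x w
    obtain ⟨k', -, c', r', hc', ha⟩ := h x W hW
    rw [NTM.run_iff_nrun] at r r'
    obtain ⟨-, rfl, rfl⟩ := r.eq_of_halt r' hc hc' hp
    exact ⟨hW, ha⟩
  refine ⟨⟨t, fun x k w c r => ?_⟩, fun x => Set.ext fun w => ⟨?_, fun hw => ?_⟩,
    fun x => Set.ext fun w => ⟨?_, fun hw => ?_⟩⟩
  · obtain ⟨W, hW, hp⟩ := key x w
    obtain ⟨k', hk', c', r', hc', -⟩ := h x W hW
    rw [NTM.run_iff_nrun] at r r'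
    obtain ⟨j, -, hj, -⟩ := r.prefix_of_halt r' hc' hp
    omega
  · rintro ⟨c, hc⟩
    exact (halts x w c hc).1
  · obtain ⟨k, -, c, r, hc, -⟩ := h x w hw
    exact ⟨c, ⟨k, r⟩, hc⟩
  · rintro ⟨c, hc, ha⟩
    exact ⟨(halts x w c hc).1, (halts x w c hc).2.mp ha⟩
  · obtain ⟨k, -, c, r, hc, ha⟩ := h x w hw.1
    exact ⟨c, ⟨⟨k, r⟩, hc⟩, ha.mpr hw.2⟩

/-- A machine that guesses a string `w` of given length and then checks `R x w`. -/
theorem exists_ntm {κ : Str → Str} {R : Str × Str → Bool} (hκ : PT κ) (hR : PT R) :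
    ∃ M : NTM, M.IsPolyTime ∧ (∀ x, M.paths x = strs (κ x).length) ∧
      ∀ x, M.acc x = {w | w.length = (κ x).length ∧ R (x, w) = true} := by
  obtain ⟨T, ⟨P, hP⟩, hF⟩ := exists_call_pt hκ
  obtain ⟨T', ⟨P', hP'⟩, hG⟩ := exists_call_pt hR
  obtain ⟨F, hF⟩ := hF 0 1 2 (by decide) (by decide) (by decide)
  obtain ⟨G, hG⟩ := hG 0 1 2 (by decide) (by decide) (by decide)
  obtain ⟨Q, hQ⟩ := hκ.pb
  refine ⟨toNTM ((dup.seq F).seq (guessLike.seq ((move 3 2).seq ((move 1 3).seq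
    ((move 2 0).seq ((mkPair id).seq G)))))) 0 1,
    NTM.of_runs (n := fun x => (κ x).length) (R := fun x w => R (x, w) = true)
      (100 * (.X + 1 + Q) + P + P'.comp (2 * .X + 1 + Q)) fun x w hw => ?_⟩
  have h1 : (dup.seq F).Does ![x, [], [], []] ![κ x, [], [], x] (5 * x.length + 2 + T x) :=
    (does_dup x []).seq ((hF ![x, [], [], x] x rfl rfl rfl).congr (upd_zero _ _ _ _ _))
  obtain ⟨n₁, hn₁, h1⟩ := h1
  obtain ⟨n₂, hn₂, h2⟩ := exec_guessLike (κ x) w [] [] x hw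
  rw [List.append_nil] at h2
  have m1 : (move (A := Bool) 3 2).Does ![[], w.reverse, [], x] ![[], w.reverse, x.reverse, []] _ :=
    move_to (by decide) (by rw [upd_three, upd_two]; simp)
  have m2 : (move (A := Bool) 1 3).Does ![[], w.reverse, x.reverse, []] ![[], [], x.reverse, w] _ :=
    move_to (by decide) (by rw [upd_one, upd_three]; simp)
  have m3 : (move (A := Bool) 2 0).Does ![[], [], x.reverse, w] ![x, [], [], w] _ :=
    move_to (by decide) (by rw [upd_two, upd_zero]; simp)
  have m4 := does_mkPair id x w
  rw [List.map_id, List.map_id, List.map_id] at m4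
  have m5 : G.Does ![enc (x, w), [], [], []] ![[R (x, w)], [], [], []] _ :=
    (hG _ (x, w) rfl rfl rfl).congr (upd_zero _ _ _ _ _)
  obtain ⟨n₃, hn₃, h3⟩ := m1.seq (m2.seq (m3.seq (m4.seq m5)))
  have h := exec_seq h1 (exec_seq h2 h3)
  rw [List.append_nil, List.nil_append, ← only_zero, ← only_zero] at h
  obtain ⟨c, hr, hc, ha⟩ := toNTM_run (t := 1) (by decide) x _ w h
  refine ⟨_, ?_, c, hr, hc, ha.trans (by simp)⟩
  have e1 := hP x
  have e2 := hP' (x, w)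
  have e3 := hQ x
  have e4 : P'.eval (enc (x, w)).length ≤ P'.eval (2 * x.length + 1 + Q.eval x.length) :=
    eval_mono _ (by simp at e3 ⊢; omega)
  simp only [Polynomial.eval_add, Polynomial.eval_mul, Polynomial.eval_X, Polynomial.eval_ofNat,
    Polynomial.eval_comp, Polynomial.eval_one]
  simp at e1 e3 hn₃
  omega

/-- Polynomial-time functions are computed by unambiguous machines. -/
theorem fpt_subset_upsvt : FPt ⊆ UPSVt := by
  rintro f ⟨h⟩
  have hr := ofAux_run h
  set N : NTM :=
    { toTM2ComputableAux := h.toTM2ComputableAux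
      guessing := fun _ => false
      alt := h.tm.m
      accept := fun _ => true } with hN
  have hN' : N.IsPolyTime ∧ (∀ x, N.paths x = strs 0) ∧
      ∀ x, N.acc x = {w | w.length = 0 ∧ True} := by
    refine NTM.of_runs h.time fun x w hw => ?_
    obtain ⟨n, hn, r⟩ := hr x
    obtain rfl : w = [] := by simpa using hw
    exact ⟨n, hn, _, NTM.run_iff_nrun.mpr r, rfl, iff_of_true rfl trivial⟩
  obtain ⟨h1, -, h3⟩ := hN'
  have h3' : ∀ x, N.acc x = {[]} := fun x => by rw [h3]; ext w; simp
  refine ⟨N, h1, fun x => ⟨by rw [h3']; exact Set.subsingleton_singleton, ?_, ?_⟩⟩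
  · intro w hw
    rw [h3'] at hw
    obtain rfl := hw
    obtain ⟨n, hn, r⟩ := hr x
    refine ⟨f x, ⟨_, ⟨⟨n, NTM.run_iff_nrun.mpr r⟩, rfl⟩, rfl, ?_⟩, rfl⟩
    refine (congrArg (List.map h.outputAlphabet) (haltList_stk h.tm _)).trans ?_
    rw [List.map_map]
    refine (List.map_congr_left fun y _ => ?_).trans (List.map_id _)
    exact h.outputAlphabet.apply_symm_apply y
  · rw [h3']
    simp

end

section

open Frag
open Enc (enc)

variable {α β : Type} [Enc α] [Enc β]

/-! ### Polynomials -/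

theorem isPoly_eval (P : Polynomial ℕ) : IsPoly fun n => P.eval n :=
  ⟨P.map (Nat.castRingHom ℝ), fun n => by rw [Polynomial.eval_natCast_map]; rfl⟩

theorem IsPoly.add {p q : ℕ → ℕ} (hp : IsPoly p) (hq : IsPoly q) : IsPoly fun n => p n + q n := by
  obtain ⟨P, hP⟩ := hp
  obtain ⟨Q, hQ⟩ := hq
  exact ⟨P + Q, fun n => by rw [Polynomial.eval_add, ← hP, ← hQ, Nat.cast_add]⟩

theorem isPoly_const (k : ℕ) : IsPoly fun _ => k := ⟨.C k, fun n => by simp⟩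

/-! ### Polynomial-time successor orders -/

/-- A polynomial-time computable successor relation with least and greatest elements, depending
on a parameter. -/
structure POrd (α : Type) [Enc α] where
  bot : α → Str
  top : α → Str
  prec : α × Str × Str → Bool
  pt_bot : PT bot
  pt_top : PT top
  pt_prec : PT prec

/-- The ranking function `r` exhibits the strings of length `N` with the successor relation of `O`
for the parameter `a` as a linear order. -/
structure POrd.Ranks (O : POrd α) (a : α) (N : ℕ) (r : Str → ℕ) : Prop where
  length_bot : (O.bot a).length = N
  length_top : (O.top a).length = N
  rank_bot : r (O.bot a) = 0
  rank_top : r (O.top a) + 1 = 2 ^ N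
  lt : ∀ w : Str, w.length = N → r w < 2 ^ N
  inj : ∀ v w : Str, v.length = N → w.length = N → r v = r w → v = w
  prec_iff : ∀ v w : Str, v.length = N → w.length = N → (O.prec (a, v, w) = true ↔ r w = r v + 1)

namespace POrd

variable {O O' : POrd α} {a : α} {N : ℕ} {r : Str → ℕ}

/-- There are `2 ^ N` strings and `2 ^ N` possible ranks, so injectivity is enough. -/
theorem Ranks.surj (h : O.Ranks a N r) {k : ℕ} (hk : k < 2 ^ N) :
    ∃ w : Str, w.length = N ∧ r w = k := by
  have hb : Function.Bijective fun w : List.Vector Bool N => (⟨r w.1, h.lt _ w.2⟩ : Fin (2 ^ N)) := by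
    rw [Fintype.bijective_iff_injective_and_card]
    refine ⟨fun v w hvw => ?_, by simp⟩
    exact Subtype.ext (h.inj _ _ v.2 w.2 (by simpa using hvw))
  obtain ⟨w, hw⟩ := hb.2 ⟨k, hk⟩
  exact ⟨w.1, w.2, by simpa using hw⟩

theorem Ranks.ncard (h : O.Ranks a N r) {s e : ℕ} (he : e ≤ 2 ^ N) :
    {w : Str | w.length = N ∧ s ≤ r w ∧ r w < e}.ncard = e - s := by
  have hi : Set.InjOn r {w : Str | w.length = N ∧ s ≤ r w ∧ r w < e} :=
    fun v hv w hw hvw => h.inj v w hv.1 hw.1 hvw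
  have him : r '' {w : Str | w.length = N ∧ s ≤ r w ∧ r w < e} = (Finset.Ico s e : Set ℕ) := by
    ext k
    simp only [Set.mem_image, Set.mem_ofPred_eq, Finset.coe_Ico, Set.mem_Ico]
    constructor
    · rintro ⟨w, ⟨-, h1⟩, rfl⟩
      exact h1
    · rintro ⟨h1, h2⟩
      obtain ⟨w, hw, rfl⟩ := h.surj (h2.trans_le he)
      exact ⟨w, ⟨hw, h1, h2⟩, rfl⟩
  rw [← hi.ncard_image, him, Set.ncard_coe_finset, Nat.card_Ico]

theorem Ranks.eq_bot_iff (h : O.Ranks a N r) {w : Str} (hw : w.length = N) :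
    w = O.bot a ↔ r w = 0 :=
  ⟨fun e => by rw [e, h.rank_bot], fun e => h.inj _ _ hw h.length_bot (e.trans h.rank_bot.symm)⟩

theorem Ranks.eq_top_iff (h : O.Ranks a N r) {w : Str} (hw : w.length = N) :
    w = O.top a ↔ r w + 1 = 2 ^ N :=
  ⟨fun e => by rw [e, h.rank_top], fun e => h.inj _ _ hw h.length_top (by have := h.rank_top; omega)⟩

/-- The cyclic successor relation. -/
def cyc (O : POrd α) (p : α × Str × Str) : Bool :=
  O.prec p || (decide (p.2.1 = O.top p.1) && decide (p.2.2 = O.bot p.1))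

theorem pt_cyc (O : POrd α) : PT O.cyc :=
  O.pt_prec.or ((pt_snd.fst.decide_eq (O.pt_top.comp pt_fst)).and
    (pt_snd.snd.decide_eq (O.pt_bot.comp pt_fst)))

/-- Each string has exactly one cyclic successor, the greatest one included. Certificates made of a
string and its neighbour thus exist wherever the cluster lies. -/
theorem Ranks.cyc_iff (h : O.Ranks a N r) {v w : Str} (hv : v.length = N) (hw : w.length = N) :
    O.cyc (a, v, w) = true ↔ r w = r v + 1 ∨ (r v + 1 = 2 ^ N ∧ r w = 0) := by
  rw [cyc, Bool.or_eq_true, Bool.and_eq_true, decide_eq_true_iff, decide_eq_true_iff,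
    h.prec_iff v w hv hw, h.eq_top_iff hv, h.eq_bot_iff hw]

/-- The lexicographical order on the strings that are as long as `κ a`. -/
def lex (κ : α → Str) (hκ : PT κ) : POrd α where
  bot a := List.replicate (κ a).length false
  top a := List.replicate (κ a).length true
  prec p := succb p.2.1 p.2.2
  pt_bot := hκ.replicate false
  pt_top := hκ.replicate true
  pt_prec := pt_snd.fst.succb pt_snd.snd

theorem ranks_lex {κ : α → Str} (hκ : PT κ) (hN : (κ a).length = N) : (lex κ hκ).Ranks a N val where
  length_bot := by simp [lex, hN]
  length_top := by simp [lex, hN]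
  rank_bot := val_zeros _
  rank_top := by
    have := Nat.one_le_two_pow (n := N)
    simp only [lex, val_ones, hN]; omega
  lt w hw := hw ▸ val_lt w
  inj v w hv hw := val_inj (hv.trans hw.symm)
  prec_iff v w hv hw := succb_iff (hv.trans hw.symm)

/-- Change of the parameter. -/
def comap (O : POrd α) (g : β → α) (hg : PT g) : POrd β where
  bot b := O.bot (g b)
  top b := O.top (g b)
  prec p := O.prec (g p.1, p.2)
  pt_bot := O.pt_bot.comp hg
  pt_top := O.pt_top.comp hg
  pt_prec := O.pt_prec.comp ((hg.comp pt_fst).pair pt_snd)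

theorem Ranks.comap {g : β → α} (hg : PT g) {b : β} (h : O.Ranks (g b) N r) :
    (O.comap g hg).Ranks b N r :=
  ⟨h.length_bot, h.length_top, h.rank_bot, h.rank_top, h.lt, h.inj, h.prec_iff⟩

/-- Case distinction. -/
def cond (c : α → Bool) (hc : PT c) (O O' : POrd α) : POrd α where
  bot a := if c a then O.bot a else O'.bot a
  top a := if c a then O.top a else O'.top a
  prec p := if c p.1 then O.prec p else O'.prec p
  pt_bot := hc.ite O.pt_bot O'.pt_bot
  pt_top := hc.ite O.pt_top O'.pt_top
  pt_prec := (hc.comp pt_fst).ite O.pt_prec O'.pt_prec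

theorem Ranks.cond_true {c : α → Bool} {hc : PT c} (h : O.Ranks a N r) (ha : c a = true) :
    (cond c hc O O').Ranks a N r := by
  exact ⟨by simpa only [cond, ha, if_true] using h.length_bot,
    by simpa only [cond, ha, if_true] using h.length_top,
    by simpa only [cond, ha, if_true] using h.rank_bot,
    by simpa only [cond, ha, if_true] using h.rank_top, h.lt, h.inj,
    by simpa only [cond, ha, if_true] using h.prec_iff⟩

theorem Ranks.cond_false {c : α → Bool} {hc : PT c} (h : O'.Ranks a N r) (ha : c a = false) :
    (cond c hc O O').Ranks a N r := by
  exact ⟨by simpa only [cond, ha, Bool.false_eq_true, if_false] using h.length_bot,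
    by simpa only [cond, ha, Bool.false_eq_true, if_false] using h.length_top,
    by simpa only [cond, ha, Bool.false_eq_true, if_false] using h.rank_bot,
    by simpa only [cond, ha, Bool.false_eq_true, if_false] using h.rank_top, h.lt, h.inj,
    by simpa only [cond, ha, Bool.false_eq_true, if_false] using h.prec_iff⟩

/-- The reversed order. -/
def rev (O : POrd α) : POrd α where
  bot := O.top
  top := O.bot
  prec p := O.prec (p.1, p.2.2, p.2.1)
  pt_bot := O.pt_top
  pt_top := O.pt_bot
  pt_prec := O.pt_prec.comp (pt_fst.pair (pt_snd.snd.pair pt_snd.fst))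

theorem Ranks.rev (h : O.Ranks a N r) : O.rev.Ranks a N fun w => 2 ^ N - 1 - r w where
  length_bot := h.length_top
  length_top := h.length_bot
  rank_bot := by have := h.rank_top; simp only [POrd.rev]; omega
  rank_top := by
    have := Nat.one_le_two_pow (n := N)
    simp only [POrd.rev, h.rank_bot]; omega
  lt w hw := by
    have := h.lt w hw
    omega
  inj v w hv hw e := by
    have h1 := h.lt v hv
    have h2 := h.lt w hw
    exact h.inj v w hv hw (by omega)
  prec_iff v w hv hw := by
    have h1 := h.lt v hv
    have h2 := h.lt w hw
    refine (h.prec_iff w v hw hv).trans ?_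
    omega

/-- The order that starts with `z` and ends with its cyclic predecessor `u`. -/
def rot (O : POrd α) (z u : α → Str) (hz : PT z) (hu : PT u) : POrd α where
  bot := z
  top := u
  prec p := O.cyc p && !decide (p.2.2 = z p.1)
  pt_bot := hz
  pt_top := hu
  pt_prec := O.pt_cyc.and (pt_snd.snd.decide_eq (hz.comp pt_fst)).not

/-- The cycle is cut open between `u` and `z`, and ranks are shifted by that of `z` modulo `2 ^ N`.
Forbidding `z` as a successor removes the one pair that closes the cycle, also for `N = 0`, where
`u` and `z` coincide. -/
theorem Ranks.rot (h : O.Ranks a N r) {z u : α → Str} (hz : PT z) (hu : PT u)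
    (hlz : (z a).length = N) (hlu : (u a).length = N) (hc : O.cyc (a, u a, z a) = true) :
    (O.rot z u hz hu).Ranks a N fun w =>
      if r (z a) ≤ r w then r w - r (z a) else r w + 2 ^ N - r (z a) := by
  rw [h.cyc_iff hlu hlz] at hc
  have h1 := h.lt _ hlz
  have h2 := h.lt _ hlu
  constructor
  · exact hlz
  · exact hlu
  · simp [POrd.rot]
  · change (if r (z a) ≤ r (u a) then r (u a) - r (z a) else r (u a) + 2 ^ N - r (z a)) + 1 = 2 ^ N
    split_ifs <;> omega
  · intro w hw
    have h3 := h.lt w hw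
    split_ifs <;> omega
  · intro v w hv hw e
    have h3 := h.lt w hw
    have h4 := h.lt v hv
    refine h.inj v w hv hw ?_
    split_ifs at e <;> omega
  · intro v w hv hw
    have h3 := h.lt w hw
    have h4 := h.lt v hv
    have h5 : w = z a ↔ r w = r (z a) := ⟨fun e => by rw [e], h.inj _ _ hw hlz⟩
    simp only [POrd.rot, Bool.and_eq_true, h.cyc_iff hv hw, Bool.not_eq_true',
      decide_eq_false_iff_not, h5]
    split_ifs <;> omega

/-- The lexicographical product of the lexicographical order on the strings that are as long as
`κ a` and an order that may depend on these strings. -/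
def prod (κ : α → Str) (hκ : PT κ) (I : POrd (α × Str)) : POrd α where
  bot a := List.replicate (κ a).length false ++ I.bot (a, List.replicate (κ a).length false)
  top a := List.replicate (κ a).length true ++ I.top (a, List.replicate (κ a).length true)
  prec p :=
    (decide (p.2.1.take (κ p.1).length = p.2.2.take (κ p.1).length) &&
      I.prec ((p.1, p.2.1.take (κ p.1).length),
        (p.2.1.drop (κ p.1).length, p.2.2.drop (κ p.1).length))) ||
    (succb (p.2.1.take (κ p.1).length) (p.2.2.take (κ p.1).length) &&
      (decide (p.2.1.drop (κ p.1).length = I.top (p.1, p.2.1.take (κ p.1).length)) &&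
       decide (p.2.2.drop (κ p.1).length = I.bot (p.1, p.2.2.take (κ p.1).length))))
  pt_bot := (hκ.replicate false).append (I.pt_bot.comp (pt_id.pair (hκ.replicate false)))
  pt_top := (hκ.replicate true).append (I.pt_top.comp (pt_id.pair (hκ.replicate true)))
  pt_prec := by
    have k : PT fun p : α × Str × Str => κ p.1 := hκ.comp pt_fst
    have y₁ := k.take (pt_fst.comp (pt_snd (α := α) (β := Str × Str)))
    have y₂ := k.drop (pt_fst.comp (pt_snd (α := α) (β := Str × Str)))
    have z₁ := k.take (pt_snd.comp (pt_snd (α := α) (β := Str × Str)))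
    have z₂ := k.drop (pt_snd.comp (pt_snd (α := α) (β := Str × Str)))
    exact ((y₁.decide_eq z₁).and (I.pt_prec.comp ((pt_fst.pair y₁).pair (y₂.pair z₂)))).or
      ((y₁.succb z₁).and ((y₂.decide_eq (I.pt_top.comp (pt_fst.pair y₁))).and
        (z₂.decide_eq (I.pt_bot.comp (pt_fst.pair z₁)))))

/-- Counting in mixed radix: adding one either raises the low digit or carries. -/
theorem mul_add_eq_iff {B a b c d : ℕ} (hc : c < B) (hd : d < B) :
    b * B + d = a * B + c + 1 ↔ (a = b ∧ d = c + 1) ∨ (b = a + 1 ∧ c + 1 = B ∧ d = 0) := by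
  constructor
  · intro h
    rcases lt_trichotomy b a with h1 | rfl | h1
    · obtain ⟨k, rfl⟩ := Nat.exists_eq_add_of_lt h1
      have : (b + k + 1) * B = b * B + k * B + B := by ring
      have := Nat.zero_le (k * B)
      omega
    · exact .inl ⟨rfl, by omega⟩
    · obtain ⟨k, rfl⟩ := Nat.exists_eq_add_of_lt h1
      have h2 : (a + k + 1) * B = a * B + k * B + B := by ring
      rcases Nat.eq_zero_or_pos k with rfl | hk
      · rw [Nat.zero_mul] at h2
        exact .inr ⟨rfl, by omega, by omega⟩
      · have : B ≤ k * B := Nat.le_mul_of_pos_left _ hk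
        omega
  · rintro (⟨rfl, rfl⟩ | ⟨rfl, rfl, rfl⟩) <;> ring

theorem mul_add_inj {B a b c d : ℕ} (hc : c < B) (hd : d < B) (h : a * B + c = b * B + d) :
    a = b ∧ c = d := by
  have hB : 0 < B := by omega
  have h1 := congrArg (· / B) h
  have h2 := congrArg (· % B) h
  simp only [Nat.mul_add_mod', Nat.mod_eq_of_lt hc, Nat.mod_eq_of_lt hd] at h2
  simp only [mul_comm _ B, Nat.mul_add_div hB, Nat.div_eq_of_lt hc, Nat.div_eq_of_lt hd,
    add_zero] at h1
  exact ⟨h1, h2⟩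

/-- The prefix counts blocks of `2 ^ N` strings and the rest is ranked within its block. The order
inside a block may vary with the prefix, as only its extreme elements matter at the boundaries. -/
theorem Ranks.prod {κ : α → Str} (hκ : PT κ) {I : POrd (α × Str)} {K : ℕ}
    (hK : (κ a).length = K) {ρ : Str → Str → ℕ}
    (h : ∀ q : Str, q.length = K → I.Ranks (a, q) N (ρ q)) :
    (POrd.prod κ hκ I).Ranks a (K + N) fun w => val (w.take K) * 2 ^ N + ρ (w.take K) (w.drop K) := by
  have hz := h (List.replicate K false) (by simp)
  have ho := h (List.replicate K true) (by simp)
  have hlt : ∀ w : Str, w.length = K + N → ρ (w.take K) (w.drop K) < 2 ^ N := fun w hw =>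
    (h _ (by simp [hw])).lt _ (by simp [hw])
  have hv : ∀ w : Str, w.length = K + N → val (w.take K) < 2 ^ K := fun w hw => by
    have := val_lt (w.take K)
    rwa [List.length_take, min_eq_left (by omega)] at this
  constructor
  · simp [POrd.prod, hK, hz.length_bot]
  · simp [POrd.prod, hK, ho.length_top]
  · simp only [POrd.prod, hK]
    rw [List.take_left' (by simp), List.drop_left' (by simp), val_zeros, hz.rank_bot, Nat.zero_mul]
  · simp only [POrd.prod, hK]
    rw [List.take_left' (by simp), List.drop_left' (by simp), val_ones, add_assoc, ho.rank_top,
      ← Nat.succ_mul, pow_add, Nat.succ_eq_add_one, Nat.sub_add_cancel Nat.one_le_two_pow]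
  · intro w hw
    have h1 := hlt w hw
    have h2 := hv w hw
    have h3 : (val (w.take K) + 1) * 2 ^ N ≤ 2 ^ K * 2 ^ N := Nat.mul_le_mul_right _ h2
    rw [Nat.succ_mul] at h3
    rw [pow_add]
    omega
  · intro v w hv' hw e
    obtain ⟨e1, e2⟩ := mul_add_inj (hlt v hv') (hlt w hw) e
    have e3 : v.take K = w.take K := val_inj (by simp [hv', hw]) e1
    rw [e3] at e2
    have e4 := (h (w.take K) (by simp [hw])).inj _ _ (by simp [hv']) (by simp [hw]) e2
    rw [← List.take_append_drop K v, e3, e4, List.take_append_drop]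
  · intro v w hv' hw
    have tv : (v.take K).length = K := by simp [hv']
    have tw : (w.take K).length = K := by simp [hw]
    have dv : (v.drop K).length = N := by simp [hv']
    have dw : (w.drop K).length = N := by simp [hw]
    simp only [POrd.prod, hK, Bool.or_eq_true, Bool.and_eq_true, decide_eq_true_iff]
    rw [mul_add_eq_iff (hlt v hv') (hlt w hw), (h _ tv).prec_iff _ _ dv dw,
      (h _ tv).eq_top_iff dv, (h _ tw).eq_bot_iff dw, succb_iff (tv.trans tw.symm)]
    refine or_congr ⟨fun ⟨e1, e2⟩ => ⟨by rw [e1], by rw [← e2, e1]⟩, fun ⟨e1, e2⟩ => ?_⟩ Iff.rfl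
    have e3 : v.take K = w.take K := val_inj (tv.trans tw.symm) e1
    exact ⟨e3, by rw [← e2, e3]⟩

end POrd

/-! ### Clusters -/

/-- For the parameter `a`, the strings of length `N` accepted by `A` form an interval of length
`n` with respect to the ranking `r`, starting at `s`. -/
structure IsCluster (O : POrd α) (A : α × Str → Bool) (a : α) (N n : ℕ) (r : Str → ℕ) (s : ℕ) :
    Prop where
  ranks : O.Ranks a N r
  le : s + n ≤ 2 ^ N
  mem_iff : ∀ w : Str, w.length = N → (A (a, w) = true ↔ s ≤ r w ∧ r w < s + n)

theorem IsCluster.ncard {O : POrd α} {A : α × Str → Bool} {a : α} {N n : ℕ} {r : Str → ℕ} {s : ℕ}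
    (h : IsCluster O A a N n r s) : {w : Str | w.length = N ∧ A (a, w) = true}.ncard = n := by
  have h1 := h.ranks.ncard (s := s) h.le
  rw [Nat.add_sub_cancel_left] at h1
  rw [← h1]
  congr 1
  ext w
  exact and_congr_right (h.mem_iff w)

/-- The ranking is the value of the bijection, and conversely the bijection writes the rank in
binary. The bijection of the definition need not be computable, so the ranking need not be either.
Following a path turns the machine into a predicate; guessing a string and testing it turns the
predicate into a balanced machine. -/
theorem mem_cluSharpP_iff {f : Str → ℕ} : f ∈ CLUSharpP ↔ ∃ (p : ℕ → ℕ) (O : POrd Str)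
    (A : Str × Str → Bool), IsPoly p ∧ PT A ∧
      ∀ x, ∃ r s, IsCluster O A x (p x.length) (f x) r s := by
  constructor
  · rintro ⟨p, hp, M, hM, hb, bot, hbot, top, htop, prec, hprec, H⟩
    obtain ⟨V, hV, hV1, hV2⟩ := exists_pt_outputs hM
    have hA : ∀ x w, (V (x, w)).headD false = true ↔ w ∈ M.acc x := by
      intro x w
      by_cases h : w ∈ M.acc x
      · obtain ⟨s, hs⟩ := NTM.mem_acc_iff.mp h
        simp [hV1 x w s hs, h]
      · simp [hV2 x w h, h]
    refine ⟨p, ⟨bot, top, fun p => prec p.1 p.2.1 p.2.2, hbot, htop, polyTimePred₃_iff.mp hprec⟩,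
      fun a => (V a).headD false, hp, hV.head, fun x => ?_⟩
    obtain ⟨h, hbij, ⟨hlb, hlt⟩, ⟨hrb, hrt⟩, hpr, hcl, hf⟩ := H x
    have hlen : ∀ w : Str, w.length = p x.length → (h w).length = p x.length := fun w hw =>
      hbij.mapsTo hw
    have hr : POrd.Ranks ⟨bot, top, fun p => prec p.1 p.2.1 p.2.2, hbot, htop,
        polyTimePred₃_iff.mp hprec⟩ x (p x.length) (fun w => val (h w)) := by
      refine ⟨hlb, hlt, ?_, ?_, ?_, ?_, ?_⟩
      · simp only [hrb, val_zeros]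
      · have := Nat.one_le_two_pow (n := p x.length)
        simp only [hrt, val_ones]; omega
      · intro w hw
        have := val_lt (h w)
        rwa [hlen w hw] at this
      · intro v w hv hw e
        exact hbij.injOn hv hw (val_inj ((hlen v hv).trans (hlen w hw).symm) e)
      · intro v w hv hw
        exact (hpr v hv w hw).trans (lexSucc_iff ((hlen v hv).trans (hlen w hw).symm))
    by_cases h0 : f x = 0
    · refine ⟨_, 0, hr, by simp [h0], fun w hw => ?_⟩
      have hsub : M.acc x ⊆ strs (p x.length) := by
        rw [← hb x]
        rintro w ⟨c, hc, -⟩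
        exact ⟨c, hc⟩
      -- `Set.ncard` vanishes on infinite sets too, so finiteness is needed to conclude that there
      -- are no accepting paths.
      have hfin : (M.acc x).Finite := (List.finite_length_eq Bool (p x.length)).subset hsub
      rw [hA, h0]
      rw [h0, eq_comm, Set.ncard_eq_zero hfin] at hf
      simp [hf]
    · obtain ⟨l, hl, u, hu, hacc⟩ := hcl h0
      have hmem : ∀ w : Str, w.length = p x.length →
          (w ∈ M.acc x ↔ val (h l) ≤ val (h w) ∧ val (h w) < val (h u) + 1) := by
        intro w hw
        rw [hacc, Set.mem_ofPred_eq, lexLe_iff ((hlen l hl).trans (hlen w hw).symm),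
          lexLe_iff ((hlen w hw).trans (hlen u hu).symm), Nat.lt_succ_iff]
        exact and_iff_right hw
      have hu' := hr.lt u hu
      have hset : M.acc x = {w : Str | w.length = p x.length ∧ val (h l) ≤ val (h w) ∧
          val (h w) < val (h u) + 1} := by
        ext w
        constructor
        · intro hw
          have hw' : w.length = p x.length := by rw [hacc] at hw; exact hw.1
          exact ⟨hw', (hmem w hw').mp hw⟩
        · rintro ⟨hw', hw⟩
          exact (hmem w hw').mpr hw
      have hc := hr.ncard (s := val (h l)) (e := val (h u) + 1) hu'
      rw [hset, hc] at hf
      refine ⟨_, val (h l), hr, by omega, fun w hw => ?_⟩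
      rw [hA, hmem w hw, hf]
      constructor <;> rintro ⟨h1, h2⟩ <;> refine ⟨h1, ?_⟩ <;> omega
  · rintro ⟨p, O, A, hp, hA, H⟩
    choose r s H using H
    -- The least element tells the machine how many bits to guess; `p` is given by a real polynomial
    -- and does not itself provide a clock.
    obtain ⟨M, hM, hpaths, hacc⟩ := exists_ntm O.pt_bot hA
    have hlb : ∀ x, (O.bot x).length = p x.length := fun x => (H x).ranks.length_bot
    refine ⟨p, hp, M, hM, fun x => by rw [hpaths, hlb], O.bot, O.pt_bot, O.top, O.pt_top,
      fun x y z => O.prec (x, y, z), polyTimePred₃_iff.mpr O.pt_prec, fun x => ?_⟩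
    have hR := (H x).ranks
    have hval : ∀ w : Str, w.length = p x.length → val (bin (p x.length) (r x w)) = r x w :=
      fun w hw => val_bin (hR.lt w hw)
    have hacc' : M.acc x = {w : Str | w.length = p x.length ∧ A (x, w) = true} := by
      rw [hacc, hlb]
    refine ⟨fun w => bin (p x.length) (r x w), ⟨fun w _ => length_bin _ _, ?_, ?_⟩,
      ⟨hlb x, hR.length_top⟩, ⟨?_, ?_⟩, ?_, ?_, ?_⟩
    · intro v hv w hw e
      refine hR.inj v w hv hw ?_
      rw [← hval v hv, ← hval w hw]
      exact congrArg val e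
    · intro w hw
      obtain ⟨v, hv, e⟩ := hR.surj (k := val w) (by
        have := val_lt w
        rwa [show w.length = p x.length from hw] at this)
      refine ⟨v, hv, ?_⟩
      simp only [e]
      conv_lhs => rw [← show w.length = p x.length from hw]
      exact bin_val w
    · refine val_inj (by simp) ?_
      rw [hval _ (hlb x), hR.rank_bot, val_zeros]
    · refine val_inj (by simp) ?_
      have := hR.rank_top
      rw [hval _ hR.length_top, val_ones]
      omega
    · intro y hy z hz
      rw [lexSucc_iff (by simp), hval y hy, hval z hz]
      exact hR.prec_iff y z hy hz
    · intro h0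
      have hle := (H x).le
      obtain ⟨l, hl, el⟩ := hR.surj (k := s x) (by omega)
      obtain ⟨u, hu, eu⟩ := hR.surj (k := s x + f x - 1) (by omega)
      refine ⟨l, hl, u, hu, ?_⟩
      rw [hacc']
      ext w
      refine and_congr_right fun hw => ?_
      rw [(H x).mem_iff w hw, lexLe_iff (by simp), lexLe_iff (by simp), hval w hw, hval l hl,
        hval u hu, el, eu]
      omega
    · rw [hacc', (H x).ncard]

end

section

open Frag
open Enc (enc)

/-! ### Certificates of fixed length -/

theorem eq_zeros_append_strip {w : Str} (h : w ≠ List.replicate w.length false) :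
    ∃ j, w = List.replicate j false ++ true :: strip w := by
  induction w with
  | nil => simp at h
  | cons b w ih =>
    cases b
    · have h' : w ≠ List.replicate w.length false := fun e => h (by
        rw [List.length_cons, List.replicate_succ, ← e])
      obtain ⟨j, hj⟩ := ih h'
      exact ⟨j + 1, by rw [strip, List.replicate_succ, List.cons_append, ← hj]⟩
    · exact ⟨0, rfl⟩

theorem strip_inj {v w : Str} (hl : v.length = w.length) (hv : v ≠ List.replicate v.length false)
    (hw : w ≠ List.replicate w.length false) (h : strip v = strip w) : v = w := by
  obtain ⟨i, hi⟩ := eq_zeros_append_strip hv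
  obtain ⟨j, hj⟩ := eq_zeros_append_strip hw
  have h1 := congrArg List.length hi
  have h2 := congrArg List.length hj
  rw [h] at hi h1
  simp only [List.length_append, List.length_replicate, List.length_cons] at h1 h2
  have : i = j := by omega
  rw [hi, this, ← hj]

theorem strip_zeros_append (j : ℕ) (w : Str) :
    strip (List.replicate j false ++ true :: w) = w := by
  induction j with
  | zero => rfl
  | succ j ih => rw [List.replicate_succ, List.cons_append, strip, ih]

/-- The accepting paths of a machine, represented by strings of fixed length. -/
theorem exists_path_cert {M : NTM} (hM : M.IsPolyTime) :
    ∃ (K : Polynomial ℕ) (V : Str × Str → Str), PT V ∧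
      (∀ x w s, M.Outputs x w s → ∃ q : Str, q.length = K.eval x.length ∧ V (x, q) = true :: s) ∧
      (∀ x q, (V (x, q)).headD false = true → ∃ w s, M.Outputs x w s ∧ V (x, q) = true :: s) ∧
      ∀ x, (M.acc x).Subsingleton → ∀ q q' : Str, q.length = K.eval x.length →
        q'.length = K.eval x.length → (V (x, q)).headD false = true →
        (V (x, q')).headD false = true → q = q' := by
  obtain ⟨t, ht⟩ := hM.length_le
  obtain ⟨V, hV, hV1, hV2⟩ := exists_pt_outputs hM
  have key : ∀ x q, (if decide (q = List.replicate q.length false) then [false] else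
      V (x, strip q)).headD false = true → q ≠ List.replicate q.length false ∧
        strip q ∈ M.acc x := by
    intro x q h
    by_cases hq : q = List.replicate q.length false
    · rw [if_pos (decide_eq_true hq)] at h
      simp at h
    · rw [if_neg (by simpa using hq)] at h
      refine ⟨hq, ?_⟩
      by_contra hn
      rw [hV2 x _ hn] at h
      simp at h
  -- A path `w` is represented by `0…01w`, and `t + 1` leaves room for the marker. Every string of
  -- this length except the zero string represents one candidate path.
  refine ⟨t + 1, fun a => if decide (a.2 = List.replicate a.2.length false) then [false] else
    V (a.1, strip a.2), ?_, ?_, ?_, ?_⟩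
  · exact (pt_snd.decide_eq (pt_snd.replicate false)).ite (pt_const _)
      (hV.comp (pt_fst.pair pt_snd.strip))
  · intro x w s h
    have hw := ht x w (by
      obtain ⟨c, hc, -⟩ := h
      exact ⟨c, hc⟩)
    refine ⟨List.replicate (t.eval x.length - w.length) false ++ true :: w, ?_, ?_⟩
    · simp; omega
    · dsimp only
      rw [if_neg, strip_zeros_append]
      · exact hV1 x w s h
      · rw [decide_eq_true_iff]
        intro e
        have : true ∈ List.replicate (t.eval x.length - w.length) false ++ true :: w := by simp
        rw [e] at this
        simp at this
  · intro x q h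
    obtain ⟨hq, hacc⟩ := key x q h
    obtain ⟨s, hs⟩ := NTM.mem_acc_iff.mp hacc
    refine ⟨_, s, hs, ?_⟩
    dsimp only
    rw [if_neg (by simpa using hq)]
    exact hV1 x _ s hs
  · intro x hsub q q' hl hl' h h'
    obtain ⟨h1, h2⟩ := key x q h
    obtain ⟨h1', h2'⟩ := key x q' h'
    exact strip_inj (hl.trans hl'.symm) h1 h1' (hsub h2 h2')

/-- `V` is a polynomial-time predicate for unique certificates of fixed length. -/
structure IsVerifier (k : ℕ → ℕ) (κ : Str → Str) (V : Str × Str → Bool) : Prop where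
  isPoly : IsPoly k
  pt_clock : PT κ
  pt : PT V
  length_clock : ∀ x, (κ x).length = k x.length
  unique : ∀ x, ∀ v w : Str, v.length = k x.length → w.length = k x.length →
    V (x, v) = true → V (x, w) = true → v = w

/-- Certificates get a length that depends only on the length of the input, so that they can be
concatenated with other strings and cut off again at a known position. -/
theorem mem_up_iff {L : Set Str} : L ∈ UP ↔ ∃ k κ V, IsVerifier k κ V ∧
    ∀ x, x ∈ L ↔ ∃ w : Str, w.length = k x.length ∧ V (x, w) = true := by
  constructor
  · rintro ⟨M, hM, hsub, hL⟩
    obtain ⟨K, V, hV, h1, h2, h3⟩ := exists_path_cert hM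
    refine ⟨fun n => K.eval n, fun x => List.replicate (K.eval x.length) false,
      fun a => (V a).headD false, ⟨isPoly_eval K, pt_id.clock K, hV.head, fun x => by simp,
        fun x v w hv hw => h3 x (hsub x) v w hv hw⟩, fun x => ?_⟩
    rw [hL]
    constructor
    · rintro ⟨w, hw⟩
      obtain ⟨s, hs⟩ := NTM.mem_acc_iff.mp hw
      obtain ⟨q, hq, hVq⟩ := h1 x w s hs
      exact ⟨q, hq, by simp [hVq]⟩
    · rintro ⟨q, -, hq⟩
      obtain ⟨w, s, hs, -⟩ := h2 x q hq
      exact ⟨w, NTM.mem_acc_iff.mpr ⟨s, hs⟩⟩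
  · rintro ⟨k, κ, V, h, hL⟩
    obtain ⟨M, hM, -, hacc⟩ := exists_ntm h.pt_clock h.pt
    refine ⟨M, hM, fun x v hv w hw => ?_, fun x => ?_⟩
    · rw [hacc, h.length_clock] at hv hw
      exact h.unique x v w hv.1 hw.1 hv.2 hw.2
    · rw [hL, hacc, h.length_clock]
      rfl

/-- A function is given by clusters with respect to orders that depend on unique certificates. -/
structure CertForm (f : Str → ℕ) where
  k : ℕ → ℕ
  κ : Str → Str
  V : Str × Str → Bool
  isVerifier : IsVerifier k κ V
  p : ℕ → ℕ
  π : Str → Str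
  isPoly : IsPoly p
  pt_clock : PT π
  length_clock : ∀ x, (π x).length = p x.length
  O : POrd (Str × Str)
  A : (Str × Str) × Str → Bool
  pt : PT A
  q : Str → Str
  r : Str → Str → ℕ
  s : Str → ℕ
  length_q : ∀ x, (q x).length = k x.length
  valid : ∀ x, V (x, q x) = true
  cluster : ∀ x, IsCluster O A (x, q x) (p x.length) (f x) (r x) (s x)

/-- The certificate becomes a prefix that selects a block. Only the block of the valid certificate
carries the order `O` and contains accepted strings; behind any other prefix `O` need not be an
order at all, so the lexicographical one is used there. The cluster is shifted by the number of
strings in the preceding blocks. -/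
theorem CertForm.mem {f : Str → ℕ} (C : CertForm f) : f ∈ CLUSharpP := by
  classical
  have hc : PT fun a : Str × Str => C.κ a.1 := C.isVerifier.pt_clock.comp pt_fst
  have hπ : PT fun a : Str × Str => C.π a.1 := C.pt_clock.comp pt_fst
  refine mem_cluSharpP_iff.mpr ⟨fun n => C.k n + C.p n,
    .prod C.κ C.isVerifier.pt_clock (.cond C.V C.isVerifier.pt C.O (.lex _ hπ)),
    fun a => C.V (a.1, a.2.take (C.κ a.1).length) &&
      C.A ((a.1, a.2.take (C.κ a.1).length), a.2.drop (C.κ a.1).length),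
    C.isVerifier.isPoly.add C.isPoly, ?_, fun x => ?_⟩
  · have h1 := pt_fst.pair (hc.take pt_snd)
    exact (C.isVerifier.pt.comp h1).and (C.pt.comp (h1.pair (hc.drop pt_snd)))
  have hK := C.isVerifier.length_clock x
  have hcl := C.cluster x
  set K := C.k x.length with hKdef
  set N := C.p x.length with hNdef
  have huniq : ∀ q' : Str, q'.length = K → (C.V (x, q') = true ↔ q' = C.q x) := fun q' hq' =>
    ⟨fun h => C.isVerifier.unique x _ _ hq' (C.length_q x) h (C.valid x),
      fun h => h ▸ C.valid x⟩
  refine ⟨_, val (C.q x) * 2 ^ N + C.s x, POrd.Ranks.prod (N := N)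
    (ρ := fun q' => if q' = C.q x then C.r x else val) C.isVerifier.pt_clock hK
    fun q' hq' => ?_, ?_, ?_⟩
  · by_cases h : q' = C.q x
    · rw [if_pos h, h]
      exact hcl.ranks.cond_true (C.valid x)
    · rw [if_neg h]
      refine (POrd.ranks_lex hπ (C.length_clock x)).cond_false ?_
      rw [Bool.eq_false_iff, Ne, huniq q' hq']
      exact h
  · have h1 := val_lt (C.q x)
    rw [C.length_q x] at h1
    have h2 : (val (C.q x) + 1) * 2 ^ N ≤ 2 ^ K * 2 ^ N := Nat.mul_le_mul_right _ h1
    have h3 := hcl.le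
    rw [Nat.succ_mul] at h2
    change _ ≤ 2 ^ (K + N)
    rw [pow_add]
    omega
  · intro w (hw : w.length = K + N)
    have tw : (w.take K).length = K := by simp [hw]
    have dw : (w.drop K).length = N := by simp [hw]
    have h3 := hcl.le
    rw [hK, Bool.and_eq_true, huniq _ tw]
    by_cases h : w.take K = C.q x
    · rw [if_pos h, h, hcl.mem_iff _ dw, eq_self_iff_true, true_and]
      omega
    · rw [if_neg h]
      have hne : val (w.take K) ≠ val (C.q x) := fun e =>
        h (val_inj (tw.trans (C.length_q x).symm) e)
      have h4 := val_lt (w.drop K)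
      rw [dw] at h4
      refine iff_of_false (fun h' => h h'.1) ?_
      -- A different block lies entirely before or entirely after the one that contains the cluster.
      rcases lt_or_gt_of_ne hne with hlt | hlt
      · have := Nat.mul_le_mul_right (2 ^ N) hlt
        rw [Nat.succ_mul] at this
        omega
      · have := Nat.mul_le_mul_right (2 ^ N) hlt
        rw [Nat.succ_mul] at this
        omega

/-! ### The last element of a cluster -/

section Last

variable {α : Type} [Enc α]

/-- The string `u` is the last element of the cluster, and `z` is its cyclic successor. -/
def lastb (O : POrd α) (A : α × Str → Bool) (p : α × Str × Str) : Bool :=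
  O.cyc p && (A (p.1, p.2.1) && (decide (p.2.1 = O.top p.1) || !A (p.1, p.2.2)))

theorem pt_lastb (O : POrd α) {A : α × Str → Bool} (hA : PT A) : PT (lastb O A) :=
  O.pt_cyc.and ((hA.comp (pt_fst.pair pt_snd.fst)).and
    ((pt_snd.fst.decide_eq (O.pt_top.comp pt_fst)).or (hA.comp (pt_fst.pair pt_snd.snd)).not))

/-- The string `u` is the first element of the cluster, and `y` is its cyclic predecessor. -/
def firstb (O : POrd α) (A : α × Str → Bool) (p : α × Str × Str) : Bool :=
  O.cyc p && (A (p.1, p.2.2) && (decide (p.2.2 = O.bot p.1) || !A (p.1, p.2.1)))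

theorem pt_firstb (O : POrd α) {A : α × Str → Bool} (hA : PT A) : PT (firstb O A) :=
  O.pt_cyc.and ((hA.comp (pt_fst.pair pt_snd.snd)).and
    ((pt_snd.snd.decide_eq (O.pt_bot.comp pt_fst)).or (hA.comp (pt_fst.pair pt_snd.fst)).not))

variable {O : POrd α} {A : α × Str → Bool} {a : α} {N n : ℕ} {r : Str → ℕ} {s : ℕ}

/-- If the cluster reaches the greatest string, the cyclic successor is the least one, which belongs
to the cluster when this starts at rank 0. Hence the test accepts the greatest string without
looking at its neighbour. -/
theorem IsCluster.lastb_iff (h : IsCluster O A a N n r s) {u z : Str} (hu : u.length = N)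
    (hz : z.length = N) : lastb O A (a, u, z) = true ↔ 0 < n ∧ r u + 1 = s + n ∧
      ((s + n = 2 ^ N ∧ r z = 0) ∨ (s + n < 2 ^ N ∧ r z = s + n)) := by
  have h1 := h.le
  have h2 := h.ranks.lt u hu
  have h3 := h.ranks.lt z hz
  rw [lastb, Bool.and_eq_true, Bool.and_eq_true, Bool.or_eq_true, decide_eq_true_iff,
    h.ranks.cyc_iff hu hz, h.mem_iff u hu, h.ranks.eq_top_iff hu, Bool.not_eq_true',
    ← Bool.not_eq_true, h.mem_iff z hz]
  omega

theorem IsCluster.firstb_iff (h : IsCluster O A a N n r s) {y u : Str} (hy : y.length = N)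
    (hu : u.length = N) : firstb O A (a, y, u) = true ↔ 0 < n ∧ r u = s ∧
      ((s = 0 ∧ r y + 1 = 2 ^ N) ∨ (0 < s ∧ r y + 1 = s)) := by
  have h1 := h.le
  have h2 := h.ranks.lt u hu
  have h3 := h.ranks.lt y hy
  rw [firstb, Bool.and_eq_true, Bool.and_eq_true, Bool.or_eq_true, decide_eq_true_iff,
    h.ranks.cyc_iff hy hu, h.mem_iff u hu, h.ranks.eq_bot_iff hu, Bool.not_eq_true',
    ← Bool.not_eq_true, h.mem_iff y hy]
  omega

theorem IsCluster.lastb_unique (h : IsCluster O A a N n r s) {u z u' z' : Str} (hu : u.length = N)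
    (hz : z.length = N) (hu' : u'.length = N) (hz' : z'.length = N)
    (e : lastb O A (a, u, z) = true) (e' : lastb O A (a, u', z') = true) : u = u' ∧ z = z' := by
  rw [h.lastb_iff hu hz] at e
  rw [h.lastb_iff hu' hz'] at e'
  exact ⟨h.ranks.inj _ _ hu hu' (by omega), h.ranks.inj _ _ hz hz' (by omega)⟩

theorem IsCluster.firstb_unique (h : IsCluster O A a N n r s) {u z u' z' : Str} (hu : u.length = N)
    (hz : z.length = N) (hu' : u'.length = N) (hz' : z'.length = N)
    (e : firstb O A (a, u, z) = true) (e' : firstb O A (a, u', z') = true) : u = u' ∧ z = z' := by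
  rw [h.firstb_iff hu hz] at e
  rw [h.firstb_iff hu' hz'] at e'
  exact ⟨h.ranks.inj _ _ hu hu' (by omega), h.ranks.inj _ _ hz hz' (by omega)⟩

theorem IsCluster.exists_lastb (h : IsCluster O A a N n r s) (hn : n ≠ 0) :
    ∃ u z : Str, u.length = N ∧ z.length = N ∧ lastb O A (a, u, z) = true := by
  have h1 := h.le
  obtain ⟨u, hu, eu⟩ := h.ranks.surj (k := s + n - 1) (by omega)
  obtain ⟨z, hz, ez⟩ := h.ranks.surj (k := if s + n = 2 ^ N then 0 else s + n)
    (by split_ifs <;> omega)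
  refine ⟨u, z, hu, hz, (h.lastb_iff hu hz).mpr ?_⟩
  rw [eu, ez]
  split_ifs <;> omega

theorem IsCluster.exists_firstb (h : IsCluster O A a N n r s) (hn : n ≠ 0) :
    ∃ y u : Str, y.length = N ∧ u.length = N ∧ firstb O A (a, y, u) = true := by
  have h1 := h.le
  obtain ⟨u, hu, eu⟩ := h.ranks.surj (k := s) (by omega)
  obtain ⟨y, hy, ey⟩ := h.ranks.surj (k := if s = 0 then 2 ^ N - 1 else s - 1)
    (by split_ifs <;> omega)
  refine ⟨y, u, hy, hu, (h.firstb_iff hy hu).mpr ?_⟩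
  rw [eu, ey]
  split_ifs <;> omega

end Last

/-- A cluster has a last element exactly if it is not empty, and then only one. This element
followed by its cyclic successor is the certificate, and both are checked locally. -/
theorem support_mem_up {f : Str → ℕ} (hf : f ∈ CLUSharpP) : {x | f x ≠ 0} ∈ UP := by
  obtain ⟨p, O, A, hp, hA, H⟩ := mem_cluSharpP_iff.mp hf
  choose r s H using H
  have hb : ∀ x, (O.bot x).length = p x.length := fun x => (H x).ranks.length_bot
  have k : PT fun a : Str × Str => O.bot a.1 := O.pt_bot.comp pt_fst
  refine mem_up_iff.mpr ⟨fun n => p n + p n, fun x => O.bot x ++ O.bot x,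
    fun a => lastb O A (a.1, a.2.take (O.bot a.1).length, a.2.drop (O.bot a.1).length),
    ⟨hp.add hp, O.pt_bot.append O.pt_bot,
      (pt_lastb O hA).comp (pt_fst.pair ((k.take pt_snd).pair (k.drop pt_snd))),
      fun x => by simp [hb], fun x v w hv hw h h' => ?_⟩, fun x => ⟨fun hx => ?_, ?_⟩⟩
  · rw [hb] at h h'
    obtain ⟨h1, h2⟩ := (H x).lastb_unique (by simp [hv]) (by simp [hv]) (by simp [hw])
      (by simp [hw]) h h'
    rw [← List.take_append_drop (p x.length) v, h1, h2, List.take_append_drop]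
  · obtain ⟨u, z, hu, hz, h⟩ := (H x).exists_lastb hx
    refine ⟨u ++ z, by simp [hu, hz], ?_⟩
    dsimp only
    rw [hb, List.take_left' hu, List.drop_left' hu]
    exact h
  · rintro ⟨w, hw, h⟩
    dsimp only at h
    rw [hb, (H x).lastb_iff (by simp [hw]) (by simp [hw])] at h
    exact h.1.ne'

/-- The incremented characteristic function of `L` has a cluster of one or two elements, but never
an empty one. A string that is both first and last exists in the first case only, that is, outside
`L`. -/
theorem up_eq_coUP_of_increment (h : ∀ f ∈ CLUSharpP, (fun x => f x + 1) ∈ CLUSharpP) :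
    UP = coUP := by
  have key : ∀ L ∈ UP, Lᶜ ∈ UP := by
    intro L hL
    classical
    obtain ⟨k, κ, V, hV, hLV⟩ := mem_up_iff.mp hL
    have hχ : (fun x => if x ∈ L then 1 else 0) ∈ CLUSharpP := by
      refine mem_cluSharpP_iff.mpr ⟨k, .lex κ hV.pt_clock, V, hV.isPoly, hV.pt, fun x => ?_⟩
      have hr : (POrd.lex κ hV.pt_clock).Ranks x (k x.length) val :=
        POrd.ranks_lex _ (hV.length_clock x)
      by_cases hx : x ∈ L
      · obtain ⟨q, hq, hVq⟩ := (hLV x).mp hx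
        have h1 := val_lt q
        rw [hq] at h1
        refine ⟨val, val q, hr, by rw [if_pos hx]; exact h1, fun w hw => ?_⟩
        rw [if_pos hx]
        refine ⟨fun h' => ?_, fun h' => ?_⟩
        · rw [hV.unique x w q hw hq h' hVq]
          omega
        · rw [val_inj (hw.trans hq.symm) (show val w = val q by omega)]
          exact hVq
      · refine ⟨val, 0, hr, by rw [if_neg hx]; exact Nat.zero_le _, fun w hw => ?_⟩
        rw [if_neg hx]
        exact iff_of_false (fun h' => hx ((hLV x).mpr ⟨w, hw, h'⟩)) (by omega)
    obtain ⟨p, O, A, hp, hA, H⟩ := mem_cluSharpP_iff.mp (h _ hχ)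
    choose r s H using H
    have hb : ∀ x, (O.bot x).length = p x.length := fun x => (H x).ranks.length_bot
    have c : PT fun a : Str × Str => O.bot a.1 := O.pt_bot.comp pt_fst
    have y := c.take (pt_snd (α := Str))
    have u := c.take (c.drop (pt_snd (α := Str)))
    have z := c.drop (c.drop (pt_snd (α := Str)))
    -- A certificate consists of `y`, `u` and `z`, where `u` is the first element with cyclic
    -- predecessor `y` and also the last one with cyclic successor `z`.
    refine mem_up_iff.mpr ⟨fun n => p n + (p n + p n), fun x => O.bot x ++ (O.bot x ++ O.bot x), _,
      ⟨hp.add (hp.add hp), O.pt_bot.append (O.pt_bot.append O.pt_bot),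
        ((pt_firstb O hA).comp (pt_fst.pair (y.pair u))).and
          ((pt_lastb O hA).comp (pt_fst.pair (u.pair z))),
        fun x => by simp [hb], fun x v w hv hw e e' => ?_⟩, fun x => ⟨fun hx => ?_, ?_⟩⟩
    · simp only [hb, Bool.and_eq_true] at e e'
      obtain ⟨h1, h2⟩ := (H x).firstb_unique (by simp [hv]) (by simp [hv]) (by simp [hw])
        (by simp [hw]) e.1 e'.1
      obtain ⟨-, h3⟩ := (H x).lastb_unique (by simp [hv]) (by simp [hv]) (by simp [hw])
        (by simp [hw]) e.2 e'.2
      rw [← List.take_append_drop (p x.length) v, ← List.take_append_drop (p x.length) (v.drop _),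
        h1, h2, h3, List.take_append_drop, List.take_append_drop]
    · have hx' : x ∉ L := hx
      have Hx := H x
      rw [if_neg hx'] at Hx
      obtain ⟨y, u, hy, hu, e⟩ := Hx.exists_firstb (by omega)
      obtain ⟨u', z, hu', hz, e'⟩ := Hx.exists_lastb (by omega)
      have : u' = u := by
        have h1 := (Hx.firstb_iff hy hu).mp e
        have h2 := (Hx.lastb_iff hu' hz).mp e'
        exact Hx.ranks.inj _ _ hu' hu (by omega)
      subst this
      refine ⟨y ++ (u' ++ z), by simp [hy, hu', hz], ?_⟩
      simp only [hb, List.take_left' hy, List.drop_left' hy, List.take_left' hu',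
        List.drop_left' hu', e, e', Bool.and_self]
    · rintro ⟨w, hw, e⟩ hx
      simp only [hb, Bool.and_eq_true] at e
      obtain ⟨e, e'⟩ := e
      rw [(H x).firstb_iff (by simp [hw]) (by simp [hw])] at e
      -- For `x` in `L` the cluster has length 2, so `u` would have both the rank `s` and the rank
      -- `s + 1`.
      rw [(H x).lastb_iff (by simp [hw]) (by simp [hw]), if_pos hx] at e'
      omega
  ext L
  exact ⟨key L, fun h' => by simpa using key _ h'⟩

end

section

open Frag
open Enc (enc)

/-! ### Sums of cluster functions -/

/-- If `UP = coUP`, then every cluster function can be given by final segments of orders that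
depend on unique certificates. -/
theorem exists_certForm_final (hup : UP = coUP) {f : Str → ℕ} (hf : f ∈ CLUSharpP) :
    ∃ C : CertForm f, ∀ x, C.s x + f x = 2 ^ C.p x.length := by
  have hco : {x | f x ≠ 0}ᶜ ∈ UP := by
    have := support_mem_up hf
    rw [hup] at this
    exact this
  obtain ⟨k, κ, V, hV, hVf⟩ := mem_up_iff.mp hco
  have hVf : ∀ x, f x = 0 ↔ ∃ w : Str, w.length = k x.length ∧ V (x, w) = true := fun x => by
    rw [← hVf]; simp
  obtain ⟨p, O, A, hp, hA, H⟩ := mem_cluSharpP_iff.mp hf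
  choose r s H using H
  have hb : ∀ x, (O.bot x).length = p x.length := fun x => (H x).ranks.length_bot
  have ht : ∀ x, (O.top x).length = p x.length := fun x => (H x).ranks.length_top
  -- A certificate is a bit `b` followed by `u`, `z` and `w`. If `b` is 1, then `u` is the last
  -- element with cyclic successor `z`, and `w` is zero. If `b` is 0, then `w` certifies that the
  -- cluster is empty, and `u`, `z` are the greatest and the least string. Filling the idle parts
  -- with fixed values keeps the certificate unique.
  set b : Str × Str → Bool := fun a => a.2.headD false with hbdef
  set u : Str × Str → Str := fun a => a.2.tail.take (O.bot a.1).length with hudef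
  set z : Str × Str → Str := fun a =>
    (a.2.tail.drop (O.bot a.1).length).take (O.bot a.1).length with hzdef
  set w : Str × Str → Str := fun a =>
    (a.2.tail.drop (O.bot a.1).length).drop (O.bot a.1).length with hwdef
  have pc : PT fun a : Str × Str => O.bot a.1 := O.pt_bot.comp pt_fst
  have pb : PT b := pt_snd.head
  have pu : PT u := pc.take pt_snd.tail
  have pz : PT z := pc.take (pc.drop pt_snd.tail)
  have pw : PT w := pc.drop (pc.drop pt_snd.tail)
  set W : Str × Str → Bool := fun a =>
    if b a then lastb O A (a.1, u a, z a) && decide (w a = List.replicate (w a).length false)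
    else decide (u a = O.top a.1) && (decide (z a = O.bot a.1) && V (a.1, w a)) with hWdef
  have pW : PT W := pb.ite (((pt_lastb O hA).comp (pt_fst.pair (pu.pair pz))).and
      (pw.decide_eq (pw.replicate false)))
    ((pu.decide_eq (O.pt_top.comp pt_fst)).and ((pz.decide_eq pc).and (hV.pt.comp (pt_fst.pair pw))))
  have parts : ∀ (x : Str) (c : Bool) (u' z' w' : Str), u'.length = p x.length →
      z'.length = p x.length → b (x, c :: (u' ++ (z' ++ w'))) = c ∧
        u (x, c :: (u' ++ (z' ++ w'))) = u' ∧ z (x, c :: (u' ++ (z' ++ w'))) = z' ∧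
        w (x, c :: (u' ++ (z' ++ w'))) = w' := by
    intro x c u' z' w' hu' hz'
    refine ⟨rfl, ?_, ?_, ?_⟩
    · simp only [hudef, hb, List.tail_cons, List.take_left' hu']
    · simp only [hzdef, hb, List.tail_cons, List.drop_left' hu', List.take_left' hz']
    · simp only [hwdef, hb, List.tail_cons, List.drop_left' hu', List.drop_left' hz']
  have split : ∀ (x v : Str), v.length = 1 + (p x.length + (p x.length + k x.length)) →
      v = b (x, v) :: (u (x, v) ++ (z (x, v) ++ w (x, v))) ∧ (u (x, v)).length = p x.length ∧
        (z (x, v)).length = p x.length ∧ (w (x, v)).length = k x.length := by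
    intro x v hv
    cases v with
    | nil => rw [List.length_nil] at hv; omega
    | cons c v =>
      rw [List.length_cons] at hv
      refine ⟨?_, ?_, ?_, ?_⟩
      · simp only [hbdef, hudef, hzdef, hwdef, List.tail_cons, List.take_append_drop]
        rfl
      · simp only [hudef, hb, List.tail_cons, List.length_take]; omega
      · simp only [hzdef, hb, List.tail_cons, List.length_take, List.length_drop]; omega
      · simp only [hwdef, hb, List.tail_cons, List.length_drop]; omega
  have hver : IsVerifier (fun n => 1 + (p n + (p n + k n)))
      (fun x => [false] ++ (O.bot x ++ (O.bot x ++ κ x))) W := by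
    refine ⟨(isPoly_const 1).add (hp.add (hp.add hV.isPoly)), (pt_const _).append
      (O.pt_bot.append (O.pt_bot.append hV.pt_clock)), pW,
      fun x => by simp [hb, hV.length_clock]; omega, fun x v v' hv hv' e e' => ?_⟩
    obtain ⟨h0, h1, h2, h3⟩ := split x v hv
    obtain ⟨h0', h1', h2', h3'⟩ := split x v' hv'
    simp only [hWdef] at e e'
    -- Both kinds of certificate are sound, so the value of `f` dictates the leading bit.
    have hbb : b (x, v) = true ↔ f x ≠ 0 := by
      constructor
      · intro h
        rw [if_pos h, Bool.and_eq_true, (H x).lastb_iff h1 h2] at e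
        omega
      · intro h
        by_contra hn
        rw [if_neg hn, Bool.and_eq_true, Bool.and_eq_true] at e
        exact h ((hVf x).mpr ⟨_, h3, e.2.2⟩)
    have hbb' : b (x, v') = true ↔ f x ≠ 0 := by
      constructor
      · intro h
        rw [if_pos h, Bool.and_eq_true, (H x).lastb_iff h1' h2'] at e'
        omega
      · intro h
        by_contra hn
        rw [if_neg hn, Bool.and_eq_true, Bool.and_eq_true] at e'
        exact h ((hVf x).mpr ⟨_, h3', e'.2.2⟩)
    have hbe : b (x, v) = b (x, v') := by rw [Bool.eq_iff_iff, hbb, hbb']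
    by_cases h : b (x, v) = true
    · rw [if_pos h, Bool.and_eq_true, decide_eq_true_iff, h3] at e
      rw [if_pos (hbe ▸ h), Bool.and_eq_true, decide_eq_true_iff, h3'] at e'
      obtain ⟨hu, hz⟩ := (H x).lastb_unique h1 h2 h1' h2' e.1 e'.1
      rw [h0, h0', hbe, hu, hz, e.2, e'.2]
    · rw [if_neg h] at e
      rw [if_neg (hbe ▸ h)] at e'
      simp only [Bool.and_eq_true, decide_eq_true_iff] at e e'
      rw [h0, h0', hbe, e.1, e'.1, e.2.1, e'.2.1, hV.unique x _ _ h3 h3' e.2.2 e'.2.2]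
  have hex : ∀ x, ∃ q : Str, q.length = 1 + (p x.length + (p x.length + k x.length)) ∧
      W (x, q) = true := by
    intro x
    by_cases h : f x = 0
    · obtain ⟨w', hw', hVw⟩ := (hVf x).mp h
      obtain ⟨e1, e2, e3, e4⟩ := parts x false (O.top x) (O.bot x) w' (ht x) (hb x)
      refine ⟨false :: (O.top x ++ (O.bot x ++ w')), by simp [ht, hb, hw']; omega, ?_⟩
      simp only [hWdef, e1, e2, e3, e4]
      simp [hVw]
    · obtain ⟨u', z', hu', hz', hl⟩ := (H x).exists_lastb h
      obtain ⟨e1, e2, e3, e4⟩ := parts x true u' z' (List.replicate (k x.length) false) hu' hz'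
      refine ⟨true :: (u' ++ (z' ++ List.replicate (k x.length) false)),
        by simp [hu', hz']; omega, ?_⟩
      simp only [hWdef, e1, e2, e3, e4]
      simp [hl]
  choose q hq hWq using hex
  -- In the order rotated to start with `z` and end with `u`, the cluster occupies the last ranks.
  have hcl : ∀ x, ∃ r' s', IsCluster ((O.comap Prod.fst pt_fst).rot z u pz pu)
      (fun a => b a.1 && A (a.1.1, a.2)) (x, q x) (p x.length) (f x) r' s' ∧
        s' + f x = 2 ^ p x.length := by
    intro x
    obtain ⟨h0, h1, h2, h3⟩ := split x (q x) (hq x)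
    have e := hWq x
    simp only [hWdef] at e
    have hO : (O.comap Prod.fst pt_fst).Ranks (x, q x) (p x.length) (r x) :=
      (H x).ranks.comap pt_fst
    have hle := (H x).le
    by_cases h : b (x, q x) = true
    · rw [if_pos h, Bool.and_eq_true] at e
      have hc : O.cyc (x, u (x, q x), z (x, q x)) = true := by
        have := e.1
        rw [lastb, Bool.and_eq_true] at this
        exact this.1
      have e1 := ((H x).lastb_iff h1 h2).mp e.1
      refine ⟨_, 2 ^ p x.length - f x, ⟨hO.rot pz pu h2 h1 hc, by omega, fun v hv => ?_⟩,
        by omega⟩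
      have h4 := (H x).ranks.lt v hv
      simp only [h, Bool.true_and]
      rw [(H x).mem_iff v hv]
      split_ifs <;> omega
    · rw [if_neg h] at e
      simp only [Bool.and_eq_true, decide_eq_true_iff] at e
      have hc : O.cyc (x, u (x, q x), z (x, q x)) = true := by
        rw [e.1, e.2.1]
        simp [POrd.cyc]
      have hf0 : f x = 0 := (hVf x).mpr ⟨_, h3, e.2.2⟩
      have hR := hO.rot pz pu h2 h1 hc
      -- The empty cluster is placed behind the last rank, so that it counts as a final segment as
      -- well.
      refine ⟨_, 2 ^ p x.length, ⟨hR, by omega, fun v hv => ?_⟩, by omega⟩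
      have h4 := hR.lt v hv
      rw [hf0]
      exact iff_of_false (by simp [h]) (by omega)
  choose r' s' hcl hs using hcl
  exact ⟨⟨_, _, W, hver, p, O.bot, hp, O.pt_bot, hb, _, _,
    (pb.comp pt_fst).and (hA.comp (pt_fst.fst.pair pt_snd)), q, r', s', hq, hWq, hcl⟩, hs⟩

/-- A leading bit separates two halves. The order of `f` fills the lower half and the reversed order
of `g` the upper one, so the final segment of `f` ends where the initial segment for `g` begins, and
their union is an interval of length `f x + g x`. Both certificates together form the certificate of
the sum. -/
theorem add_mem_of_final {f g : Str → ℕ} (C : CertForm f) (D : CertForm g)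
    (hC : ∀ x, C.s x + f x = 2 ^ C.p x.length) (hD : ∀ x, D.s x + g x = 2 ^ D.p x.length) :
    (fun x => f x + g x) ∈ CLUSharpP := by
  have pκ : PT fun a : Str × Str => C.κ a.1 := C.isVerifier.pt_clock.comp pt_fst
  set q₁ : Str × Str → Str × Str := fun a => (a.1, a.2.take (C.κ a.1).length) with hq₁
  set q₂ : Str × Str → Str × Str := fun a => (a.1, a.2.drop (C.κ a.1).length) with hq₂
  have p₁ : PT q₁ := pt_fst.pair (pκ.take pt_snd)
  have p₂ : PT q₂ := pt_fst.pair (pκ.drop pt_snd)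
  have pπ₁ : PT fun a : (Str × Str) × Str => C.π a.1.1 := C.pt_clock.comp pt_fst.fst
  have pπ₂ : PT fun a : (Str × Str) × Str => D.π a.1.1 := D.pt_clock.comp pt_fst.fst
  have g₁ : PT fun a : ((Str × Str) × Str) × Str => q₁ a.1.1 := p₁.comp pt_fst.fst
  have g₂ : PT fun a : ((Str × Str) × Str) × Str => q₂ a.1.1 := p₂.comp pt_fst.fst
  have pb : PT fun a : (Str × Str) × Str => a.2.headD false := pt_snd.head
  have hver : IsVerifier (fun n => C.k n + D.k n) (fun x => C.κ x ++ D.κ x)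
      (fun a => C.V (q₁ a) && D.V (q₂ a)) := by
    refine ⟨C.isVerifier.isPoly.add D.isVerifier.isPoly,
      C.isVerifier.pt_clock.append D.isVerifier.pt_clock,
      (C.isVerifier.pt.comp p₁).and (D.isVerifier.pt.comp p₂),
      fun x => by simp [C.isVerifier.length_clock, D.isVerifier.length_clock],
      fun x v w hv hw e e' => ?_⟩
    simp only [hq₁, hq₂, C.isVerifier.length_clock, Bool.and_eq_true] at e e'
    have h1 := C.isVerifier.unique x _ _ (by simp [hv]) (by simp [hw]) e.1 e'.1
    have h2 := D.isVerifier.unique x _ _ (by simp [hv]) (by simp [hw]) e.2 e'.2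
    rw [← List.take_append_drop (C.k x.length) v, h1, h2, List.take_append_drop]
  have e₁ : ∀ x, q₁ (x, C.q x ++ D.q x) = (x, C.q x) := fun x => by
    simp only [hq₁, C.isVerifier.length_clock, List.take_left' (C.length_q x)]
  have e₂ : ∀ x, q₂ (x, C.q x ++ D.q x) = (x, D.q x) := fun x => by
    simp only [hq₂, C.isVerifier.length_clock, List.drop_left' (C.length_q x)]
  -- The two orders live on different lengths, so each is repeated once for each padding prefix of
  -- the other length. Accepted strings occur only in the last copy of the first order (prefix of
  -- ones) and in the first copy of the second (prefix of zeros), next to the border of the halves.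
  set I₁ : POrd ((Str × Str) × Str) := .prod _ pπ₂ (C.O.comap _ g₁) with hI₁
  set I₂ : POrd ((Str × Str) × Str) := .prod _ pπ₁ (D.O.rev.comap _ g₂) with hI₂
  set A : (Str × Str) × Str → Bool := fun a =>
    if a.2.headD false then
      decide (a.2.tail.take (C.π a.1.1).length = List.replicate (C.π a.1.1).length false) &&
        D.A (q₂ a.1, a.2.tail.drop (C.π a.1.1).length)
    else decide (a.2.tail.take (D.π a.1.1).length = List.replicate (D.π a.1.1).length true) &&
        C.A (q₁ a.1, a.2.tail.drop (D.π a.1.1).length) with hA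
  have pA : PT A := pb.ite
    (((pπ₁.take pt_snd.tail).decide_eq (pπ₁.replicate false)).and
      (D.pt.comp ((p₂.comp pt_fst).pair (pπ₁.drop pt_snd.tail))))
    (((pπ₂.take pt_snd.tail).decide_eq (pπ₂.replicate true)).and
      (C.pt.comp ((p₁.comp pt_fst).pair (pπ₂.drop pt_snd.tail))))
  have hcl : ∀ x, ∃ r s, IsCluster (.prod (fun _ => [false]) (pt_const _) (.cond _ pb I₂ I₁)) A
      (x, C.q x ++ D.q x) (1 + (C.p x.length + D.p x.length)) (f x + g x) r s := by
    intro x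
    have c₁ := C.cluster x
    have c₂ := D.cluster x
    have l₁ := C.length_clock x
    have l₂ := D.length_clock x
    have s₁ := hC x
    have s₂ := hD x
    rw [← e₁] at c₁
    rw [← e₂] at c₂
    set M := C.p x.length with hM
    set N := D.p x.length with hN
    have R₁ : ∀ b, I₁.Ranks ((x, C.q x ++ D.q x), b) (M + N) fun w =>
        val (w.take N) * 2 ^ M + C.r x (w.drop N) := fun b => by
      rw [Nat.add_comm]
      exact POrd.Ranks.prod pπ₂ (a := ((x, C.q x ++ D.q x), b)) (ρ := fun _ => C.r x) l₂
        fun _ _ => c₁.ranks.comap g₁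
    have R₂ : ∀ b, I₂.Ranks ((x, C.q x ++ D.q x), b) (M + N) fun w =>
        val (w.take M) * 2 ^ N + (2 ^ N - 1 - D.r x (w.drop M)) := fun b =>
      POrd.Ranks.prod pπ₁ (a := ((x, C.q x ++ D.q x), b))
        (ρ := fun _ w => 2 ^ N - 1 - D.r x w) l₁ fun _ _ => c₂.ranks.rev.comap g₂
    -- The upper half starts at rank `2 ^ (M + N)`; the joint cluster begins `f x` ranks earlier.
    refine ⟨_, 2 ^ (M + N) - f x, POrd.Ranks.prod (pt_const _) rfl
      (ρ := fun b w => if b.headD false then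
        val (w.take M) * 2 ^ N + (2 ^ N - 1 - D.r x (w.drop M)) else
        val (w.take N) * 2 ^ M + C.r x (w.drop N)) fun b hb => ?_, ?_, ?_⟩
    · by_cases h : b.headD false = true
      · simp only [h, if_true]
        exact (R₂ b).cond_true h
      · simp only [h]
        exact (R₁ b).cond_false (by simpa using h)
    · have h1 : 2 ^ M * 1 ≤ 2 ^ M * 2 ^ N := Nat.mul_le_mul_left _ Nat.one_le_two_pow
      have h2 : 1 * 2 ^ N ≤ 2 ^ M * 2 ^ N := Nat.mul_le_mul_right _ Nat.one_le_two_pow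
      rw [pow_add 2 1, pow_add 2 M]
      omega
    · intro w hw
      have h1 : 2 ^ M * 1 ≤ 2 ^ M * 2 ^ N := Nat.mul_le_mul_left _ Nat.one_le_two_pow
      have h2 : 1 * 2 ^ N ≤ 2 ^ M * 2 ^ N := Nat.mul_le_mul_right _ Nat.one_le_two_pow
      cases w with
      | nil => rw [List.length_nil] at hw; omega
      | cons b v =>
        have hv : v.length = M + N := by
          rw [List.length_cons] at hw; omega
        have tb : (b :: v).take 1 = [b] := rfl
        have db : (b :: v).drop 1 = v := rfl
        simp only [hA, List.length_singleton, tb, db, List.headD_cons, List.tail_cons, l₁, l₂]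
        cases b
        · have tv : (v.take N).length = N := by simp [hv]
          have dv : (v.drop N).length = M := by simp [hv]
          have h3 := val_lt (v.take N)
          have h4 := c₁.ranks.lt _ dv
          rw [tv] at h3
          have h5 : v.take N = List.replicate N true ↔ val (v.take N) + 1 = 2 ^ N := by
            have h6 := val_ones N
            constructor
            · intro h; rw [h]; omega
            · intro h; exact val_inj (by simp [hv]) (by omega)
          have v0 : val [false] = 0 := rfl
          simp only [Bool.false_eq_true, if_false, Bool.and_eq_true, decide_eq_true_iff, h5,
            c₁.mem_iff _ dv, v0, Nat.zero_mul, Nat.zero_add]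
          have h6 := Nat.mul_le_mul_right (2 ^ M) h3
          rw [Nat.succ_mul, mul_comm (2 ^ N)] at h6
          rw [pow_add]
          constructor
          · rintro ⟨h7, h8, h9⟩
            have h10 : (val (v.take N) + 1) * 2 ^ M = 2 ^ M * 2 ^ N := by rw [h7, mul_comm]
            rw [Nat.succ_mul] at h10
            omega
          · intro h7
            have h8 : val (v.take N) + 1 = 2 ^ N := by
              by_contra hne
              have h9 := Nat.mul_le_mul_right (2 ^ M)
                (show val (v.take N) + 1 + 1 ≤ 2 ^ N by omega)
              rw [Nat.succ_mul, Nat.succ_mul, mul_comm (2 ^ N)] at h9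
              omega
            have h10 : (val (v.take N) + 1) * 2 ^ M = 2 ^ M * 2 ^ N := by rw [h8, mul_comm]
            rw [Nat.succ_mul] at h10
            omega
        · have tv : (v.take M).length = M := by simp [hv]
          have dv : (v.drop M).length = N := by simp [hv]
          have h4 := c₂.ranks.lt _ dv
          have h5 : v.take M = List.replicate M false ↔ val (v.take M) = 0 := by
            have h6 := val_zeros M
            constructor
            · intro h; rw [h, h6]
            · intro h; exact val_inj (by simp [hv]) (h.trans h6.symm)
          have v1 : val [true] = 1 := rfl
          simp only [if_true, Bool.and_eq_true, decide_eq_true_iff, h5, c₂.mem_iff _ dv, v1,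
            Nat.one_mul]
          rw [pow_add]
          rcases Nat.eq_zero_or_pos (val (v.take M)) with h6 | h6
          · rw [h6, Nat.zero_mul]
            omega
          · have := Nat.mul_le_mul_right (2 ^ N) h6
            rw [Nat.succ_mul, Nat.zero_mul] at this
            omega
  choose r s hcl using hcl
  refine CertForm.mem (f := fun x => f x + g x) ⟨_, _, _, hver,
    fun n => 1 + (C.p n + D.p n), fun x => [false] ++ (C.π x ++ D.π x),
    (isPoly_const 1).add (C.isPoly.add D.isPoly), (pt_const _).append (C.pt_clock.append D.pt_clock),
    fun x => by simp [C.length_clock, D.length_clock]; omega, _, A, pA, fun x => C.q x ++ D.q x, r, s,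
    fun x => by simp [C.length_q, D.length_q], fun x => ?_, hcl⟩
  simp only [e₁, e₂, C.valid, D.valid, Bool.and_self]

/-! ### Functions computed by unambiguous machines -/

/-- The encoding of numbers starts with the least significant bit, whereas `val` reads the most
significant bit first. -/
theorem val_reverse_encodePosNum (n : PosNum) :
    val (Computability.encodePosNum n).reverse = n := by
  induction n with
  | one => rfl
  | bit0 n ih =>
    rw [Computability.encodePosNum, List.reverse_cons, val_append, ih]
    simp [val]; ring
  | bit1 n ih =>
    rw [Computability.encodePosNum, List.reverse_cons, val_append, ih]
    simp [val]; ring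

theorem val_reverse_encodeNat (n : ℕ) : val (Computability.encodeNat n).reverse = n := by
  rw [Computability.encodeNat]
  conv_rhs => rw [← Num.to_of_nat n]
  cases (n : Num) with
  | zero => rfl
  | pos n => exact val_reverse_encodePosNum n

/-- Given the code of the unique accepting path, the number `g x` can be computed in polynomial
time. The strings of value less than `g x` are then an initial segment of the lexicographical order,
and `CertForm.mem` absorbs the dependence on the path. -/
theorem upsvt_mem_cluSharpP {g : Str → ℕ} (hg : natValued g ∈ UPSVt) : g ∈ CLUSharpP := by
  obtain ⟨M, hM, H⟩ := hg
  obtain ⟨K, V, pV, h1, h2, h3⟩ := exists_path_cert hM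
  have hout : ∀ x w s, M.Outputs x w s → s = Computability.encodeNat (g x) := by
    intro x w s h
    obtain ⟨s', hs', e⟩ := (H x).2.1 w (NTM.mem_acc_iff.mpr ⟨s, h⟩)
    rw [h.unique hs']
    exact (Option.some.inj e).symm
  have hex : ∀ x, ∃ q : Str, q.length = K.eval x.length ∧
      V (x, q) = true :: Computability.encodeNat (g x) := by
    intro x
    have hne : (M.acc x).Nonempty := by
      by_contra hn
      have := (H x).2.2 (Set.not_nonempty_iff_eq_empty.mp hn)
      simp at this
    obtain ⟨w, hw⟩ := hne
    obtain ⟨s, hs⟩ := NTM.mem_acc_iff.mp hw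
    rw [← hout x w s hs]
    exact h1 x w s hs
  choose q hq hVq using hex
  obtain ⟨P, hP⟩ := pV.pb
  -- `P` bounds the output of `V` in the length of the encoded pair; substituting the length of that
  -- pair gives a bound in the length of `x`.
  set Q : Polynomial ℕ := P.comp (2 * .X + 1 + K) with hQ
  have hlen : ∀ x, (Computability.encodeNat (g x)).length ≤ Q.eval x.length := by
    intro x
    have := hP (x, q x)
    dsimp only at this
    rw [hVq] at this
    simp only [enc_str, enc_pair, List.length_append, length_dbl, List.length_cons, hq] at this
    have e : 2 * x.length + (K.eval x.length + 1) = 2 * x.length + 1 + K.eval x.length := by omega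
    rw [e] at this
    simp only [hQ, Polynomial.eval_comp, Polynomial.eval_add, Polynomial.eval_mul,
      Polynomial.eval_X, Polynomial.eval_ofNat, Polynomial.eval_one]
    omega
  have pπ : PT fun x : Str => List.replicate (Q.eval x.length) false := pt_id.clock Q
  -- Zeros appended to the output become leading zeros after the reversal, so the length is fixed
  -- and the value is `g x`.
  set B : Str × Str → Str := fun a => (((V a).tail ++ List.replicate (Q.eval a.1.length) false).take
    (List.replicate (Q.eval a.1.length) false).length).reverse with hB
  have pB : PT B := ((pπ.comp pt_fst).take (pV.tail.append (pπ.comp pt_fst))).reverse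
  have hB' : ∀ x, (B (x, q x)).length = Q.eval x.length ∧ val (B (x, q x)) = g x := by
    intro x
    have h := hlen x
    refine ⟨by simp [hB], ?_⟩
    simp only [hB, hVq, List.tail_cons, List.length_replicate]
    rw [List.take_append, List.take_of_length_le h, List.take_replicate, List.reverse_append,
      val_append, List.reverse_replicate, val_zeros, Nat.zero_mul, Nat.zero_add,
      val_reverse_encodeNat]
  refine CertForm.mem ⟨fun n => K.eval n, fun x => List.replicate (K.eval x.length) false,
    fun a => (V a).headD false, ⟨isPoly_eval K, pt_id.clock K, pV.head, fun x => by simp,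
      fun x v w hv hw => h3 x (H x).1 v w hv hw⟩, fun n => Q.eval n, _, isPoly_eval Q, pπ,
    fun x => by simp, .lex _ (pπ.comp pt_fst), fun a => ltb a.2 (B a.1), pt_snd.ltb (pB.comp pt_fst),
    q, fun _ => val, fun _ => 0, hq, fun x => by simp [hVq], fun x => ⟨?_, ?_, fun w hw => ?_⟩⟩
  · exact POrd.ranks_lex _ (by simp)
  · have := val_lt (B (x, q x))
    rw [(hB' x).1, (hB' x).2] at this
    omega
  · rw [ltb_iff (hw.trans (hB' x).1.symm), (hB' x).2]
    omega

end

end ClusterComputing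


/-! ### The cycle of implications -/

theorem theoremt :
    List.TFAE [
      ClusterComputing.UP = ClusterComputing.coUP,
      ∀ f ∈ ClusterComputing.CLUSharpP, (fun x => f x + 1) ∈ ClusterComputing.CLUSharpP,
      ∀ f ∈ ClusterComputing.CLUSharpP, ∀ g : ClusterComputing.Str → ℕ,
        ClusterComputing.natValued g ∈ ClusterComputing.FPt →
          (fun x => f x + g x) ∈ ClusterComputing.CLUSharpP,
      ∀ f ∈ ClusterComputing.CLUSharpP, ∀ g : ClusterComputing.Str → ℕ,
        ClusterComputing.natValued g ∈ ClusterComputing.UPSVt →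
          (fun x => f x + g x) ∈ ClusterComputing.CLUSharpP,
      ∀ f ∈ ClusterComputing.CLUSharpP, ∀ g ∈ ClusterComputing.CLUSharpP,
        (fun x => f x + g x) ∈ ClusterComputing.CLUSharpP] := by
  tfae_have 1 → 5 := fun hup f hf g hg => by
    obtain ⟨C, hC⟩ := ClusterComputing.exists_certForm_final hup hf
    obtain ⟨D, hD⟩ := ClusterComputing.exists_certForm_final hup hg
    exact ClusterComputing.add_mem_of_final C D hC hD
  tfae_have 5 → 4 := fun h f hf g hg => h f hf g (ClusterComputing.upsvt_mem_cluSharpP hg)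
  tfae_have 4 → 3 := fun h f hf g hg => h f hf g (ClusterComputing.fpt_subset_upsvt hg)
  -- Membership in `FPt` unfolds to `PT` on strings, and a constant function is polynomial-time
  -- computable.
  tfae_have 3 → 2 := fun h f hf => h f hf (fun _ => 1) 
    (show ClusterComputing.PT fun _ : ClusterComputing.Str => Computability.encodeNat 1 from
      ClusterComputing.pt_const (β := ClusterComputing.Str) _)
  tfae_have 2 → 1 := ClusterComputing.up_eq_coUP_of_increment
  tfae_finish
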